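/- **Corollary.** A leader contributor system $\mathcal{S}=(D,a^0,P_L,P_C)$ consists of a finite data domain $D$ with an initial memory value $a^0\in D$, and of two finite automata, the leader $P_L=(Q_L,q_L^0,\delta_L)$ and the contributor $P_C=(Q_C,q_C^0,\delta_C)$, whose transitions are labelled by writes $!a$ and reads $?a$ ($a\in D$) of a shared memory cell or by the internal label $\varepsilon$. A configuration with $t\in\mathbb{N}$ contributors is a tuple $(q,a,\mathit{pc})\in Q_L\times D\times Q_C^t$; in a step, either the leader or one contributor takes one of its transitions, where a write $!b$ changes the memory value to $b$, a read $?b$ is possible only if the memory value is $b$ and leaves it unchanged, and $\varepsilon$ leaves it unchanged. The leader contributor liveness problem asks, given $\mathcal{S}$ and $F\subseteq Q_L$, whether for some $t\in\mathbb{N}$ there is an infinite sequence of steps starting in $(q_L^0,a^0,(q_C^0,\dots,q_C^0))$ along which some leader state in $F$ occurs infinitely often. Let $\mathtt{L}=|Q_L|$, $\mathtt{D}=|D|$ and $\mathtt{C}=|Q_C|$. There is a deterministic algorithm that solves the leader contributor liveness problem in time $$\mathcal{O}\bigl(2^{\mathtt{C}}\cdot \mathtt{L}\cdot \mathtt{D}^2\cdot(\mathtt{L}\cdot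 \mathtt{C}^4+\mathtt{D}\cdot \mathtt{C}^2+\mathtt{L}^2\cdot \mathtt{D}^3)\bigr).$$ Here time is the number of steps of a random access machine with unit cost for arithmetic ($+$, truncated $-$, $\cdot$, integer division and remainder), comparisons and memory accesses, with numbers bounded by $\mathcal{O}$ of the same expression, i.e. with words of length logarithmic in that bound; states and data values are given as numbers and the transition relations and $F$ as $0/1$ tables. -/

import Mathlib

/-! ### Leader contributor systems -/

/-- Memory operations over a data domain `D`: write a value or read a value.
Labels of transitions are elements of `Option (MemOp D)`, where `none` is the internal label `ε`. -/
inductive MemOp (D : Type) : Type where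
  | write (a : D) : MemOp D
  | read (a : D) : MemOp D

/-- A leader contributor system with data domain `D`, leader states `QL` and contributor
states `QC` (the three are taken to be finite where the system is used as an input). -/
structure LCSystem (D QL QC : Type) where
  /-- initial memory value -/
  memInit : D
  /-- initial state of the leader -/
  leaderInit : QL
  /-- transition relation of the leader -/
  leaderTrans : Set (QL × Option (MemOp D) × QL)
  /-- initial state of the contributors -/
  contribInit : QC
  /-- transition relation of the contributors -/
  contribTrans : Set (QC × Option (MemOp D) × QC)

namespace LCSystem

variable {D QL QC : Type}

/-- Configurations with `t` contributors. -/
structure Config (D QL QC : Type) (t : ℕ) where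
  leader : QL
  mem : D
  contrib : Fin t → QC

/-- `MemStep o a b`: the label `o` can be executed when the memory holds `a`, and the memory
holds `b` afterwards. -/
inductive MemStep : Option (MemOp D) → D → D → Prop where
  | write (a b : D) : MemStep (some (MemOp.write b)) a b
  | read (a : D) : MemStep (some (MemOp.read a)) a a
  | eps (a : D) : MemStep none a a

/-- The labelled transition relation between configurations with `t` contributors: either
the leader or one of the contributors takes a transition. -/
inductive Step (S : LCSystem D QL QC) {t : ℕ} :
    Config D QL QC t → Option (MemOp D) → Config D QL QC t → Prop where
  | leader {q q' : QL} {a b : D} {pc : Fin t → QC} {o : Option (MemOp D)}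
      (hδ : (q, o, q') ∈ S.leaderTrans) (hm : MemStep o a b) :
      Step S ⟨q, a, pc⟩ o ⟨q', b, pc⟩
  | contrib {q : QL} {a b : D} {pc : Fin t → QC} {o : Option (MemOp D)} {p' : QC} (i : Fin t)
      (hδ : (pc i, o, p') ∈ S.contribTrans) (hm : MemStep o a b) :
      Step S ⟨q, a, pc⟩ o ⟨q, b, Function.update pc i p'⟩

/-- The initial configuration with `t` contributors. -/
def initConfig (S : LCSystem D QL QC) (t : ℕ) : Config D QL QC t :=
  ⟨S.leaderInit, S.memInit, fun _ => S.contribInit⟩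

/-- `σ` is an infinite computation: an infinite sequence of transitions. -/
def IsComputation (S : LCSystem D QL QC) {t : ℕ} (σ : ℕ → Config D QL QC t) : Prop :=
  ∀ i, ∃ o, S.Step (σ i) o (σ (i + 1))

/-- The leader states that occur infinitely often along `σ`. -/
def infStates {t : ℕ} (σ : ℕ → Config D QL QC t) : Set QL :=
  {q | ∃ᶠ i in Filter.atTop, (σ i).leader = q}

/-- The question of leader contributor liveness: for some number of contributors there is an
initialized infinite computation along which the leader visits `F` infinitely often. -/
def Live (S : LCSystem D QL QC) (F : Set QL) : Prop :=
  ∃ (t : ℕ) (σ : ℕ → Config D QL QC t),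
    σ 0 = S.initConfig t ∧ S.IsComputation σ ∧ (infStates σ ∩ F).Nonempty

end LCSystem

/-! ### Random access machine with unit cost and bounded words -/

namespace RAM

/-- The memory: registers `reg 0, reg 1, …` and arrays `arr 0, arr 1, …` of numbers. A program
mentions only finitely many registers and arrays by name. -/
structure State where
  reg : ℕ → ℕ
  arr : ℕ → ℕ → ℕ

/-- Operands of instructions: the content of a register, or a fixed number. -/
inductive Operand where
  | reg (r : ℕ) : Operand
  | const (n : ℕ) : Operand

/-- Value of an operand. -/
def Operand.val (s : State) : Operand → ℕ
  | .reg r => s.reg r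
  | .const n => n

/-- Arithmetic operations: truncated subtraction, integer division (`x / 0 = 0`), remainder. -/
inductive ArithOp where
  | add | sub | mul | div | mod

/-- Value of an arithmetic operation. -/
def ArithOp.eval : ArithOp → ℕ → ℕ → ℕ
  | .add, x, y => x + y
  | .sub, x, y => x - y
  | .mul, x, y => x * y
  | .div, x, y => x / y
  | .mod, x, y => x % y

/-- Programs. -/
inductive Prog where
  | skip : Prog
  /-- `reg r := x op y` -/
  | assign (r : ℕ) (op : ArithOp) (x y : Operand) : Prog
  /-- `reg r := arr A [x]` -/
  | load (r A : ℕ) (x : Operand) : Prog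
  /-- `arr A [x] := y` -/
  | store (A : ℕ) (x y : Operand) : Prog
  | seq (p q : Prog) : Prog
  /-- `if x < y then p else q` -/
  | ifLt (x y : Operand) (p q : Prog) : Prog
  /-- `while x < y do p` -/
  | whileLt (x y : Operand) (p : Prog) : Prog

/-- Write to a register. -/
def State.setReg (s : State) (r v : ℕ) : State :=
  ⟨Function.update s.reg r v, s.arr⟩

/-- Write to an array cell. -/
def State.setArr (s : State) (A i v : ℕ) : State :=
  ⟨s.reg, Function.update s.arr A (Function.update (s.arr A) i v)⟩

/-- `Exec W p s n s'`: started in `s`, the program `p` halts in `s'` after exactly `n` steps,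
and no number exceeding `W` is computed on the way (a program that computes such a number gets
stuck). Each instruction and each evaluation of a test counts one step. -/
inductive Exec (W : ℕ) : Prog → State → ℕ → State → Prop where
  | skip (s : State) : Exec W .skip s 1 s
  | assign (s : State) (r : ℕ) (op : ArithOp) (x y : Operand)
      (h : op.eval (x.val s) (y.val s) ≤ W) :
      Exec W (.assign r op x y) s 1 (s.setReg r (op.eval (x.val s) (y.val s)))
  | load (s : State) (r A : ℕ) (x : Operand) :
      Exec W (.load r A x) s 1 (s.setReg r (s.arr A (x.val s)))
  | store (s : State) (A : ℕ) (x y : Operand) :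
      Exec W (.store A x y) s 1 (s.setArr A (x.val s) (y.val s))
  | seq {p q : Prog} {s s₁ s₂ : State} {m n : ℕ}
      (hp : Exec W p s m s₁) (hq : Exec W q s₁ n s₂) : Exec W (.seq p q) s (m + n) s₂
  | ifTrue {x y : Operand} {p q : Prog} {s s₁ : State} {n : ℕ}
      (h : x.val s < y.val s) (hp : Exec W p s n s₁) : Exec W (.ifLt x y p q) s (n + 1) s₁
  | ifFalse {x y : Operand} {p q : Prog} {s s₁ : State} {n : ℕ}
      (h : ¬ x.val s < y.val s) (hq : Exec W q s n s₁) : Exec W (.ifLt x y p q) s (n + 1) s₁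
  | whileTrue {x y : Operand} {p : Prog} {s s₁ s₂ : State} {m n : ℕ}
      (h : x.val s < y.val s) (hp : Exec W p s m s₁) (hw : Exec W (.whileLt x y p) s₁ n s₂) :
      Exec W (.whileLt x y p) s (m + n + 1) s₂
  | whileFalse {x y : Operand} {p : Prog} {s : State}
      (h : ¬ x.val s < y.val s) : Exec W (.whileLt x y p) s 1 s

end RAM

/-! ### Instances as inputs of the machine -/

namespace LCSystem

open Classical in
/-- The characteristic table of a set of numbers. -/
noncomputable def charTable (A : Set ℕ) : ℕ → ℕ := fun i => if i ∈ A then 1 else 0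

/-- Positions of the transitions of an automaton with states `0, …, m - 1` that are labelled by
`op b` for some data value `b`; the transition `(q, op b, q')` has position
`(q * d + b) * m + q'`. -/
def labelledPos {d m : ℕ} (δ : Set (Fin m × Option (MemOp (Fin d)) × Fin m))
    (op : Fin d → MemOp (Fin d)) : Set ℕ :=
  {i | ∃ (q : Fin m) (b : Fin d) (q' : Fin m),
    (q, some (op b), q') ∈ δ ∧ i = ((q : ℕ) * d + b) * m + q'}

/-- Positions of the internal transitions; `(q, ε, q')` has position `q * m + q'`. -/
def epsPos {d m : ℕ} (δ : Set (Fin m × Option (MemOp (Fin d)) × Fin m)) : Set ℕ :=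
  {i | ∃ q q' : Fin m, (q, none, q') ∈ δ ∧ i = (q : ℕ) * m + q'}

/-- The initial memory of the machine for a system with data domain `{0, …, d - 1}`, leader
states `{0, …, l - 1}`, contributor states `{0, …, c - 1}`, and final states `F`. Registers
`0` to `5` hold `l`, `d`, `c`, the initial memory value and the two initial states, arrays
`0` to `5` hold the transition tables, array `6` the table of `F`. All else is zero. -/
noncomputable def encode {d l c : ℕ} (S : LCSystem (Fin d) (Fin l) (Fin c)) (F : Set (Fin l)) :
    RAM.State where
  reg
    | 0 => l
    | 1 => d
    | 2 => c
    | 3 => S.memInit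
    | 4 => S.leaderInit
    | 5 => S.contribInit
    | _ => 0
  arr
    | 0 => charTable (labelledPos S.leaderTrans MemOp.write)
    | 1 => charTable (labelledPos S.leaderTrans MemOp.read)
    | 2 => charTable (epsPos S.leaderTrans)
    | 3 => charTable (labelledPos S.contribTrans MemOp.write)
    | 4 => charTable (labelledPos S.contribTrans MemOp.read)
    | 5 => charTable (epsPos S.contribTrans)
    | 6 => charTable {i | ∃ q ∈ F, i = (q : ℕ)}
    | _ => fun _ => 0

/-- The time bound `2^C · L · D² · (L · C⁴ + D · C² + L² · D³)`. -/
def timeBound (L D C : ℕ) : ℕ :=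
  2 ^ C * L * D ^ 2 * (L * C ^ 4 + D * C ^ 2 + L ^ 2 * D ^ 3)

end LCSystem

/-! Contributors are anonymous and there may be arbitrarily many of them, so whatever one
contributor does, others can repeat at once: a write rewrites the same value, a read is still
enabled, an internal move is harmless. Hence a contributor state that has been reached once can be
populated in any quantity, and a finite computation matters only through the set `T` of contributor
states seen so far, the leader state and the memory value. This is `AReach`, justified by
`exists_aReach` and `AReach.cSteps`.

For fixed `t` there are finitely many configurations, so a live computation repeats one whose leader
state lies in `F`. Let `V` be the set of memory values along that loop. Each contributor comes back
to its own state, so each of its moves lies on a cycle of moves out of `T` with labels over `V`,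
which is `Good`. Leader and memory run through a closed walk in which the memory may also jump to
any value written by a good move, so all of `V` occurs in the strongly connected component of the
starting node: `V ⊆ next S T n₀ V`. `Accept` says that something moves at all.

Conversely, from such a `V` one builds a closed walk of leader and memory in which every contributor
move is made by a contributor of its own, and adds good moves until every contributor state is left
as often as it is entered (`exists_absorb`, `exists_balance`, `exists_cycle`). The walk then
restores the multiset of contributor states and can be repeated for ever. This gives
`live_iff_aLive`. Since `next` and `Accept` are monotone, only the greatest fixed point of `next`
has to be tested, and `D` iterations from the full set reach it (`exists_accept_iff`).

For the algorithm, `T` is a number below `2 ^ C`. A move that adds a state to `T` increases this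
number, so the layers of abstract reachability can be computed in increasing order of `T`. At each
node of a layer with a final leader state, `next` is iterated. One iteration costs `C * (C * C + C *
D)` for searches in the contributor graph and `(L * D) ^ 2` for building and searching the graph of
leader and memory. In total this is of order `2 ^ C * L * D ^ 2 * (C ^ 3 + C ^ 2 * D + L ^ 2 * D ^
2)`, which is within the bound. The program is verified with total correctness triples whose time
bounds have the form constant times size, so that constants and loop lengths are tracked separately.
-/

namespace LCSystem

open Relation

/-! ### The copycat abstraction and the abstract condition for a cycle. -/

section Abstraction

variable {D QL : Type} {C : ℕ}

/-- Reachability in the copycat abstraction: the bits of `T` are the contributor states that can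
be occupied by arbitrarily many contributors. -/
inductive AReach (S : LCSystem D QL (Fin C)) : ℕ → QL → D → Prop where
  | init : AReach S (2 ^ (S.contribInit : ℕ)) S.leaderInit S.memInit
  | leader {T : ℕ} {q q' : QL} {a b : D} {o : Option (MemOp D)} (h : AReach S T q a)
      (hδ : (q, o, q') ∈ S.leaderTrans) (hm : MemStep o a b) : AReach S T q' b
  | contrib {T : ℕ} {q : QL} {a b : D} {o : Option (MemOp D)} {p p' : Fin C}
      (h : AReach S T q a) (hp : T.testBit p = true)
      (hδ : (p, o, p') ∈ S.contribTrans) (hm : MemStep o a b) :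
      AReach S (T ||| 2 ^ (p' : ℕ)) q b

/-- Labels that only mention values in `V`. -/
inductive LabelIn (V : Set D) : Option (MemOp D) → Prop where
  | eps : LabelIn V none
  | write {b : D} (h : b ∈ V) : LabelIn V (some (MemOp.write b))
  | read {b : D} (h : b ∈ V) : LabelIn V (some (MemOp.read b))

/-- Contributor moves from a state in `T` with a label over `V`. -/
def CEdge (S : LCSystem D QL (Fin C)) (T : ℕ) (V : Set D) (p p' : Fin C) : Prop :=
  T.testBit p = true ∧ ∃ o, LabelIn V o ∧ (p, o, p') ∈ S.contribTrans

/-- Contributor transitions that lie on a cycle of `CEdge`. -/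
def Good (S : LCSystem D QL (Fin C)) (T : ℕ) (V : Set D) (p : Fin C) (o : Option (MemOp D))
    (p' : Fin C) : Prop :=
  T.testBit p = true ∧ LabelIn V o ∧ (p, o, p') ∈ S.contribTrans ∧
    ReflTransGen (CEdge S T V) p' p

/-- Values written by good transitions. -/
def Writable (S : LCSystem D QL (Fin C)) (T : ℕ) (V : Set D) : Set D :=
  {b | ∃ p p', Good S T V p (some (MemOp.write b)) p'}

/-- Moves of the leader and the memory, when the contributors can write the values in `G`. -/
def MStep (S : LCSystem D QL (Fin C)) (G : Set D) (n n' : QL × D) : Prop :=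
  (∃ o, (n.1, o, n'.1) ∈ S.leaderTrans ∧ MemStep o n.2 n'.2) ∨ (n'.1 = n.1 ∧ n'.2 ∈ G)

/-- Memory values in the strongly connected component of `n₀`. -/
def next (S : LCSystem D QL (Fin C)) (T : ℕ) (n₀ : QL × D) (V : Set D) : Set D :=
  {x | ∃ q, ReflTransGen (MStep S (Writable S T V)) n₀ (q, x) ∧
    ReflTransGen (MStep S (Writable S T V)) (q, x) n₀}

/-- There is a nonempty cycle: a contributor moves, or the leader or the memory do. -/
def Accept (S : LCSystem D QL (Fin C)) (T : ℕ) (n₀ : QL × D) (V : Set D) : Prop :=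
  (∃ p o p', Good S T V p o p') ∨
    ∃ n, MStep S (Writable S T V) n₀ n ∧ ReflTransGen (MStep S (Writable S T V)) n n₀

variable {S : LCSystem D QL (Fin C)} {T : ℕ}

lemma AReach.lt {q : QL} {a : D} (h : AReach S T q a) : T < 2 ^ C := by
  induction h with
  | init => exact Nat.pow_lt_pow_right (by norm_num) S.contribInit.2
  | leader _ _ _ ih => exact ih
  | @contrib T q a b o p p' _ _ _ _ ih =>
    exact Nat.or_lt_two_pow ih (Nat.pow_lt_pow_right (by norm_num) p'.2)

lemma LabelIn.mono {V V' : Set D} (h : V ⊆ V') {o : Option (MemOp D)} (ho : LabelIn V o) :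
    LabelIn V' o := by
  cases ho with
  | eps => exact .eps
  | write hb => exact .write (h hb)
  | read hb => exact .read (h hb)

lemma CEdge.mono {V V' : Set D} (h : V ⊆ V') {p p' : Fin C} (he : CEdge S T V p p') :
    CEdge S T V' p p' :=
  ⟨he.1, he.2.imp fun _ ho => ⟨ho.1.mono h, ho.2⟩⟩

lemma Good.mono {V V' : Set D} (h : V ⊆ V') {p p' : Fin C} {o : Option (MemOp D)}
    (he : Good S T V p o p') : Good S T V' p o p' :=
  ⟨he.1, he.2.1.mono h, he.2.2.1, he.2.2.2.lift id fun _ _ => CEdge.mono h⟩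

lemma Writable.mono {V V' : Set D} (h : V ⊆ V') : Writable S T V ⊆ Writable S T V' :=
  fun _ ⟨p, p', hg⟩ => ⟨p, p', hg.mono h⟩

lemma MStep.mono {G G' : Set D} (h : G ⊆ G') {n n' : QL × D} (hs : MStep S G n n') :
    MStep S G' n n' :=
  hs.imp_right fun hb => ⟨hb.1, h hb.2⟩

lemma next_mono (n₀ : QL × D) : Monotone (next S T n₀) := by
  rintro V V' h x ⟨q, h₁, h₂⟩
  exact ⟨q, h₁.lift id fun _ _ => MStep.mono (Writable.mono h),
    h₂.lift id fun _ _ => MStep.mono (Writable.mono h)⟩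

lemma Accept.mono {n₀ : QL × D} {V V' : Set D} (h : V ⊆ V') (ha : Accept S T n₀ V) :
    Accept S T n₀ V' := by
  rcases ha with ⟨p, o, p', hg⟩ | ⟨n, h₁, h₂⟩
  · exact .inl ⟨p, o, p', hg.mono h⟩
  · exact .inr ⟨n, h₁.mono (Writable.mono h),
      h₂.lift id fun _ _ => MStep.mono (Writable.mono h)⟩

/-! ### From computations to the abstraction -/

lemma exists_repetition {α : Type*} [Finite α] (σ : ℕ → α) (P : α → Prop)
    (h : ∃ᶠ i in Filter.atTop, P (σ i)) : ∃ i j, i < j ∧ σ i = σ j ∧ P (σ i) := by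
  have hinf : {i | P (σ i)}.Infinite := Nat.frequently_atTop_iff_infinite.1 h
  obtain ⟨i, hi, j, hj, hne, heq⟩ :=
    hinf.exists_ne_map_eq_of_mapsTo (t := Set.univ) (f := σ) (fun _ _ => trivial) Set.finite_univ
  rcases lt_or_gt_of_ne hne with h | h
  · exact ⟨i, j, h, heq, hi⟩
  · exact ⟨j, i, h, heq.symm, hj⟩

instance {D QL QC : Type} [Finite D] [Finite QL] [Finite QC] (t : ℕ) :
    Finite (Config D QL QC t) :=
  Finite.of_injective (fun c : Config D QL QC t => (c.leader, c.mem, c.contrib)) (by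
    rintro ⟨_, _, _⟩ ⟨_, _, _⟩ h
    simp only [Prod.mk.injEq] at h
    obtain ⟨rfl, rfl, rfl⟩ := h
    rfl)

/-- The contributor states seen up to time `n` are abstractly available at time `n`. -/
lemma exists_aReach {t : ℕ} {σ : ℕ → Config D QL (Fin C) t} (h0 : σ 0 = S.initConfig t)
    (hσ : S.IsComputation σ) (n : ℕ) :
    ∃ T, AReach S T (σ n).leader (σ n).mem ∧
      ∀ k ≤ n, ∀ i, T.testBit ((σ k).contrib i) = true := by
  induction n with
  | zero =>
    refine ⟨_, by rw [h0]; exact AReach.init, ?_⟩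
    intro k hk i
    obtain rfl : k = 0 := by omega
    simp [h0, initConfig]
  | succ n ih =>
    obtain ⟨T, hT, hb⟩ := ih
    obtain ⟨o, ho⟩ := hσ n
    have key : ∃ T', AReach S T' (σ (n + 1)).leader (σ (n + 1)).mem ∧
        (∀ k, T.testBit k = true → T'.testBit k = true) ∧
        ∀ i, T'.testBit ((σ (n + 1)).contrib i) = true := by
      have hbn := hb n le_rfl
      generalize σ n = c at *
      generalize σ (n + 1) = c' at *
      cases ho with
      | leader hδ hm => exact ⟨T, hT.leader hδ hm, fun _ h => h, hbn⟩
      | @contrib q a b pc o p' i hδ hm =>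
        refine ⟨_, hT.contrib (hbn i) hδ hm, ?_, ?_⟩
        · intro k hk
          simp [hk]
        · intro j
          by_cases hj : j = i
          · subst hj
            simp
          · have := hbn j
            simp only at this
            simp [hj, this]
    obtain ⟨T', h₁, h₂, h₃⟩ := key
    refine ⟨T', h₁, ?_⟩
    intro k hk i
    rcases Nat.lt_or_ge k (n + 1) with h | h
    · exact h₂ _ (hb k (by omega) i)
    · obtain rfl : k = n + 1 := by omega
      exact h₃ i

lemma reflTransGen_of_seq {α : Type*} {r : α → α → Prop} {f : ℕ → α} {i j : ℕ} (hij : i ≤ j)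
    (h : ∀ k, i ≤ k → k < j → ReflTransGen r (f k) (f (k + 1))) : ReflTransGen r (f i) (f j) := by
  induction j, hij using Nat.le_induction with
  | base => exact .refl
  | succ j hj ih =>
    exact (ih fun k hk hkj => h k hk (by omega)).trans (h j hj (by omega))

/-- A label mentions at most one value, and for reads and writes alike this is the value in memory
after the step. -/
lemma MemStep.labelIn {V : Set D} {o : Option (MemOp D)} {a b : D} (h : MemStep o a b)
    (hb : b ∈ V) : LabelIn V o := by
  cases h with
  | write => exact .write hb
  | read => exact .read hb
  | eps => exact .eps

/-- The abstract condition that characterizes liveness. -/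
def ALive (S : LCSystem D QL (Fin C)) (F : Set QL) : Prop :=
  ∃ T q a, q ∈ F ∧ AReach S T q a ∧ ∃ V, V ⊆ next S T (q, a) V ∧ Accept S T (q, a) V

lemma aLive_of_live [Finite D] [Finite QL] {F : Set QL} (h : S.Live F) : ALive S F := by
  obtain ⟨t, σ, h0, hσ, f, hinf, hf⟩ := h
  obtain ⟨i, j, hij, heq, hi⟩ := exists_repetition σ (fun c => c.leader = f) hinf
  -- `T` is taken at the end of the loop, so that it contains every contributor state occupied
  -- during the loop.
  obtain ⟨T, hT, hb⟩ := exists_aReach h0 hσ j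
  rw [← heq, hi] at hT
  let V : Set D := {x | ∃ k, i ≤ k ∧ k ≤ j ∧ (σ k).mem = x}
  let nd : ℕ → QL × D := fun k => ((σ k).leader, (σ k).mem)
  have hndi : nd i = (f, (σ i).mem) := by simp [nd, hi]
  have hndj : nd j = (f, (σ i).mem) := by rw [← hndi]; simp [nd, heq]
  have hmem : ∀ k, i ≤ k → k ≤ j → (σ k).mem ∈ V := fun k h₁ h₂ => ⟨k, h₁, h₂, rfl⟩
  have hmove : ∀ m k, i ≤ k → k < j →
      ReflTransGen (CEdge S T V) ((σ k).contrib m) ((σ (k + 1)).contrib m) := by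
    intro m k hik hkj
    obtain ⟨o, ho⟩ := hσ k
    have h₁ := hb k (by omega) m
    have h₂ := hmem (k + 1) (by omega) (by omega)
    generalize σ k = c at *
    generalize σ (k + 1) = c' at *
    cases ho with
    | leader => exact .refl
    | @contrib q a b pc o p' l hδ hm =>
      by_cases hl : m = l
      · subst hl
        refine .single ⟨h₁, o, hm.labelIn h₂, ?_⟩
        simpa using hδ
      · simp only [Function.update_of_ne hl]
        exact .refl
  have hstep : ∀ k, i ≤ k → k < j →
      MStep S (Writable S T V) (nd k) (nd (k + 1)) ∨
        (nd (k + 1) = nd k ∧ ∃ p o p', Good S T V p o p') := by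
    intro k hik hkj
    obtain ⟨o, ho⟩ := hσ k
    have h₁ := hb k (by omega)
    have h₂ := hmem (k + 1) (by omega) (by omega)
    -- Every contributor finds its way back: follow it to time `j`, where it is in its state of time
    -- `i`, and then from `i` to `k`.
    have h₃ : ∀ m, ReflTransGen (CEdge S T V) ((σ (k + 1)).contrib m) ((σ k).contrib m) := by
      intro m
      have e₁ := reflTransGen_of_seq (f := fun k => (σ k).contrib m) (show k + 1 ≤ j by omega)
        fun l hl hlj => hmove m l (by omega) hlj
      have e₂ := reflTransGen_of_seq (f := fun k => (σ k).contrib m) hik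
        fun l hl hlj => hmove m l (by omega) (by omega)
      simp only [heq] at e₂
      exact e₁.trans e₂
    simp only [nd]
    generalize σ k = c at *
    generalize σ (k + 1) = c' at *
    cases ho with
    | leader hδ hm => exact .inl (.inl ⟨o, hδ, hm⟩)
    | @contrib q a b pc o p' l hδ hm =>
      have hg : Good S T V (pc l) o p' := by
        refine ⟨h₁ l, hm.labelIn h₂, hδ, ?_⟩
        simpa using h₃ l
      cases hm with
      | write => exact .inl (.inr ⟨rfl, _, _, hg⟩)
      | read => exact .inr ⟨rfl, _, _, _, hg⟩
      | eps => exact .inr ⟨rfl, _, _, _, hg⟩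
  have hstep' : ∀ k, i ≤ k → k < j →
      ReflTransGen (MStep S (Writable S T V)) (nd k) (nd (k + 1)) := by
    intro k h₁ h₂
    rcases hstep k h₁ h₂ with h | ⟨h, -⟩
    · exact .single h
    · rw [h]
  refine ⟨T, f, _, hf, hT, V, ?_, ?_⟩
  · rintro x ⟨k, hik, hkj, rfl⟩
    refine ⟨(σ k).leader, ?_, ?_⟩
    · rw [← hndi]
      exact reflTransGen_of_seq hik fun l hl hlj => hstep' l (by omega) (by omega)
    · rw [← hndj]
      exact reflTransGen_of_seq hkj fun l hl hlj => hstep' l (by omega) (by omega)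
  -- The first step of the loop already yields `Accept`: it is either an edge on a closed walk
  -- through the node, or a good move that leaves the node unchanged.
  · rcases hstep i le_rfl hij with h | ⟨-, h⟩
    · refine .inr ⟨nd (i + 1), hndi ▸ h, ?_⟩
      rw [← hndj]
      exact reflTransGen_of_seq hij fun l hl hlj => hstep' l (by omega) (by omega)
    · exact .inl h

/-! ### From the abstraction to computations -/

/-- Steps between configurations whose contributors are given as a multiset of states. -/
inductive CStep (S : LCSystem D QL (Fin C)) :
    QL × D × Multiset (Fin C) → QL × D × Multiset (Fin C) → Prop where
  | leader {q q' : QL} {a b : D} {o : Option (MemOp D)} (m : Multiset (Fin C))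
      (hδ : (q, o, q') ∈ S.leaderTrans) (hm : MemStep o a b) : CStep S (q, a, m) (q', b, m)
  | contrib {a b : D} {o : Option (MemOp D)} {p p' : Fin C} (q : QL) (m : Multiset (Fin C))
      (hδ : (p, o, p') ∈ S.contribTrans) (hm : MemStep o a b) :
      CStep S (q, a, p ::ₘ m) (q, b, p' ::ₘ m)

/-- The multiset of contributor states of a configuration. -/
def Config.count {t : ℕ} (c : Config D QL (Fin C) t) : QL × D × Multiset (Fin C) :=
  (c.leader, c.mem, Finset.univ.val.map c.contrib)

lemma CStep.lift {t : ℕ} {c : Config D QL (Fin C) t} {x : QL × D × Multiset (Fin C)}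
    (h : CStep S c.count x) : ∃ c' o, S.Step c o c' ∧ c'.count = x := by
  obtain ⟨q, a, pc⟩ := c
  generalize hx : Config.count ⟨q, a, pc⟩ = y at h
  cases h with
  | leader m hδ hm =>
    simp only [Config.count, Prod.mk.injEq] at hx
    obtain ⟨rfl, rfl, rfl⟩ := hx
    exact ⟨_, _, .leader hδ hm, rfl⟩
  | @contrib a' b o p p' q' m hδ hm =>
    simp only [Config.count, Prod.mk.injEq] at hx
    obtain ⟨rfl, rfl, hx⟩ := hx
    have hp : p ∈ Finset.univ.val.map pc := by rw [hx]; simp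
    obtain ⟨i, -, rfl⟩ := Multiset.mem_map.1 hp
    refine ⟨_, _, .contrib i hδ hm, ?_⟩
    have hi : (Finset.univ : Finset (Fin t)).val = i ::ₘ (Finset.univ.erase i).val := by
      rw [← Finset.insert_val_of_notMem (Finset.notMem_erase _ _), Finset.insert_erase (by simp)]
    rw [hi, Multiset.map_cons] at hx
    have hx' := (Multiset.cons_inj_right _).1 hx
    simp only [Config.count, Prod.mk.injEq, true_and]
    rw [hi, Multiset.map_cons, Function.update_self, ← hx']
    congr 1
    refine Multiset.map_congr rfl fun j hj => ?_
    rw [Finset.mem_val, Finset.mem_erase] at hj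
    rw [Function.update_of_ne hj.1]

/-- The copycat argument: after the first move the memory holds `b`, and the same label leads from
`b` to `b`, so the remaining copies can follow. -/
lemma cSteps_replicate {o : Option (MemOp D)} {a b : D} {p p' : Fin C}
    (hδ : (p, o, p') ∈ S.contribTrans) (hm : MemStep o a b) (q : QL) (m : Multiset (Fin C))
    (k : ℕ) :
    ReflTransGen (CStep S) (q, a, Multiset.replicate (k + 1) p + m)
      (q, b, Multiset.replicate (k + 1) p' + m) := by
  have hb : MemStep o b b := by cases hm <;> constructor
  induction k generalizing m with
  | zero =>
    refine .single ?_
    simpa using CStep.contrib q m hδ hm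
  | succ k ih =>
    have h₁ := ih (p ::ₘ m)
    have h₂ := CStep.contrib q (Multiset.replicate (k + 1) p' + m) hδ hb
    rw [Multiset.replicate_succ p, Multiset.replicate_succ p', Multiset.cons_add,
      Multiset.cons_add]
    rw [Multiset.add_cons, Multiset.add_cons] at h₁
    exact h₁.tail h₂

/-- Abstractly reachable configurations are reachable with arbitrarily many contributors in each
of the available states. -/
lemma AReach.cSteps {q : QL} {a : D} (h : AReach S T q a) (M : Multiset (Fin C))
    (hM : ∀ p ∈ M, T.testBit p = true) :
    ∃ t m, ReflTransGen (CStep S)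
      (S.leaderInit, S.memInit, Multiset.replicate t S.contribInit) (q, a, M + m) := by
  induction h generalizing M with
  | init =>
    refine ⟨M.card, 0, ?_⟩
    have : M = Multiset.replicate M.card S.contribInit := by
      refine Multiset.eq_replicate.2 ⟨rfl, fun p hp => ?_⟩
      have := hM p hp
      rw [Nat.testBit_two_pow] at this
      exact Fin.ext (by simpa [eq_comm] using this)
    rw [add_zero, ← this]
  | leader h hδ hm ih =>
    obtain ⟨t, m, hr⟩ := ih M hM
    exact ⟨t, m, hr.tail (.leader _ hδ hm)⟩
  | @contrib T q a b o p p' h hp hδ hm ih =>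
    classical
    -- The copies of `p'` in `M` are obtained from copies of `p`. One more copy is requested so that
    -- the move is made, and the memory updated, even if `p'` does not occur in `M`; the surplus
    -- `p'` joins the remainder.
    obtain ⟨t, m, hr⟩ := ih (Multiset.replicate (M.count p' + 1) p + M.filter (· ≠ p')) (by
      intro x hx
      rw [Multiset.mem_add, Multiset.mem_replicate, Multiset.mem_filter] at hx
      rcases hx with ⟨-, rfl⟩ | ⟨hx, hne⟩
      · exact hp
      · have := hM x hx
        rw [Nat.testBit_or, Nat.testBit_two_pow] at this
        simpa [Fin.val_ne_of_ne (Ne.symm hne)] using this)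
    refine ⟨t, p' ::ₘ m, ?_⟩
    rw [add_assoc] at hr
    refine (hr.trans (cSteps_replicate hδ hm q _ _)).trans (Eq.subst (motive := fun x =>
      ReflTransGen (CStep S) (q, b, x) _) ?_ .refl)
    have : M = Multiset.replicate (M.count p') p' + M.filter (· ≠ p') := by
      rw [← Multiset.filter_eq', Multiset.filter_add_not]
    conv_lhs => rw [this]
    simp [Multiset.replicate_succ, Multiset.add_cons, add_assoc]

/-- `Walk S T n l E n'`: `l` steps lead from `n` to `n'`, each contributor move being made by a
contributor of its own; `E` collects these moves. -/
inductive Walk (S : LCSystem D QL (Fin C)) (n₀ : QL × D) :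
    ℕ → Multiset (Fin C × Fin C) → QL × D → Prop where
  | nil : Walk S n₀ 0 0 n₀
  | leader {q q' : QL} {a b : D} {l : ℕ} {E : Multiset (Fin C × Fin C)} {o : Option (MemOp D)}
      (h : Walk S n₀ l E (q, a)) (hδ : (q, o, q') ∈ S.leaderTrans) (hm : MemStep o a b) :
      Walk S n₀ (l + 1) E (q', b)
  | contrib {q : QL} {a b : D} {l : ℕ} {E : Multiset (Fin C × Fin C)} {o : Option (MemOp D)}
      {p p' : Fin C} (h : Walk S n₀ l E (q, a)) (hδ : (p, o, p') ∈ S.contribTrans)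
      (hm : MemStep o a b) : Walk S n₀ (l + 1) ((p, p') ::ₘ E) (q, b)

lemma Walk.trans {n₁ n₂ n₃ : QL × D} {l l' : ℕ} {E E' : Multiset (Fin C × Fin C)}
    (h : Walk S n₁ l E n₂) (h' : Walk S n₂ l' E' n₃) : Walk S n₁ (l + l') (E + E') n₃ := by
  induction h' with
  | nil => simpa using h
  | leader _ hδ hm ih => exact ih.leader hδ hm
  | contrib _ hδ hm ih =>
    rw [Multiset.add_cons]
    exact ih.contrib hδ hm

lemma Walk.eq_zero {n n' : QL × D} {l : ℕ} {E : Multiset (Fin C × Fin C)}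
    (h : Walk S n l E n') (hl : l = 0) : E = 0 := by
  cases h with
  | nil => rfl
  | leader => omega
  | contrib => omega

/-- As each move has a contributor of its own, which waits at the source before and at the target
afterwards, the moves impose no condition on their order. -/
lemma Walk.cSteps {n n' : QL × D} {l : ℕ} {E : Multiset (Fin C × Fin C)}
    (h : Walk S n l E n') (M : Multiset (Fin C)) :
    ReflTransGen (CStep S) (n.1, n.2, E.map Prod.fst + M) (n'.1, n'.2, E.map Prod.snd + M) ∧
      (0 < l → TransGen (CStep S) (n.1, n.2, E.map Prod.fst + M)
        (n'.1, n'.2, E.map Prod.snd + M)) := by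
  induction h generalizing M with
  | nil => exact ⟨.refl, fun h => absurd h (by simp)⟩
  | leader h hδ hm ih =>
    have := TransGen.tail' (ih M).1 (.leader _ hδ hm)
    exact ⟨this.to_reflTransGen, fun _ => this⟩
  | @contrib q a b l E o p p' h hδ hm ih =>
    have h₁ := (ih (p ::ₘ M)).1
    rw [Multiset.add_cons, Multiset.add_cons] at h₁
    have := TransGen.tail' h₁ (.contrib q _ hδ hm)
    simp only [Multiset.map_cons, Multiset.cons_add]
    exact ⟨this.to_reflTransGen, fun _ => this⟩

/-- Pairs of contributor states joined by a good transition. -/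
def GoodPair (S : LCSystem D QL (Fin C)) (T : ℕ) (V : Set D) (e : Fin C × Fin C) : Prop :=
  ∃ o, Good S T V e.1 o e.2

variable {V : Set D}

lemma exists_walk_of_mSteps {n n' : QL × D} (h : ReflTransGen (MStep S (Writable S T V)) n n') :
    ∃ l E, Walk S n l E n' ∧ ∀ e ∈ E, GoodPair S T V e := by
  induction h with
  | refl => exact ⟨0, 0, .nil, by simp⟩
  | @tail b c _ hs ih =>
    obtain ⟨l, E, hw, hE⟩ := ih
    obtain ⟨q, x⟩ := b
    obtain ⟨q', y⟩ := c
    rcases hs with ⟨o, hδ, hm⟩ | ⟨hq, p, p', hg⟩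
    · exact ⟨_, E, hw.leader hδ hm, hE⟩
    · simp only at hq
      subst hq
      refine ⟨_, _, hw.contrib hg.2.2.1 (.write x y), ?_⟩
      simp only [Multiset.mem_cons, forall_eq_or_imp]
      exact ⟨⟨_, hg⟩, hE⟩

lemma exists_walk_of_mStep {n n' : QL × D} (h : MStep S (Writable S T V) n n') :
    ∃ E, Walk S n 1 E n' ∧ ∀ e ∈ E, GoodPair S T V e := by
  obtain ⟨q, x⟩ := n
  obtain ⟨q', y⟩ := n'
  rcases h with ⟨o, hδ, hm⟩ | ⟨hq, p, p', hg⟩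
  · exact ⟨0, Walk.nil.leader hδ hm, by simp⟩
  · simp only at hq
    subst hq
    refine ⟨_, Walk.nil.contrib hg.2.2.1 (.write x y), ?_⟩
    simpa using ⟨_, hg⟩

lemma Walk.replicate {q : QL} {x : D} {p p' : Fin C} {o : Option (MemOp D)}
    (hδ : (p, o, p') ∈ S.contribTrans) (hm : MemStep o x x) (k : ℕ) :
    Walk S (q, x) k (Multiset.replicate k (p, p')) (q, x) := by
  induction k with
  | zero => exact .nil
  | succ k ih =>
    rw [Multiset.replicate_succ]
    exact ih.contrib hδ hm

/-- Some closed walk can be extended by any number of copies of a given good pair. -/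
lemma exists_absorb_pair {n₀ : QL × D} (hV : V ⊆ next S T n₀ V) {e : Fin C × Fin C}
    (he : GoodPair S T V e) :
    ∃ B, (∀ e ∈ B, GoodPair S T V e) ∧
      ∀ k, ∃ l, Walk S n₀ l (B + Multiset.replicate k e) n₀ := by
  obtain ⟨p, p'⟩ := e
  obtain ⟨o, -, ho, hδ, -⟩ := he
  have key : ∀ b ∈ V, MemStep o b b → ∃ B, (∀ e ∈ B, GoodPair S T V e) ∧
      ∀ k, ∃ l, Walk S n₀ l (B + Multiset.replicate k (p, p')) n₀ := by
    -- By `V ⊆ next S T n₀ V` some node with memory `b` lies in the component of `n₀`. There the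
    -- move can be repeated without leaving the node, so only the way there and back contributes to
    -- `B`.
    intro b hb hm
    obtain ⟨q, h₁, h₂⟩ := hV hb
    obtain ⟨l₁, E₁, hw₁, hE₁⟩ := exists_walk_of_mSteps h₁
    obtain ⟨l₂, E₂, hw₂, hE₂⟩ := exists_walk_of_mSteps h₂
    refine ⟨E₁ + E₂, ?_, fun k => ⟨l₁ + k + l₂, ?_⟩⟩
    · intro e he
      rcases Multiset.mem_add.1 he with h | h
      exacts [hE₁ e h, hE₂ e h]
    · have := (hw₁.trans (Walk.replicate hδ hm k)).trans hw₂
      rwa [add_right_comm E₁] at this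
  cases ho with
  | eps => exact ⟨0, by simp, fun k => ⟨_, by simpa using Walk.replicate hδ (.eps n₀.2) k⟩⟩
  | write hb => exact key _ hb (.write _ _)
  | read hb => exact key _ hb (.read _)

/-- Concatenate the closed walks of the single pairs. It is essential that `B` does not depend on
`X`: the moves that balance a walk can be absorbed without creating new moves to be balanced. -/
lemma exists_absorb {n₀ : QL × D} (hV : V ⊆ next S T n₀ V) (s : Finset (Fin C × Fin C))
    (hs : ∀ e ∈ s, GoodPair S T V e) :
    ∃ B, (∀ e ∈ B, GoodPair S T V e) ∧
      ∀ X : Multiset (Fin C × Fin C), (∀ e ∈ X, e ∈ s) → ∃ l, Walk S n₀ l (B + X) n₀ := by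
  induction s using Finset.induction_on with
  | empty =>
    refine ⟨0, by simp, fun X hX => ⟨0, ?_⟩⟩
    rw [Multiset.eq_zero_of_forall_notMem (s := X) fun e he => by simpa using hX e he]
    exact .nil
  | insert e s hes ih =>
    obtain ⟨B, hB, hB'⟩ := ih fun e he => hs e (Finset.mem_insert_of_mem he)
    obtain ⟨B₁, hB₁, hB₁'⟩ := exists_absorb_pair hV (hs e (Finset.mem_insert_self _ _))
    refine ⟨B + B₁, ?_, fun X hX => ?_⟩
    · intro e he
      rcases Multiset.mem_add.1 he with h | h
      exacts [hB e h, hB₁ e h]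
    · obtain ⟨l, hl⟩ := hB' (X.filter (· ≠ e)) (by
        intro x hx
        rw [Multiset.mem_filter] at hx
        exact (Finset.mem_insert.1 (hX x hx.1)).resolve_left hx.2)
      obtain ⟨l', hl'⟩ := hB₁' (X.count e)
      refine ⟨l + l', ?_⟩
      have h := hl.trans hl'
      have hX' : X.filter (· ≠ e) + Multiset.replicate (X.count e) e = X := by
        rw [← Multiset.filter_eq', add_comm, Multiset.filter_add_not]
      rwa [add_add_add_comm, hX'] at h

/-- Along a path from `p` to `u`, sources and targets telescope. Each edge is good because `u` leads
back to `p`, which closes a cycle through it. -/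
lemma exists_return {p u : Fin C} (h : ReflTransGen (CEdge S T V) p u)
    (h' : ReflTransGen (CEdge S T V) u p) :
    ∃ X : Multiset (Fin C × Fin C), (∀ e ∈ X, GoodPair S T V e) ∧
      X.map Prod.fst + {u} = X.map Prod.snd + {p} := by
  induction h with
  | refl => exact ⟨0, by simp, rfl⟩
  | @tail b c hb hs ih =>
    obtain ⟨X, hX, hX'⟩ := ih (h'.head hs)
    obtain ⟨hT, o, ho, hδ⟩ := hs
    refine ⟨(b, c) ::ₘ X, ?_, ?_⟩
    · simp only [Multiset.mem_cons, forall_eq_or_imp]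
      exact ⟨⟨o, hT, ho, hδ, h'.trans hb⟩, hX⟩
    · simp only [Multiset.map_cons, Multiset.cons_add, ← hX']
      simp only [← Multiset.singleton_add]
      abel

/-- For each pair in `B` add a path from its target back to its source; this path exists because the
pair is good. -/
lemma exists_balance (B : Multiset (Fin C × Fin C)) (hB : ∀ e ∈ B, GoodPair S T V e) :
    ∃ X : Multiset (Fin C × Fin C), (∀ e ∈ X, GoodPair S T V e) ∧
      (B + X).map Prod.fst = (B + X).map Prod.snd := by
  induction B using Multiset.induction_on with
  | empty => exact ⟨0, by simp, rfl⟩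
  | cons e B ih =>
    obtain ⟨X, hX, hX'⟩ := ih fun e he => hB e (Multiset.mem_cons_of_mem he)
    obtain ⟨o, hg⟩ := hB e (Multiset.mem_cons_self _ _)
    obtain ⟨Y, hY, hY'⟩ := exists_return hg.2.2.2 (.single ⟨hg.1, o, hg.2.1, hg.2.2.1⟩)
    refine ⟨X + Y, ?_, ?_⟩
    · intro e he
      rcases Multiset.mem_add.1 he with h | h
      exacts [hX e h, hY e h]
    · have : e ::ₘ B + (X + Y) = (B + X) + (Y + {e}) := by
        rw [← Multiset.singleton_add]; abel
      rw [this, Multiset.map_add, Multiset.map_add _ (B + X), hX',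
        Multiset.map_add _ Y, Multiset.map_singleton, Multiset.map_add _ Y,
        Multiset.map_singleton, hY']

/-- The abstract cycle is realized by a nonempty cycle on multisets. -/
lemma exists_cycle {n₀ : QL × D} (hV : V ⊆ next S T n₀ V) (hA : Accept S T n₀ V) :
    ∃ M : Multiset (Fin C), (∀ p ∈ M, T.testBit p = true) ∧
      ∀ m, TransGen (CStep S) (n₀.1, n₀.2, M + m) (n₀.1, n₀.2, M + m) := by
  classical
  obtain ⟨B, hB, hB'⟩ := exists_absorb hV (Finset.univ.filter (GoodPair S T V)) (by simp)
  have hext : ∃ l E, Walk S n₀ l E n₀ ∧ (∀ e ∈ E, GoodPair S T V e) ∧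
      (0 < l ∨ ∃ e, GoodPair S T V e) := by
    rcases hA with ⟨p, o, p', hg⟩ | ⟨n, h₁, h₂⟩
    · exact ⟨0, 0, .nil, by simp, .inr ⟨(p, p'), o, hg⟩⟩
    · obtain ⟨E₁, hw₁, hE₁⟩ := exists_walk_of_mStep h₁
      obtain ⟨l₂, E₂, hw₂, hE₂⟩ := exists_walk_of_mSteps h₂
      refine ⟨_, _, hw₁.trans hw₂, ?_, .inl (by omega)⟩
      intro e he
      rcases Multiset.mem_add.1 he with h | h
      exacts [hE₁ e h, hE₂ e h]
  obtain ⟨l, E, hw, hE, hpos⟩ := hext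
  -- `Accept` may come from a contributor move alone, with an empty walk at hand. Then `Y` contains
  -- one good pair, and a walk that makes this move cannot have length zero.
  have hY : ∃ Y : Multiset (Fin C × Fin C), (∀ e ∈ Y, GoodPair S T V e) ∧
      (0 < l ∨ Y ≠ 0) := by
    rcases hpos with h | ⟨e, he⟩
    · exact ⟨0, by simp, .inl h⟩
    · exact ⟨{e}, by simpa using he, .inr (by simp)⟩
  obtain ⟨Y, hY, hpos⟩ := hY
  obtain ⟨X, hX, hbal⟩ := exists_balance (E + B + Y) (by
    intro e he
    rcases Multiset.mem_add.1 he with h | h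
    · rcases Multiset.mem_add.1 h with h | h
      exacts [hE e h, hB e h]
    · exact hY e h)
  have hXY : ∀ e ∈ Y + X, GoodPair S T V e := by
    intro e he
    rcases Multiset.mem_add.1 he with h | h
    exacts [hY e h, hX e h]
  obtain ⟨l', hw'⟩ := hB' (Y + X) (by simpa using hXY)
  have hcl := hw.trans hw'
  have hass : E + (B + (Y + X)) = E + B + Y + X := by abel
  rw [hass] at hcl
  have hl : 0 < l + l' := by
    by_contra hcon
    have h0 := hcl.eq_zero (by omega)
    rcases hpos with h | h
    · omega
    · simp at h0
      exact h h0.1.2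
  refine ⟨(E + B + Y + X).map Prod.fst, ?_, fun m => ?_⟩
  · intro p hp
    obtain ⟨e, he, rfl⟩ := Multiset.mem_map.1 hp
    have : GoodPair S T V e := by
      rw [← hass, ← add_assoc] at he
      rcases Multiset.mem_add.1 he with h | h
      · rcases Multiset.mem_add.1 h with h | h
        exacts [hE e h, hB e h]
      · exact hXY e h
    exact this.choose_spec.1
  · have := (hcl.cSteps m).2 hl
    rwa [← hbal] at this

lemma cSteps_lift {t : ℕ} {x y : QL × D × Multiset (Fin C)} (h : ReflTransGen (CStep S) x y)
    {c : Config D QL (Fin C) t} (hc : c.count = x) :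
    ∃ c', ReflTransGen (fun c c' => ∃ o, S.Step c o c') c c' ∧ c'.count = y := by
  induction h with
  | refl => exact ⟨c, .refl, hc⟩
  | tail _ hs ih =>
    obtain ⟨c', hc', rfl⟩ := ih
    obtain ⟨c'', o, ho, hc''⟩ := hs.lift
    exact ⟨c'', hc'.tail ⟨o, ho⟩, hc''⟩

lemma cSteps_lift_pos {t : ℕ} {x y : QL × D × Multiset (Fin C)} (h : TransGen (CStep S) x y)
    {c : Config D QL (Fin C) t} (hc : c.count = x) :
    ∃ c', TransGen (fun c c' => ∃ o, S.Step c o c') c c' ∧ c'.count = y := by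
  obtain ⟨z, hz, hs⟩ := TransGen.tail'_iff.1 h
  obtain ⟨c', hc', rfl⟩ := cSteps_lift hz hc
  obtain ⟨c'', o, ho, hc''⟩ := hs.lift
  exact ⟨c'', .tail' hc' ⟨o, ho⟩, hc''⟩

/-- If `X` can be reached, and reached again by at least one step from each of its elements,
then some infinite path visits `X` infinitely often. -/
lemma exists_recurrent_path {α : Type*} {r : α → α → Prop} {X : Set α} {x₀ : α}
    (h₀ : ∃ x ∈ X, ReflTransGen r x₀ x) (hX : ∀ x ∈ X, ∃ y ∈ X, TransGen r x y) :
    ∃ σ : ℕ → α, σ 0 = x₀ ∧ (∀ i, r (σ i) (σ (i + 1))) ∧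
      ∃ᶠ i in Filter.atTop, σ i ∈ X := by
  -- `P n x` says that `X` can be reached from `x` in exactly `n` steps. The path carries such an
  -- `n` along and decreases it whenever it is not zero, so it is always bound to meet `X` again.
  let P : ℕ → α → Prop := fun n => Nat.rec (fun x => x ∈ X) (fun _ P x => ∃ y, r x y ∧ P y) n
  have hP0 : ∀ x, P 0 x ↔ x ∈ X := fun x => Iff.rfl
  have hPs : ∀ n x, P (n + 1) x ↔ ∃ y, r x y ∧ P n y := fun n x => Iff.rfl
  have hreach : ∀ x, (∃ y ∈ X, ReflTransGen r x y) → ∃ n, P n x := by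
    rintro x ⟨y, hy, h⟩
    induction h using ReflTransGen.head_induction_on with
    | refl => exact ⟨0, hy⟩
    | head hs _ ih =>
      obtain ⟨n, hn⟩ := ih
      exact ⟨n + 1, _, hs, hn⟩
  have hsucc : ∀ s : {s : ℕ × α // P s.1 s.2}, ∃ s' : {s : ℕ × α // P s.1 s.2},
      r s.1.2 s'.1.2 ∧ (s.1.1 ≠ 0 → s'.1.1 < s.1.1) := by
    rintro ⟨⟨n, x⟩, hn⟩
    rcases n with _ | n
    · obtain ⟨y, hy, hxy⟩ := hX x hn
      obtain ⟨z, hz, hzy⟩ := TransGen.head'_iff.1 hxy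
      obtain ⟨m, hm⟩ := hreach z ⟨y, hy, hzy⟩
      exact ⟨⟨(m, z), hm⟩, hz, by simp⟩
    · obtain ⟨y, hxy, hy⟩ := hn
      exact ⟨⟨(n, y), hy⟩, hxy, by simp⟩
  choose nx hr hlt using hsucc
  obtain ⟨n₀, hn₀⟩ := hreach x₀ h₀
  let τ : ℕ → {s : ℕ × α // P s.1 s.2} := fun i => nx^[i] ⟨(n₀, x₀), hn₀⟩
  have hτ : ∀ i, τ (i + 1) = nx (τ i) := fun i => Function.iterate_succ_apply' _ _ _
  refine ⟨fun i => (τ i).1.2, rfl, fun i => ?_, ?_⟩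
  · simp only [hτ]
    exact hr _
  · rw [Filter.frequently_atTop]
    intro i
    have : ∀ n j, (τ j).1.1 = n → ∃ k ≥ j, (τ k).1.2 ∈ X := by
      intro n
      induction n using Nat.strong_induction_on with
      | _ n ih =>
        intro j hj
        by_cases hn : n = 0
        · refine ⟨j, le_rfl, ?_⟩
          have := (τ j).2
          rwa [hj, hn] at this
        · have := hlt (τ j) (by omega)
          rw [← hτ] at this
          obtain ⟨k, hk, hkX⟩ := ih _ (hj ▸ this) (j + 1) rfl
          exact ⟨k, by omega, hkX⟩
    exact this _ i rfl

/-- A round of the cycle restores the multiset of contributor states but may permute the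
contributors. The computation therefore returns to a set of configurations and not to a single one,
which is what `exists_recurrent_path` is made for. -/
lemma live_of_aLive {F : Set QL} (h : ALive S F) : S.Live F := by
  obtain ⟨T, f, a, hf, hT, V, hV, hA⟩ := h
  obtain ⟨M, hM, hcyc⟩ := exists_cycle hV hA
  obtain ⟨t, m, hr⟩ := hT.cSteps M hM
  have hinit : (S.initConfig t).count =
      (S.leaderInit, S.memInit, Multiset.replicate t S.contribInit) := by
    simp [Config.count, initConfig]
  obtain ⟨σ, h0, hσ, hinf⟩ := exists_recurrent_path
    (r := fun c c' : Config D QL (Fin C) t => ∃ o, S.Step c o c')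
    (X := {c | c.count = (f, a, M + m)}) (x₀ := S.initConfig t) (by
      obtain ⟨c, hc, hc'⟩ := cSteps_lift hr hinit
      exact ⟨c, hc', hc⟩) (by
      intro c hc
      obtain ⟨c', hc, hc'⟩ := cSteps_lift_pos (hcyc m) hc
      exact ⟨c', hc', hc⟩)
  refine ⟨t, σ, h0, hσ, f, hinf.mono fun i hi => ?_, hf⟩
  exact congrArg Prod.fst hi

theorem live_iff_aLive [Finite D] [Finite QL] {F : Set QL} : S.Live F ↔ ALive S F :=
  ⟨aLive_of_live, live_of_aLive⟩

/-! ### The greatest fixed point by iteration -/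

/-- The iterates decrease, and each one that is not yet fixed loses an element; a set with `d`
elements allows this at most `d` times. -/
lemma iterate_univ_fixed {d : ℕ} {g : Set (Fin d) → Set (Fin d)} (hg : Monotone g) :
    g (g^[d] Set.univ) = g^[d] Set.univ := by
  have hanti : ∀ k, g^[k + 1] Set.univ ⊆ g^[k] Set.univ := by
    intro k
    induction k with
    | zero => exact Set.subset_univ _
    | succ k ih =>
      have := hg ih
      rwa [← Function.iterate_succ_apply' g, ← Function.iterate_succ_apply' g] at this
  have hstep : ∀ k, g (g^[k] Set.univ) = g^[k] Set.univ →
      g (g^[k + 1] Set.univ) = g^[k + 1] Set.univ := by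
    intro k hk
    rw [Function.iterate_succ_apply', hk, hk]
  have hcard : ∀ k, g (g^[k] Set.univ) = g^[k] Set.univ ∨ (g^[k] Set.univ).ncard + k ≤ d := by
    intro k
    induction k with
    | zero => exact .inr (by simp [Set.ncard_univ])
    | succ k ih =>
      rcases ih with h | h
      · exact .inl (hstep k h)
      · by_cases he : g (g^[k] Set.univ) = g^[k] Set.univ
        · exact .inl (hstep k he)
        · right
          have := hanti k
          rw [Function.iterate_succ_apply'] at this ⊢
          have := Set.ncard_lt_ncard (this.ssubset_of_ne he) (Set.toFinite _)
          omega
  rcases hcard d with h | h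
  · exact h
  · have h0 : g^[d] Set.univ = ∅ := by
      rw [← Set.ncard_eq_zero (Set.toFinite _)]
      omega
    have := hanti d
    rw [Function.iterate_succ_apply', h0, Set.subset_empty_iff] at this
    rw [h0, this]

/-- By monotonicity every `V` with `V ⊆ next S T n₀ V` lies below all iterates from the top. The
iterate of order `d` is fixed, hence the largest such `V`, and `Accept` is monotone. -/
lemma exists_accept_iff {d : ℕ} {S : LCSystem (Fin d) QL (Fin C)} {n₀ : QL × Fin d} :
    (∃ V, V ⊆ next S T n₀ V ∧ Accept S T n₀ V) ↔
      Accept S T n₀ ((next S T n₀)^[d] Set.univ) := by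
  constructor
  · rintro ⟨V, hV, hA⟩
    refine hA.mono ?_
    have : ∀ k, V ⊆ (next S T n₀)^[k] Set.univ := by
      intro k
      induction k with
      | zero => exact Set.subset_univ _
      | succ k ih =>
        rw [Function.iterate_succ_apply']
        exact hV.trans (next_mono n₀ ih)
    exact this d
  · intro h
    exact ⟨_, (iterate_univ_fixed (next_mono n₀)).ge, h⟩

end Abstraction

end LCSystem

namespace RAM

/-! ### Expressions and structured programs -/

/-- Expressions over registers and arrays. -/
inductive Ex where
  | const (n : ℕ) : Ex
  | var (r : ℕ) : Ex
  | get (A : ℕ) (e : Ex) : Ex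
  | bin (op : ArithOp) (x y : Ex) : Ex

namespace Ex

/-- Value of an expression, in terms of the contents of registers and arrays. -/
def eval (ρ : ℕ → ℕ) (a : ℕ → ℕ → ℕ) : Ex → ℕ
  | const n => n
  | var r => ρ r
  | get A e => a A (e.eval ρ a)
  | bin op x y => op.eval (x.eval ρ a) (y.eval ρ a)

/-- No arithmetic operation exceeds `W`. -/
def Ok (W : ℕ) (ρ : ℕ → ℕ) (a : ℕ → ℕ → ℕ) : Ex → Prop
  | const _ => True
  | var _ => True
  | get _ e => e.Ok W ρ a
  | bin op x y => x.Ok W ρ a ∧ y.Ok W ρ a ∧ op.eval (x.eval ρ a) (y.eval ρ a) ≤ W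

/-- Only registers below `k` occur. -/
def Below (k : ℕ) : Ex → Prop
  | const _ => True
  | var r => r < k
  | get _ e => e.Below k
  | bin _ x y => x.Below k ∧ y.Below k

/-- The array `A` does not occur. -/
def Avoids (A : ℕ) : Ex → Prop
  | const _ => True
  | var _ => True
  | get B e => B ≠ A ∧ e.Avoids A
  | bin _ x y => x.Avoids A ∧ y.Avoids A

/-- Code that evaluates an expression, using registers from `k` on. -/
def code (k : ℕ) : Ex → Prog
  | const _ => .skip
  | var _ => .skip
  | get A e => .seq (e.code k) (.load k A (match e with
      | const n => .const n
      | var r => .reg r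
      | _ => .reg k))
  | bin op x y => .seq (x.code k) (.seq (y.code (k + 1)) (.assign k op (match x with
      | const n => .const n
      | var r => .reg r
      | _ => .reg k) (match y with
      | const n => .const n
      | var r => .reg r
      | _ => .reg (k + 1))))

/-- Where `code k` leaves the value. -/
def opd (k : ℕ) : Ex → Operand
  | const n => .const n
  | var r => .reg r
  | _ => .reg k

/-- Number of steps of the code. -/
def size : Ex → ℕ
  | const _ => 1
  | var _ => 1
  | get _ e => e.size + 1
  | bin _ x y => x.size + (y.size + 1)

lemma code_get (k A : ℕ) (e : Ex) :
    (get A e).code k = .seq (e.code k) (.load k A (e.opd k)) := by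
  cases e <;> rfl

lemma code_bin (k : ℕ) (op : ArithOp) (x y : Ex) :
    (bin op x y).code k =
      .seq (x.code k) (.seq (y.code (k + 1)) (.assign k op (x.opd k) (y.opd (k + 1)))) := by
  cases x <;> cases y <;> rfl

lemma eval_congr {ρ ρ' : ℕ → ℕ} {a : ℕ → ℕ → ℕ} {k : ℕ} (h : ∀ r < k, ρ' r = ρ r) :
    ∀ {e : Ex}, e.Below k → e.eval ρ' a = e.eval ρ a
  | const _, _ => rfl
  | var _, he => h _ he
  | get A e, he => by
    have := eval_congr (a := a) h (e := e) he
    simp only [eval, this]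
  | bin _ x y, he => by
    have h₁ := eval_congr (a := a) h (e := x) he.1
    have h₂ := eval_congr (a := a) h (e := y) he.2
    simp only [eval, h₁, h₂]

lemma ok_congr {W : ℕ} {ρ ρ' : ℕ → ℕ} {a : ℕ → ℕ → ℕ} {k : ℕ} (h : ∀ r < k, ρ' r = ρ r) :
    ∀ {e : Ex}, e.Below k → (e.Ok W ρ' a ↔ e.Ok W ρ a)
  | const _, _ => Iff.rfl
  | var _, _ => Iff.rfl
  | get A e, he => ok_congr (a := a) h (e := e) he
  | bin _ x y, he => by
    simp only [Ok, ok_congr (a := a) h he.1, ok_congr (a := a) h he.2, eval_congr h he.1,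
      eval_congr h he.2]

lemma opd_val_congr {s s' : State} {k k' : ℕ} {e : Ex} (he : e.Below k)
    (h : ∀ r < k, s'.reg r = s.reg r) (h' : s'.reg k' = s.reg k') :
    (e.opd k').val s' = (e.opd k').val s := by
  cases e with
  | const => rfl
  | var r => exact h r he
  | get => exact h'
  | bin => exact h'

/-- The expression reads registers below `k`, while scratch registers start at `k' ≥ k`. The second
operand is evaluated from `k' + 1` on, so it does not destroy the first one in `k'`. -/
lemma exec_code {W : ℕ} (e : Ex) : ∀ (k k' : ℕ) (s : State), e.Below k → k ≤ k' →
    e.Ok W s.reg s.arr → ∃ s', Exec W (e.code k') s e.size s' ∧ s'.arr = s.arr ∧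
      (∀ r < k', s'.reg r = s.reg r) ∧ (e.opd k').val s' = e.eval s.reg s.arr := by
  induction e with
  | const n => exact fun k k' s _ _ _ => ⟨s, .skip s, rfl, fun _ _ => rfl, rfl⟩
  | var r => exact fun k k' s _ _ _ => ⟨s, .skip s, rfl, fun _ _ => rfl, rfl⟩
  | get A e ih =>
    intro k k' s hb hk hok
    obtain ⟨s₁, h₁, ha, hr, hv⟩ := ih k k' s hb hk hok
    rw [code_get]
    refine ⟨_, .seq h₁ (.load _ _ _ _), ha, ?_, ?_⟩
    · intro r hr'
      simp only [State.setReg, Function.update_of_ne hr'.ne, hr r hr']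
    · change Function.update s₁.reg k' (s₁.arr A ((e.opd k').val s₁)) k' = _
      rw [Function.update_self, hv, ha, eval]
  | bin op x y ihx ihy =>
    intro k k' s hb hk hok
    obtain ⟨s₁, h₁, ha₁, hr₁, hv₁⟩ := ihx k k' s hb.1 hk hok.1
    have hr₁' : ∀ r < k, s₁.reg r = s.reg r := fun r hr => hr₁ r (by omega)
    obtain ⟨s₂, h₂, ha₂, hr₂, hv₂⟩ := ihy k (k' + 1) s₁ hb.2 (by omega) (by
      rw [ha₁]; exact (ok_congr hr₁' hb.2).2 hok.2.1)
    rw [ha₁, eval_congr hr₁' hb.2] at hv₂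
    have hvx : (x.opd k').val s₂ = x.eval s.reg s.arr := by
      rw [← hv₁]
      exact opd_val_congr hb.1 (fun r hr => hr₂ r (by omega)) (hr₂ _ (by omega))
    rw [code_bin]
    refine ⟨_, .seq h₁ (.seq h₂ (.assign _ _ _ _ _ ?_)), ?_, ?_, ?_⟩
    · rw [hvx, hv₂]; exact hok.2.2
    · simp only [State.setReg, ha₂, ha₁]
    · intro r hr
      simp only [State.setReg, Function.update_of_ne hr.ne, hr₂ r (by omega), hr₁ r hr]
    · change Function.update s₂.reg k' (op.eval ((x.opd k').val s₂) ((y.opd (k' + 1)).val s₂)) k' = _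
      rw [Function.update_self, hvx, hv₂, eval]

end Ex

/-- `A[e₁] := e₂` -/
def storeE (k A : ℕ) (e₁ e₂ : Ex) : Prog :=
  .seq (e₁.code k) (.seq (e₂.code (k + 1)) (.store A (e₁.opd k) (e₂.opd (k + 1))))

/-- `if e₁ < e₂ then p else q` -/
def ifE (k : ℕ) (e₁ e₂ : Ex) (p q : Prog) : Prog :=
  .seq (e₁.code k) (.seq (e₂.code (k + 1)) (.ifLt (e₁.opd k) (e₂.opd (k + 1)) p q))

/-- Register `k` runs from `0` to `e - 1`; register `k + 1` holds the bound. -/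
def forE (k : ℕ) (e : Ex) (p : Prog) : Prog :=
  .seq (e.code (k + 1)) (.seq (.assign (k + 1) .add (e.opd (k + 1)) (.const 0))
    (.seq (.assign k .add (.const 0) (.const 0))
      (.whileLt (.reg k) (.reg (k + 1)) (.seq p (.assign k .add (.reg k) (.const 1))))))

/-- Register `k` is set to `e` for the execution of `p`. -/
def letE (k : ℕ) (e : Ex) (p : Prog) : Prog :=
  .seq (e.code k) (.seq (.assign k .add (e.opd k) (.const 0)) p)

/-- Registers below `k` as in `ρ`, then `i` and `N`. -/
def push (ρ : ℕ → ℕ) (k i N : ℕ) : ℕ → ℕ := fun r => if r < k then ρ r else if r = k then i else N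

/-- Total correctness with a time bound: started with `ρ` in the registers below `k` and `a` in
the arrays, the program halts within `n` steps, leaves the registers below `k` unchanged, and the
arrays satisfy `Q`. -/
def T (W : ℕ) (p : Prog) (k n : ℕ) (ρ : ℕ → ℕ) (a : ℕ → ℕ → ℕ) (Q : (ℕ → ℕ → ℕ) → Prop) : Prop :=
  ∀ s : State, (∀ r < k, s.reg r = ρ r) → s.arr = a →
    ∃ m s', Exec W p s m s' ∧ m ≤ n ∧ (∀ r < k, s'.reg r = ρ r) ∧ Q s'.arr

/-! ### Rules for total correctness with time bounds. -/

section Rules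

variable {W k n : ℕ} {p q : Prog} {ρ : ℕ → ℕ} {a : ℕ → ℕ → ℕ} {Q : (ℕ → ℕ → ℕ) → Prop}

lemma T.conseq {Q' : (ℕ → ℕ → ℕ) → Prop} (h : T W p k n ρ a Q) (hQ : ∀ a', Q a' → Q' a') :
    T W p k n ρ a Q' := by
  intro s hs ha
  obtain ⟨m, s', h₁, h₂, h₃, h₄⟩ := h s hs ha
  exact ⟨m, s', h₁, h₂, h₃, hQ _ h₄⟩

lemma T.mono {n' : ℕ} (h : T W p k n ρ a Q) (hn : n ≤ n') : T W p k n' ρ a Q := by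
  intro s hs ha
  obtain ⟨m, s', h₁, h₂, h₃, h₄⟩ := h s hs ha
  exact ⟨m, s', h₁, h₂.trans hn, h₃, h₄⟩

/-- Bounds of the form `c * m`. -/
lemma T.weaken {c m c' m' : ℕ} (h : T W p k (c * m) ρ a Q) (hc : c ≤ c') (hm : m ≤ m') :
    T W p k (c' * m') ρ a Q :=
  h.mono (Nat.mul_le_mul hc hm)

/-- Serves to call, at level `k`, a procedure that is stated for a fixed higher level `k'`; the
registers in between may hold anything. -/
lemma T.lift {k' : ℕ} (hk : k ≤ k') (h : ∀ ρ', (∀ r < k, ρ' r = ρ r) → T W p k' n ρ' a Q) :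
    T W p k n ρ a Q := by
  intro s hs ha
  obtain ⟨m, s', h₁, h₂, h₃, h₄⟩ := h s.reg hs s (fun _ _ => rfl) ha
  exact ⟨m, s', h₁, h₂, fun r hr => (h₃ r (by omega)).trans (hs r hr), h₄⟩

/-- Both parts are measured in the same unit `m`, so that only the constants add up. -/
lemma T.seq {c₁ c₂ m : ℕ} {R : (ℕ → ℕ → ℕ) → Prop} (hp : T W p k (c₁ * m) ρ a R)
    (hq : ∀ a', R a' → T W q k (c₂ * m) ρ a' Q) :
    T W (.seq p q) k ((c₁ + c₂) * m) ρ a Q := by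
  intro s hs ha
  obtain ⟨n₁, s₁, h₁, hn₁, hs₁, hR⟩ := hp s hs ha
  obtain ⟨n₂, s₂, h₂, hn₂, hs₂, hQ⟩ := hq _ hR s₁ hs₁ rfl
  exact ⟨_, s₂, .seq h₁ h₂, by rw [add_mul]; omega, hs₂, hQ⟩

lemma T.skip {m : ℕ} (hm : 1 ≤ m) (hQ : Q a) : T W .skip k (1 * m) ρ a Q :=
  fun s hs ha => ⟨1, s, .skip s, by omega, hs, ha ▸ hQ⟩

/-- Write to an array cell. -/
def upd (a : ℕ → ℕ → ℕ) (A i v : ℕ) : ℕ → ℕ → ℕ :=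
  Function.update a A (Function.update (a A) i v)

lemma exec_pair {e₁ e₂ : Ex} (h₁ : e₁.Below k) (h₂ : e₂.Below k) (hok₁ : e₁.Ok W ρ a)
    (hok₂ : e₂.Ok W ρ a) {s : State} (hs : ∀ r < k, s.reg r = ρ r) (ha : s.arr = a) :
    ∃ s₁ s', Exec W (e₁.code k) s e₁.size s₁ ∧ Exec W (e₂.code (k + 1)) s₁ e₂.size s' ∧
      s'.arr = a ∧ (∀ r < k, s'.reg r = ρ r) ∧ (e₁.opd k).val s' = e₁.eval ρ a ∧
      (e₂.opd (k + 1)).val s' = e₂.eval ρ a := by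
  subst ha
  obtain ⟨s₁, hx₁, ha₁, hr₁, hv₁⟩ := Ex.exec_code e₁ k k s h₁ le_rfl ((Ex.ok_congr hs h₁).2 hok₁)
  have hr₁' : ∀ r < k, s₁.reg r = ρ r := fun r hr => (hr₁ r hr).trans (hs r hr)
  obtain ⟨s₂, hx₂, ha₂, hr₂, hv₂⟩ := Ex.exec_code e₂ k (k + 1) s₁ h₂ (by omega)
    (by rw [ha₁]; exact (Ex.ok_congr hr₁' h₂).2 hok₂)
  refine ⟨s₁, s₂, hx₁, hx₂, ha₂.trans ha₁, ?_, ?_, ?_⟩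
  · exact fun r hr => (hr₂ r (by omega)).trans (hr₁' r hr)
  · rw [Ex.opd_val_congr h₁ (fun r hr => hr₂ r (by omega)) (hr₂ _ (by omega)), hv₁,
      Ex.eval_congr hs h₁]
  · rw [hv₂, ha₁, Ex.eval_congr hr₁' h₂]

lemma T.store {A m : ℕ} {e₁ e₂ : Ex} (h₁ : e₁.Below k) (h₂ : e₂.Below k) (hok₁ : e₁.Ok W ρ a)
    (hok₂ : e₂.Ok W ρ a) (hm : 1 ≤ m) (hQ : Q (upd a A (e₁.eval ρ a) (e₂.eval ρ a))) :
    T W (storeE k A e₁ e₂) k ((e₁.size + e₂.size + 1) * m) ρ a Q := by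
  intro s hs ha
  obtain ⟨s₁, s₂, hx₁, hx₂, ha₂, hr₂, hv₁, hv₂⟩ := exec_pair h₁ h₂ hok₁ hok₂ hs ha
  refine ⟨_, _, .seq hx₁ (.seq hx₂ (.store _ _ _ _)), ?_, hr₂, ?_⟩
  · nlinarith
  · simp only [State.setArr, hv₁, hv₂, ha₂]
    exact hQ

lemma T.ite {c m : ℕ} {e₁ e₂ : Ex} (h₁ : e₁.Below k) (h₂ : e₂.Below k) (hok₁ : e₁.Ok W ρ a)
    (hok₂ : e₂.Ok W ρ a) (hm : 1 ≤ m)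
    (hp : e₁.eval ρ a < e₂.eval ρ a → T W p k (c * m) ρ a Q)
    (hq : ¬ e₁.eval ρ a < e₂.eval ρ a → T W q k (c * m) ρ a Q) :
    T W (ifE k e₁ e₂ p q) k ((c + (e₁.size + e₂.size + 1)) * m) ρ a Q := by
  intro s hs ha
  obtain ⟨s₁, s₂, hx₁, hx₂, ha₂, hr₂, hv₁, hv₂⟩ := exec_pair h₁ h₂ hok₁ hok₂ hs ha
  by_cases hc : e₁.eval ρ a < e₂.eval ρ a
  · obtain ⟨n, s', hx, hn, hr, hQ⟩ := hp hc s₂ hr₂ ha₂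
    refine ⟨_, s', .seq hx₁ (.seq hx₂ (.ifTrue (by rwa [hv₁, hv₂]) hx)), ?_, hr, hQ⟩
    nlinarith
  · obtain ⟨n, s', hx, hn, hr, hQ⟩ := hq hc s₂ hr₂ ha₂
    refine ⟨_, s', .seq hx₁ (.seq hx₂ (.ifFalse (by rwa [hv₁, hv₂]) hx)), ?_, hr, hQ⟩
    nlinarith

lemma T.when {c m : ℕ} {e₁ e₂ : Ex} (h₁ : e₁.Below k) (h₂ : e₂.Below k) (hok₁ : e₁.Ok W ρ a)
    (hok₂ : e₂.Ok W ρ a) (hm : 1 ≤ m) (hc : 1 ≤ c)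
    (hp : e₁.eval ρ a < e₂.eval ρ a → T W p k (c * m) ρ a Q)
    (hq : ¬ e₁.eval ρ a < e₂.eval ρ a → Q a) :
    T W (ifE k e₁ e₂ p .skip) k ((c + (e₁.size + e₂.size + 1)) * m) ρ a Q :=
  T.ite h₁ h₂ hok₁ hok₂ hm hp fun h => (T.skip hm (hq h)).weaken hc le_rfl

/-- Induction on the number `j` of remaining rounds. The counter climbs up to `N`, which therefore
must fit into a word. Each round pays two extra steps, for the test and the increment. -/
lemma exec_while {m : ℕ} (I : ℕ → (ℕ → ℕ → ℕ) → Prop) {N : ℕ} (hN : N ≤ W)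
    (hp : ∀ i < N, ∀ a', I i a' → T W p (k + 2) m (push ρ k i N) a' (I (i + 1))) :
    ∀ (j i : ℕ) (s : State), i + j = N → (∀ r < k + 2, s.reg r = push ρ k i N r) → I i s.arr →
      ∃ n s', Exec W (.whileLt (.reg k) (.reg (k + 1))
          (.seq p (.assign k .add (.reg k) (.const 1)))) s n s' ∧ n ≤ j * (m + 2) + 1 ∧
        (∀ r < k, s'.reg r = ρ r) ∧ I N s'.arr := by
  have hreg : ∀ i (s : State), (∀ r < k + 2, s.reg r = push ρ k i N r) →
      s.reg k = i ∧ s.reg (k + 1) = N := fun i s hs =>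
    ⟨(hs k (by omega)).trans (by simp [push]), (hs (k + 1) (by omega)).trans (by simp [push])⟩
  intro j
  induction j with
  | zero =>
    intro i s hij hs hI
    obtain ⟨h₁, h₂⟩ := hreg i s hs
    refine ⟨1, s, .whileFalse ?_, by omega, fun r hr => ?_, ?_⟩
    · simp only [Operand.val, h₁, h₂]; omega
    · rw [hs r (by omega)]; simp [push, hr]
    · rwa [← show i = N by omega]
  | succ j ih =>
    intro i s hij hs hI
    obtain ⟨h₁, h₂⟩ := hreg i s hs
    obtain ⟨n₁, s₁, hx₁, hn₁, hs₁, hI₁⟩ := hp i (by omega) _ hI s hs rfl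
    obtain ⟨h₃, h₄⟩ := hreg i s₁ hs₁
    have hle : ArithOp.eval .add ((Operand.reg k).val s₁) ((Operand.const 1).val s₁) ≤ W := by
      simp only [ArithOp.eval, Operand.val, h₃]; omega
    obtain ⟨n₂, s₂, hx₂, hn₂, hs₂, hI₂⟩ := ih (i + 1)
      (s₁.setReg k (ArithOp.eval .add ((Operand.reg k).val s₁) ((Operand.const 1).val s₁)))
      (by omega) (by
        intro r hr
        simp only [State.setReg, ArithOp.eval, Operand.val, h₃]
        by_cases hrk : r = k
        · subst hrk; simp [push]
        · rw [Function.update_of_ne hrk, hs₁ r hr]; simp [push, hrk]) hI₁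
    refine ⟨_, s₂, .whileTrue ?_ (.seq hx₁ (.assign _ _ _ _ _ hle)) hx₂, ?_, hs₂, hI₂⟩
    · simp only [Operand.val, h₁, h₂]; omega
    · rw [add_mul]; omega

/-- The unit is multiplied by the number of rounds, and the overhead goes into the constant. This
absorption needs `1 ≤ N` and `1 ≤ m`, which is why positive dimensions are carried through all
specifications. -/
lemma T.forE {c m N : ℕ} (I : ℕ → (ℕ → ℕ → ℕ) → Prop) {e : Ex} (he : e.Below k)
    (hok : e.Ok W ρ a) (heN : e.eval ρ a = N) (hN : N ≤ W) (hN1 : 1 ≤ N) (hm : 1 ≤ m)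
    (h0 : I 0 a)
    (hp : ∀ i < N, ∀ a', I i a' → T W p (k + 2) (c * m) (push ρ k i N) a' (I (i + 1)))
    (hQ : ∀ a', I N a' → Q a') :
    T W (forE k e p) k ((c + (e.size + 5)) * (N * m)) ρ a Q := by
  intro s hs ha
  subst ha
  obtain ⟨s₁, hx₁, ha₁, hr₁, hv₁⟩ := Ex.exec_code e k (k + 1) s he (by omega)
    ((Ex.ok_congr hs he).2 hok)
  rw [Ex.eval_congr hs he, heN] at hv₁
  obtain ⟨n, s', hx, hn, hr, hI⟩ := exec_while I hN hp N 0
    ((s₁.setReg (k + 1) (N + 0)).setReg k (0 + 0)) (by omega) (by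
      intro r hr
      simp only [State.setReg]
      by_cases hrk : r = k
      · subst hrk; simp [push]
      · rw [Function.update_of_ne hrk]
        by_cases hrk' : r = k + 1
        · subst hrk'; simp [push]
        · have : r < k := by omega
          rw [Function.update_of_ne hrk', hr₁ r (by omega), hs r this]
          simp [push, this]) (by simpa [State.setReg, ha₁] using h0)
  have hadd : ArithOp.eval .add ((e.opd (k + 1)).val s₁) ((Operand.const 0).val s₁) = N + 0 := by
    change (e.opd (k + 1)).val s₁ + 0 = _
    rw [hv₁]
  have hx' := Exec.assign (W := W) s₁ (k + 1) .add (e.opd (k + 1)) (.const 0)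
    (by rw [hadd]; exact hN)
  rw [hadd] at hx'
  refine ⟨_, s', .seq hx₁ (.seq hx' (.seq (.assign _ k .add (.const 0) (.const 0) (by
    simp [ArithOp.eval, Operand.val])) hx)), ?_, hr, hQ _ hI⟩
  · have h1 : 1 ≤ N * m := Nat.mul_pos hN1 hm
    have h2 : N ≤ N * m := Nat.le_mul_of_pos_right _ hm
    have h3 : N * (c * m + 2) = c * (N * m) + 2 * N := by ring
    have h4 : e.size ≤ e.size * (N * m) := Nat.le_mul_of_pos_right _ h1
    rw [h3] at hn
    rw [add_mul, add_mul]
    omega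

/-- The last argument `0` of `push` is immaterial: at level `k + 1` only the registers up to `k` are
looked at. -/
lemma T.letE {c m : ℕ} {e : Ex} (he : e.Below k) (hok : e.Ok W ρ a) (hle : e.eval ρ a ≤ W)
    (hm : 1 ≤ m) (hp : T W p (k + 1) (c * m) (push ρ k (e.eval ρ a) 0) a Q) :
    T W (letE k e p) k ((c + (e.size + 1)) * m) ρ a Q := by
  intro s hs ha
  subst ha
  obtain ⟨s₁, hx₁, ha₁, hr₁, hv₁⟩ := Ex.exec_code e k k s he le_rfl
    ((Ex.ok_congr hs he).2 hok)
  rw [Ex.eval_congr hs he] at hv₁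
  have hadd : ArithOp.eval .add ((e.opd k).val s₁) ((Operand.const 0).val s₁) =
      e.eval ρ s.arr := by
    change (e.opd k).val s₁ + 0 = _
    rw [hv₁, add_zero]
  have hx' := Exec.assign (W := W) s₁ k .add (e.opd k) (.const 0) (by rw [hadd]; exact hle)
  rw [hadd] at hx'
  obtain ⟨n, s', hx, hn, hr, hQ⟩ := hp (s₁.setReg k (e.eval ρ s.arr)) (by
      intro r hr
      simp only [State.setReg]
      by_cases hrk : r = k
      · subst hrk; simp [push]
      · have : r < k := by omega
        rw [Function.update_of_ne hrk, hr₁ r this, hs r this]; simp [push, this])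
    (by simp [State.setReg, ha₁])
  refine ⟨_, s', .seq hx₁ (.seq hx' hx), ?_, ?_, hQ⟩
  · have h4 : e.size ≤ e.size * m := Nat.le_mul_of_pos_right _ hm
    rw [add_mul, add_mul]
    omega
  · intro r hr'
    rw [hr r (by omega)]; simp [push, hr']

end Rules

/-! ### Loops of guarded stores of a constant -/

open Classical in
/-- Set the cells of array `A` with indices in `X` to `v`. -/
noncomputable def fill (a : ℕ → ℕ → ℕ) (A v : ℕ) (X : Set ℕ) : ℕ → ℕ → ℕ :=
  Function.update a A fun i => if i ∈ X then v else a A i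

section Marks

variable {W k : ℕ} {p q : Prog} {ρ : ℕ → ℕ} {a : ℕ → ℕ → ℕ} {A v : ℕ} {P P' : Set ℕ}

lemma fill_of_ne {B : ℕ} (h : B ≠ A) {X : Set ℕ} : fill a A v X B = a B :=
  Function.update_of_ne h _ _

lemma fill_self_of_mem {X : Set ℕ} {i : ℕ} (h : i ∈ X) : fill a A v X A i = v := by
  simp [fill, h]

lemma fill_pos {X : Set ℕ} {i : ℕ} : 0 < fill a A 1 X A i ↔ i ∈ X ∨ 0 < a A i := by
  by_cases h : i ∈ X <;> simp [fill, h]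

lemma fill_empty : fill a A v ∅ = a := by
  simp [fill]

lemma fill_fill {X Y : Set ℕ} : fill (fill a A v X) A v Y = fill a A v (X ∪ Y) := by
  unfold fill
  rw [Function.update_idem]
  congr 1
  funext i
  by_cases h : i ∈ X <;> by_cases h' : i ∈ Y <;> simp [h, h']

lemma upd_eq_fill {i : ℕ} : upd a A i v = fill a A v {i} := by
  unfold upd fill
  congr 1
  funext j
  by_cases h : j = i
  · subst h; simp
  · simp [h]

lemma Ex.eval_fill : ∀ {e : Ex} {X : Set ℕ}, e.Avoids A → e.eval ρ (fill a A v X) = e.eval ρ a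
  | const _, _, _ => rfl
  | var _, _, _ => rfl
  | get B e, X, h => by
    have := Ex.eval_fill (e := e) (X := X) h.2
    simp only [eval, this, fill_of_ne h.1]
  | bin _ x y, X, h => by
    simp only [eval, Ex.eval_fill h.1, Ex.eval_fill h.2]

lemma Ex.ok_fill : ∀ {e : Ex} {X : Set ℕ}, e.Avoids A → (e.Ok W ρ (fill a A v X) ↔ e.Ok W ρ a)
  | const _, _, _ => Iff.rfl
  | var _, _, _ => Iff.rfl
  | get B e, X, h => Ex.ok_fill (e := e) (X := X) h.2
  | bin _ x y, X, h => by
    simp only [Ok, Ex.ok_fill h.1, Ex.ok_fill h.2, Ex.eval_fill h.1, Ex.eval_fill h.2]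

/-- Within `c * m` steps the program sets the cells of `A` with indices in `P` to `v`, whatever
cells of `A` have been set to `v` before. -/
def Marks (W : ℕ) (p : Prog) (k c m : ℕ) (ρ : ℕ → ℕ) (a : ℕ → ℕ → ℕ) (A v : ℕ) (P : Set ℕ) :
    Prop :=
  ∀ X, T W p k (c * m) ρ (fill a A v X) fun a' => a' = fill a A v (X ∪ P)

lemma Marks.t {c m : ℕ} (h : Marks W p k c m ρ a A v P) :
    T W p k (c * m) ρ a fun a' => a' = fill a A v P := by
  have := h ∅
  rwa [fill_empty, Set.empty_union] at this

lemma Marks.weaken {c m c' m' : ℕ} (h : Marks W p k c m ρ a A v P) (hc : c ≤ c')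
    (hm : m ≤ m') : Marks W p k c' m' ρ a A v P :=
  fun X => (h X).weaken hc hm

lemma Marks.congr {c m : ℕ} (h : Marks W p k c m ρ a A v P) (hP : P = P') :
    Marks W p k c m ρ a A v P' :=
  hP ▸ h

lemma Marks.store {m : ℕ} {e : Ex} (hm : 1 ≤ m) (he : e.Below k) (hA : e.Avoids A)
    (hok : e.Ok W ρ a) :
    Marks W (storeE k A e (.const v)) k (e.size + 2) m ρ a A v {e.eval ρ a} := by
  intro X
  refine T.store he trivial ((Ex.ok_fill hA).2 hok) trivial hm ?_
  rw [Ex.eval_fill hA, ← fill_fill, ← upd_eq_fill]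
  rfl

lemma Marks.seq {c₁ c₂ m : ℕ} (hp : Marks W p k c₁ m ρ a A v P)
    (hq : Marks W q k c₂ m ρ a A v P') :
    Marks W (.seq p q) k (c₁ + c₂) m ρ a A v (P ∪ P') := by
  intro X
  refine T.seq (hp X) fun a' ha' => ?_
  subst ha'
  refine (hq _).conseq fun a' ha' => ?_
  rw [ha', Set.union_assoc]

lemma Marks.when {c m : ℕ} {e₁ e₂ : Ex} (hc : 1 ≤ c) (hm : 1 ≤ m) (h₁ : e₁.Below k)
    (h₂ : e₂.Below k) (hA₁ : e₁.Avoids A) (hA₂ : e₂.Avoids A) (hok₁ : e₁.Ok W ρ a)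
    (hok₂ : e₂.Ok W ρ a)
    (hp : e₁.eval ρ a < e₂.eval ρ a → Marks W p k c m ρ a A v P) :
    Marks W (ifE k e₁ e₂ p .skip) k (c + (e₁.size + e₂.size + 1)) m ρ a A v
      {x | e₁.eval ρ a < e₂.eval ρ a ∧ x ∈ P} := by
  intro X
  refine T.when h₁ h₂ ((Ex.ok_fill hA₁).2 hok₁) ((Ex.ok_fill hA₂).2 hok₂) hm hc ?_ ?_
  · intro h
    rw [Ex.eval_fill hA₁, Ex.eval_fill hA₂] at h
    simpa [h] using hp h X
  · intro h
    rw [Ex.eval_fill hA₁, Ex.eval_fill hA₂] at h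
    simp [h]

/-- The body is specified once, over the original `a`: since `Marks` allows any earlier marks in
`A`, the rounds do not interact and their sets of marks unite. -/
lemma Marks.forE {c m N : ℕ} {e : Ex} {P : Fin N → Set ℕ} (hm : 1 ≤ m) (he : e.Below k)
    (hA : e.Avoids A) (hok : e.Ok W ρ a) (heN : e.eval ρ a = N) (hN : N ≤ W) (hN1 : 1 ≤ N)
    (hp : ∀ i : Fin N, Marks W p (k + 2) c m (push ρ k i N) a A v (P i)) :
    Marks W (forE k e p) k (c + (e.size + 5)) (N * m) ρ a A v {x | ∃ i, x ∈ P i} := by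
  intro X
  refine T.forE (fun j a' => a' = fill a A v (X ∪ {x | ∃ i : Fin N, (i : ℕ) < j ∧ x ∈ P i})) he
    ((Ex.ok_fill hA).2 hok) (by rw [Ex.eval_fill hA, heN]) hN hN1 hm ?_ ?_ ?_
  · simp
  · rintro i hi a' rfl
    refine (hp ⟨i, hi⟩ _).conseq fun a' ha' => ?_
    rw [ha', Set.union_assoc]
    congr 2
    ext x
    simp only [Set.mem_union, Set.mem_ofPred_eq]
    constructor
    · rintro (⟨j, hj, hx⟩ | hx)
      exacts [⟨j, by omega, hx⟩, ⟨_, Nat.lt_succ_self i, hx⟩]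
    · rintro ⟨j, hj, hx⟩
      rcases Nat.lt_or_ge j i with h | h
      · exact .inl ⟨j, h, hx⟩
      · right
        have : j = ⟨i, hi⟩ := Fin.ext (show (j : ℕ) = i by omega)
        rwa [← this]
  · rintro a' rfl
    simp

end Marks

end RAM

namespace RAM

open Relation

/-! ### Closure of a set of nodes under the edges of a matrix -/

/-- Register `x` times register `n` plus register `y`. -/
def ixE (x n y : ℕ) : Ex := .bin .add (.bin .mul (.var x) (.var n)) (.var y)

lemma idx_lt {i j m n : ℕ} (hi : i < m) (hj : j < n) : i * n + j < m * n :=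
  calc i * n + j < i * n + n := by omega
    _ = (i + 1) * n := by ring
    _ ≤ m * n := Nat.mul_le_mul_right _ hi

lemma idx_inj {i j i' j' n : ℕ} (hj : j < n) (hj' : j' < n) :
    i * n + j = i' * n + j' ↔ i = i' ∧ j = j' := by
  refine ⟨fun h => ?_, by rintro ⟨rfl, rfl⟩; rfl⟩
  have hn : 0 < n := by omega
  have h₁ : (i * n + j) / n = i := by
    rw [mul_comm, Nat.mul_add_div hn, Nat.div_eq_of_lt hj, add_zero]
  have h₂ : (i' * n + j') / n = i' := by
    rw [mul_comm, Nat.mul_add_div hn, Nat.div_eq_of_lt hj', add_zero]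
  have : i = i' := by rw [← h₁, h, h₂]
  subst this
  exact ⟨rfl, by omega⟩

/-- Look for a node in array 17 that is not in array 18; its number, or the number of nodes if
there is none, is stored in array 19. -/
def selectP (nr : ℕ) : Prog :=
  .seq (storeE 32 19 (.const 0) (.var nr))
    (forE 32 (.var nr) (ifE 34 (.const 0) (.get 17 (.var 32))
      (ifE 34 (.get 18 (.var 32)) (.const 1) (storeE 34 19 (.const 0) (.var 32)) .skip) .skip))

/-- Add the successors of node `x` to array 17. -/
def expandP (nr M : ℕ) (rev : Bool) : Prog :=
  .seq (storeE 33 18 (.var 32) (.const 1))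
    (forE 33 (.var nr) (ifE 35 (.const 0)
      (.get M (if rev then ixE 33 nr 32 else ixE 32 nr 33)) (storeE 35 17 (.var 33) (.const 1))
      .skip))

/-- Close the set in array 17 under the edges of the matrix `M`, whose size is in register `nr`,
or under the reversed edges. -/
def closureP (nr M : ℕ) (rev : Bool) : Prog :=
  .seq (forE 30 (.var nr) (storeE 32 18 (.var 30) (.const 0)))
    (forE 30 (.var nr) (.seq (selectP nr) (ifE 32 (.get 19 (.const 0)) (.var nr)
      (letE 32 (.get 19 (.const 0)) (expandP nr M rev)) .skip)))

variable {W : ℕ}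

lemma upd_self {a : ℕ → ℕ → ℕ} {A i v : ℕ} : upd a A i v A i = v := by simp [upd]

lemma upd_ne {a : ℕ → ℕ → ℕ} {A B i v : ℕ} (h : B ≠ A) : upd a A i v B = a B :=
  Function.update_of_ne h _ _

lemma upd_of_ne {a : ℕ → ℕ → ℕ} {A i j v : ℕ} (h : j ≠ i) : upd a A i v A j = a A j := by
  simp [upd, h]

lemma push_lt {ρ : ℕ → ℕ} {k i N r : ℕ} (h : r < k) : push ρ k i N r = ρ r := by
  simp [push, h]

/-- The number `n`, which is not the number of a node, serves as the sentinel for an unsuccessful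
scan. A later hit overwrites an earlier one, so some candidate is found, not a particular one. -/
lemma select_spec {nr n : ℕ} (hnr : nr < 30) {ρ : ℕ → ℕ} (hρ : ρ nr = n) (hn : 1 ≤ n)
    (hW : n ≤ W) (a : ℕ → ℕ → ℕ) :
    T W (selectP nr) 32 (23 * n) ρ a fun a' => (∀ A, A ≠ 19 → a' A = a A) ∧
      ((a' 19 0 = n ∧ ∀ y : Fin n, 0 < a 17 y → 0 < a 18 y) ∨
        ∃ x : Fin n, a' 19 0 = x ∧ 0 < a 17 x ∧ a 18 x = 0) := by
  have h32 : nr < 32 := by omega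
  have h34 : nr < 34 := by omega
  have key : T W (selectP nr) 32 ((3 + (14 + 6)) * (n * 1)) ρ a fun a' =>
      (∀ A, A ≠ 19 → a' A = a A) ∧
      ((a' 19 0 = n ∧ ∀ y : Fin n, 0 < a 17 y → 0 < a 18 y) ∨
        ∃ x : Fin n, a' 19 0 = x ∧ 0 < a 17 x ∧ a 18 x = 0) := by
    refine T.seq (R := fun a' => (∀ A, A ≠ 19 → a' A = a A) ∧ a' 19 0 = n)
      (T.store trivial h32 trivial trivial (by omega) ?_) ?_
    · refine ⟨fun A hA => upd_ne hA, ?_⟩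
      simp [Ex.eval, hρ, upd_self]
    · rintro a₁ ⟨hf, hz⟩
      refine T.forE (c := 14) (fun j a' => (∀ A, A ≠ 19 → a' A = a A) ∧
        ((a' 19 0 = n ∧ ∀ y : Fin n, (y : ℕ) < j → 0 < a 17 y → 0 < a 18 y) ∨
          ∃ x : Fin n, a' 19 0 = x ∧ 0 < a 17 x ∧ a 18 x = 0)) (by exact h32) trivial
        hρ hW hn le_rfl ⟨hf, .inl ⟨hz, by simp⟩⟩ ?_ ?_
      · rintro j hj a' ⟨hf', hI⟩
        refine T.when (c := 10) (by simp [Ex.Below]) (by simp [Ex.Below]) trivial trivial le_rfl (by omega)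
          (fun hR => ?_) (fun hR => ?_)
        · refine T.mono (T.when (c := 3) (m := 1) (by simp [Ex.Below]) (by simp [Ex.Below]) trivial trivial le_rfl
            (by omega) (fun hD => T.store (by simp [Ex.Below]) (by simp [Ex.Below]) trivial trivial le_rfl ?_)
            (fun hD => ?_)) (by simp [Ex.size])
          · simp only [Ex.eval, push, hf' 17 (by omega), hf' 18 (by omega)] at hR hD
            refine ⟨fun A hA => by rw [upd_ne hA, hf' A hA], .inr ⟨⟨j, hj⟩, ?_, ?_, ?_⟩⟩
            · simp [Ex.eval, push, upd_self]
            · simpa using hR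
            · simpa using hD
          · refine ⟨hf', hI.imp_left fun ⟨h₁, h₂⟩ => ⟨h₁, fun y hy hy' => ?_⟩⟩
            simp only [Ex.eval, push, hf' 18 (by omega)] at hD
            rcases Nat.lt_or_ge y j with h | h
            · exact h₂ y h hy'
            · rw [show (y : ℕ) = j by omega]
              simp at hD
              omega
        · refine ⟨hf', hI.imp_left fun ⟨h₁, h₂⟩ => ⟨h₁, fun y hy hy' => ?_⟩⟩
          simp only [Ex.eval, push, hf' 17 (by omega)] at hR
          rcases Nat.lt_or_ge y j with h | h
          · exact h₂ y h hy'
          · rw [show (y : ℕ) = j by omega] at hy'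
            simp at hR
            omega
      · rintro a' ⟨hf', hI⟩
        exact ⟨hf', hI.imp_left fun ⟨h₁, h₂⟩ => ⟨h₁, fun y => h₂ y y.2⟩⟩
  exact key.weaken le_rfl (by omega)

/-- `hE` describes the matrix in the orientation in which it is read. The reversed case is thus the
same statement for a relation `E` stored in transposed form. -/
lemma expand_spec {nr M n : ℕ} (rev : Bool) (hM : M < 17) (hnr : nr < 30) {ρ : ℕ → ℕ}
    (hρ : ρ nr = n) (hW : n * n ≤ W) {a : ℕ → ℕ → ℕ} {E : Fin n → Fin n → Prop}
    (hE : ∀ x y : Fin n, 0 < a M (if rev then y * n + x else x * n + y) ↔ E x y) (x : Fin n)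
    (hx : ρ 32 = x) :
    T W (expandP nr M rev) 33 (22 * n) ρ a fun a' =>
      a' = fill (upd a 18 x 1) 17 1 {j | ∃ y : Fin n, E x y ∧ j = y} := by
  have hn : 1 ≤ n := by have := x.2; omega
  have hnn : n ≤ n * n := Nat.le_mul_of_pos_left _ hn
  have h33 : nr < 33 := by omega
  have h35 : nr < 35 := by omega
  have hM17 : M ≠ 17 := by omega
  have key : T W (expandP nr M rev) 33 ((3 + (13 + 6)) * (n * 1)) ρ a fun a' =>
      a' = fill (upd a 18 x 1) 17 1 {j | ∃ y : Fin n, E x y ∧ j = y} := by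
    refine T.seq (R := fun a' => a' = upd a 18 x 1)
      (T.store (by simp [Ex.Below]) trivial trivial trivial (by omega) (by simp [Ex.eval, hx])) ?_
    rintro _ rfl
    refine Marks.t (Marks.congr (Marks.forE (c := 13) (m := 1)
      (P := fun y : Fin n => {j | E x y ∧ j = y}) le_rfl h33 trivial trivial hρ (by omega) hn
      fun y => ?_) ?_)
    · have hlt : ∀ x y : Fin n, (x : ℕ) * n + y < n * n := fun x y => idx_lt x.2 y.2
      have hxle : ∀ x : Fin n, (x : ℕ) * n ≤ n * n := fun x => Nat.mul_le_mul_right _ x.2.le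
      refine Marks.weaken (m := 1) (Marks.congr (Marks.when (by omega) le_rfl trivial
        ?_ trivial ?_ trivial ?_ fun _ => Marks.store le_rfl (by simp [Ex.Below]) trivial trivial)
        ?_) ?_ le_rfl
      · cases rev <;> simp [Ex.Below, ixE, h35]
      · cases rev <;> simp [Ex.Avoids, ixE, hM17]
      · have h₁ := hxle x
        have h₂ := hxle y
        have h₃ := hlt x y
        have h₄ := hlt y x
        cases rev <;> simp [Ex.Ok, ixE, Ex.eval, ArithOp.eval, push, h33, hx, hρ] <;> omega
      · ext j
        have := hE x y
        cases rev <;>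
          simp [Ex.eval, ixE, ArithOp.eval, push, h33, hx, hρ, upd_ne (show M ≠ 18 by omega)] at this ⊢ <;>
          simp [this]
      · cases rev <;> simp [Ex.size, ixE]
    · ext j
      simp
  exact key.weaken le_rfl (by omega)

/-- A worklist search: array 17 holds the nodes reached, array 18 those already expanded. Each of
the `n` rounds takes linear time and either expands a new node or finds that none is left. So after
`h` rounds at least `h` nodes are expanded or the search is complete, and for `h = n` both
alternatives mean completeness. -/
lemma closure_spec {nr M n : ℕ} (rev : Bool) (hM : M < 17) (hnr : nr < 30) {ρ : ℕ → ℕ}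
    (hρ : ρ nr = n) (hn : 1 ≤ n) (hW : n * n ≤ W) {a : ℕ → ℕ → ℕ} {E : Fin n → Fin n → Prop}
    (hE : ∀ x y : Fin n, 0 < a M (if rev then y * n + x else x * n + y) ↔ E x y) :
    T W (closureP nr M rev) 30 (100 * (n * n)) ρ a fun a' => (∀ A < 17, a' A = a A) ∧
      ∀ y : Fin n, 0 < a' 17 y ↔ ∃ x : Fin n, 0 < a 17 x ∧ ReflTransGen E x y := by
  classical
  have hnn : n ≤ n * n := Nat.le_mul_of_pos_left _ hn
  have h32 : nr < 32 := by omega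
  refine T.weaken (c := 9 + 65) (m := n * n) ?_ (by omega) le_rfl
  refine T.seq (R := fun a' => (∀ A, A ≠ 18 → a' A = a A) ∧ ∀ y : Fin n, a' 18 y = 0) ?_ ?_
  · refine T.weaken (c := 3 + 6) (m := n * 1) (T.conseq (Marks.t (Marks.forE
      (P := fun y : Fin n => {(y : ℕ)}) (A := 18) (v := 0) (m := 1) le_rfl (by exact hnr) trivial
      trivial hρ (by omega) hn fun y => Marks.congr (Marks.store le_rfl (by simp [Ex.Below])
        trivial trivial) ?_)) ?_) le_rfl (by omega)
    · simp [Ex.eval, push]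
    · rintro _ rfl
      exact ⟨fun A hA => fill_of_ne hA, fun y => fill_self_of_mem ⟨y, rfl⟩⟩
  · rintro a₀ ⟨hf₀, hD₀⟩
    refine T.weaken (c := 59 + 6) (m := n * n) (T.forE (c := 59) (fun h a' =>
      (∀ A < 17, a' A = a A) ∧
      (∀ y : Fin n, 0 < a 17 y → 0 < a' 17 y) ∧
      (∀ y : Fin n, 0 < a' 17 y → ∃ x : Fin n, 0 < a 17 x ∧ ReflTransGen E x y) ∧
      (∀ y : Fin n, 0 < a' 18 y → 0 < a' 17 y) ∧
      (∀ x y : Fin n, 0 < a' 18 x → E x y → 0 < a' 17 y) ∧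
      (h ≤ (Finset.univ.filter fun x : Fin n => 0 < a' 18 x).card ∨
        ∀ y : Fin n, 0 < a' 17 y → 0 < a' 18 y)) (by exact hnr) trivial hρ (by omega) hn hn
      ?_ ?_ ?_) le_rfl le_rfl
    · refine ⟨fun A hA => hf₀ A (by omega), ?_, ?_, ?_, ?_, .inl (Nat.zero_le _)⟩
      · intro y hy
        rwa [hf₀ 17 (by omega)]
      · intro y hy
        rw [hf₀ 17 (by omega)] at hy
        exact ⟨y, hy, .refl⟩
      · intro y hy
        rw [hD₀] at hy
        omega
      · intro x y hx
        rw [hD₀] at hx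
        omega
    · rintro h hh a₁ ⟨hfr, hseed, hsound, hDR, hexp, hprog⟩
      have hρ' : push ρ 30 h n nr = n := by rw [push_lt hnr, hρ]
      refine T.weaken (c := 23 + 36) (m := n) ?_ le_rfl le_rfl
      refine T.seq (select_spec hnr hρ' hn (by omega) a₁) ?_
      rintro a₂ ⟨hfr₂, hsel⟩
      refine T.weaken (c := 22 + 3 + 4) (m := n) (T.when trivial (by exact h32) trivial trivial
        hn (by omega) (fun hlt => ?_) (fun hge => ?_)) (by simp) le_rfl
      · simp only [Ex.eval, hρ'] at hlt
        rcases hsel with ⟨hz, -⟩ | ⟨x, hz, hxR, hxD⟩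
        · omega
        refine T.letE trivial trivial (by simp only [Ex.eval]; omega) hn
          (T.conseq (expand_spec rev hM hnr ?_ hW (E := E) ?_ x ?_) ?_)
        · rw [push_lt h32, hρ']
        · intro x y
          rw [hfr₂ M (by omega), hfr M (by omega)]
          exact hE x y
        · simp [push, Ex.eval, hz]
        · rintro _ rfl
          have e17 : ∀ y : Fin n, 0 < fill (upd a₂ 18 x 1) 17 1
              {j | ∃ y : Fin n, E x y ∧ j = y} 17 y ↔ E x y ∨ 0 < a₁ 17 y := by
            intro y
            rw [fill_pos, upd_ne (by omega), hfr₂ 17 (by omega)]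
            refine or_congr_left ⟨?_, fun h => ⟨y, h, rfl⟩⟩
            rintro ⟨y', h, h'⟩
            rwa [Fin.ext h']
          have e18 : ∀ y : Fin n, 0 < fill (upd a₂ 18 x 1) 17 1
              {j | ∃ y : Fin n, E x y ∧ j = y} 18 y ↔ y = x ∨ 0 < a₁ 18 y := by
            intro y
            rw [fill_of_ne (by omega), upd_eq_fill, fill_pos, hfr₂ 18 (by omega)]
            simp [Fin.ext_iff]
          simp only [e17, e18]
          refine ⟨?_, ?_, ?_, ?_, ?_, ?_⟩
          · intro A hA
            rw [fill_of_ne (by omega), upd_ne (by omega), hfr₂ A (by omega), hfr A hA]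
          · exact fun y hy => .inr (hseed y hy)
          · rintro y (hy | hy)
            · obtain ⟨z, hz, hz'⟩ := hsound x hxR
              exact ⟨z, hz, hz'.tail hy⟩
            · exact hsound y hy
          · rintro y (rfl | hy)
            exacts [.inr hxR, .inr (hDR y hy)]
          · rintro x' y (rfl | hx') hxy
            exacts [.inl hxy, .inr (hexp x' y hx' hxy)]
          · rcases hprog with hp | hp
            · left
              have hins : (Finset.univ.filter fun y : Fin n => y = x ∨ 0 < a₁ 18 y) =
                  insert x (Finset.univ.filter fun y : Fin n => 0 < a₁ 18 y) := by
                ext y; simp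
              rw [hins, Finset.card_insert_of_notMem (by simp [hxD])]
              omega
            · have := hp x hxR
              omega
      · simp only [Ex.eval, hρ'] at hge
        rcases hsel with ⟨hz, hall⟩ | ⟨x, hz, -, -⟩
        · rw [hfr₂ 17 (by omega), hfr₂ 18 (by omega)]
          exact ⟨fun A hA => by rw [hfr₂ A (by omega), hfr A hA], hseed, hsound, hDR, hexp,
            .inr hall⟩
        · have := x.2
          omega
    · rintro a₁ ⟨hfr, hseed, hsound, hDR, hexp, hprog⟩
      refine ⟨hfr, fun y => ⟨hsound y, ?_⟩⟩
      have hall : ∀ y : Fin n, 0 < a₁ 17 y → 0 < a₁ 18 y := by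
        rcases hprog with hp | hp
        · have : (Finset.univ.filter fun x : Fin n => 0 < a₁ 18 x) = Finset.univ := by
            refine Finset.eq_univ_of_card _ (le_antisymm (Finset.card_le_univ _) ?_)
            simpa using hp
          intro y _
          have hy := Finset.mem_univ y
          rw [← this] at hy
          exact (Finset.mem_filter.1 hy).2
        · exact hp
      rintro ⟨x, hx, hxy⟩
      induction hxy with
      | refl => exact hseed x hx
      | tail _ hs ih => exact hexp _ _ (hall _ ih) hs

end RAM

namespace RAM

open Relation

attribute [simp] Ex.Below Ex.Avoids ArithOp.eval

/-! ### Index expressions and guarded stores -/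

/-- `e₁ * reg n + e₂` -/
abbrev linE (e₁ : Ex) (n : ℕ) (e₂ : Ex) : Ex := .bin .add (.bin .mul e₁ (.var n)) e₂

section Index

variable {W k : ℕ} {p : Prog} {ρ : ℕ → ℕ} {a : ℕ → ℕ → ℕ} {A v : ℕ} {P : Set ℕ}

lemma eval_linE {e₁ e₂ : Ex} {n : ℕ} :
    (linE e₁ n e₂).eval ρ a = e₁.eval ρ a * ρ n + e₂.eval ρ a := rfl

/-- The expression can be evaluated and its value is below `m`. -/
def Ex.Bd (W : ℕ) (ρ : ℕ → ℕ) (a : ℕ → ℕ → ℕ) (e : Ex) (m : ℕ) : Prop :=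
  e.Ok W ρ a ∧ e.eval ρ a < m

lemma Ex.Bd.var {r m : ℕ} (h : ρ r < m) : Ex.Bd W ρ a (.var r) m := ⟨trivial, h⟩

lemma Ex.Bd.lin {e₁ e₂ : Ex} {n m N : ℕ} (h₁ : e₁.Bd W ρ a m) (h₂ : e₂.Bd W ρ a N)
    (hn : ρ n = N) (hW : m * N ≤ W) : (linE e₁ n e₂).Bd W ρ a (m * N) := by
  have hlt : e₁.eval ρ a * N + e₂.eval ρ a < m * N := idx_lt h₁.2 h₂.2
  refine ⟨⟨⟨h₁.1, trivial, ?_⟩, h₂.1, ?_⟩, ?_⟩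
  · simp only [ArithOp.eval, Ex.eval, hn]; omega
  · simp only [ArithOp.eval, Ex.eval, hn]; omega
  · rw [eval_linE, hn]; exact hlt

lemma Marks.guard {c m : ℕ} {e : Ex} {φ : Prop} (hφ : 0 < e.eval ρ a ↔ φ) (hc : 1 ≤ c)
    (hm : 1 ≤ m) (he : e.Below k) (hA : e.Avoids A) (hok : e.Ok W ρ a)
    (hp : φ → Marks W p k c m ρ a A v P) :
    Marks W (ifE k (.const 0) e p .skip) k (c + (e.size + 2)) m ρ a A v {x | φ ∧ x ∈ P} :=
  ((Marks.when (e₁ := .const 0) hc hm trivial he trivial hA trivial hok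
    fun h => hp (hφ.1 h)).weaken
    (by simp only [Ex.size]; omega) le_rfl).congr (by ext; simp [← hφ, Ex.eval])

lemma Marks.put {m j : ℕ} {e : Ex} (hj : e.eval ρ a = j) (hm : 1 ≤ m) (he : e.Below k)
    (hA : e.Avoids A) (hok : e.Ok W ρ a) :
    Marks W (storeE k A e (.const v)) k (e.size + 2) m ρ a A v {x | x = j} :=
  hj ▸ Marks.store hm he hA hok

/-- `if 0 < B[i] then A[e] := v` -/
abbrev putIf (k B : ℕ) (i : Ex) (A : ℕ) (e : Ex) (v : ℕ) : Prog :=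
  ifE k (.const 0) (.get B i) (storeE k A e (.const v)) .skip

lemma Marks.putIf {m j B : ℕ} {i e : Ex} {φ : Prop} (hφ : 0 < a B (i.eval ρ a) ↔ φ)
    (hj : e.eval ρ a = j) (hm : 1 ≤ m) (hi : i.Below k) (he : e.Below k) (hB : B ≠ A)
    (hiA : i.Avoids A) (heA : e.Avoids A) (hoki : i.Ok W ρ a) (hok : e.Ok W ρ a) :
    Marks W (putIf k B i A e v) k (e.size + i.size + 5) m ρ a A v {x | φ ∧ x = j} :=
  (Marks.guard (e := .get B i) hφ (by omega) hm hi ⟨hB, hiA⟩ hoki fun _ =>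
    Marks.put hj hm he heA hok).weaken (by simp only [Ex.size]; omega) le_rfl

/-- Set the cells of `A` below `reg r` to `v`. -/
abbrev initP (k r A v : ℕ) : Prog := forE k (.var r) (storeE (k + 2) A (.var k) (.const v))

lemma initP_spec {r n : ℕ} (hr : r < k) (hρ : ρ r = n) (hn : 1 ≤ n) (hW : n ≤ W) :
    T W (initP k r A v) k (9 * n) ρ a fun a' =>
      (∀ B, B ≠ A → a' B = a B) ∧ ∀ y : Fin n, a' A y = v := by
  refine T.weaken (c := 3 + 6) (m := n * 1) (T.conseq (Marks.t (Marks.forE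
    (P := fun y : Fin n => {x | x = (y : ℕ)}) (A := A) (v := v) (m := 1) le_rfl (by exact hr)
    trivial trivial hρ (by omega) hn fun y => Marks.put ?_ le_rfl (by simp) trivial trivial))
    ?_) (by omega) (by omega)
  · simp [Ex.eval, push]
  · rintro _ rfl
    exact ⟨fun B hB => fill_of_ne hB, fun y => fill_self_of_mem ⟨y, rfl⟩⟩

/-- Set array 17 to the nodes reachable from node `e` along the edges of matrix `M`. -/
abbrev reachP (k nr M : ℕ) (rev : Bool) (e : Ex) : Prog :=
  .seq (initP k nr 17 0) (.seq (storeE k 17 e (.const 1)) (closureP nr M rev))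

lemma reachP_spec {nr M n : ℕ} (rev : Bool) (hM : M < 17) (hnr : nr < k) (hk : k ≤ 30)
    (hρ : ρ nr = n) (hW : n * n ≤ W) {E : Fin n → Fin n → Prop}
    (hE : ∀ x y : Fin n, 0 < a M (if rev then y * n + x else x * n + y) ↔ E x y)
    {e : Ex} (heB : e.Below k) (heA : e.Avoids 17) (hok : e.Ok W ρ a) (x : Fin n)
    (hx : e.eval ρ a = x) :
    T W (reachP k nr M rev e) k ((e.size + 120) * (n * n)) ρ a fun a' =>
      (∀ A < 17, a' A = a A) ∧ ∀ y : Fin n, 0 < a' 17 y ↔ ReflTransGen E x y := by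
  have hn : 1 ≤ n := by have := x.2; omega
  have hnn : n ≤ n * n := Nat.le_mul_of_pos_left _ hn
  refine T.weaken (c := 9 + ((e.size + 1 + 1) + 100)) (m := n * n) ?_ (by omega) le_rfl
  refine T.seq ((initP_spec hnr hρ hn (by omega)).weaken le_rfl hnn) ?_
  rintro a₁ ⟨hf₁, h₁⟩
  -- Clearing array 17 does not affect the start node, because `e` avoids that array.
  have hev : e.eval ρ a₁ = e.eval ρ a ∧ e.Ok W ρ a₁ := by
    have : a₁ = fill a₁ 17 0 ∅ := fill_empty.symm
    have h17 : a₁ = Function.update a 17 (a₁ 17) := by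
      funext B
      by_cases hB : B = 17
      · subst hB; simp
      · rw [Function.update_of_ne hB, hf₁ B hB]
    have hev' : ∀ {e : Ex} (f : ℕ → ℕ), e.Avoids 17 →
        e.eval ρ (Function.update a 17 f) = e.eval ρ a ∧
          (e.Ok W ρ (Function.update a 17 f) ↔ e.Ok W ρ a) := by
      intro e f
      induction e with
      | const => exact fun _ => ⟨rfl, Iff.rfl⟩
      | var => exact fun _ => ⟨rfl, Iff.rfl⟩
      | get B e ih =>
        intro h
        have := ih h.2
        simp only [Ex.eval, Ex.Ok, this, Function.update_of_ne h.1, and_self]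
      | bin op x y ihx ihy =>
        intro h
        simp only [Ex.eval, Ex.Ok, ihx h.1, ihy h.2, and_self]
    rw [h17]
    exact ⟨(hev' _ heA).1, (hev' _ heA).2.2 hok⟩
  refine T.seq (R := fun a' => a' = upd a₁ 17 x 1) (T.store heB trivial hev.2 trivial
    (by nlinarith) (by rw [hev.1, hx]; rfl)) ?_
  rintro _ rfl
  refine T.lift hk fun ρ' hρ' => ?_
  have hE' : ∀ x' y : Fin n, 0 < upd a₁ 17 x 1 M (if rev then y * n + x' else x' * n + y) ↔
      E x' y := by
    intro x' y
    rw [upd_ne (by omega), hf₁ M (by omega)]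
    exact hE x' y
  refine (closure_spec rev hM (by omega) (by rw [hρ' _ hnr, hρ]) hn hW hE').conseq ?_
  rintro a₂ ⟨hf₂, h₂⟩
  refine ⟨fun A hA => ?_, fun y => ?_⟩
  · rw [hf₂ A hA, upd_ne (by omega), hf₁ A (by omega)]
  · rw [h₂]
    have : ∀ z : Fin n, 0 < upd a₁ 17 x 1 17 z ↔ z = x := by
      intro z
      rw [upd_eq_fill, fill_pos, h₁]
      simp [Fin.ext_iff]
    simp [this]

end Index

end RAM

/-! ### Dimensions, tables, and the graph of leader and memory. -/

namespace LCSystem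

open RAM Relation

/-- The dimensions are positive and the tables can be indexed with words below `W`. -/
structure Fits (W L D C : ℕ) : Prop where
  L_pos : 1 ≤ L
  D_pos : 1 ≤ D
  C_pos : 1 ≤ C
  node : L * D * (L * D) ≤ W
  ltab : L * D * L ≤ W
  ctab : C * D * C ≤ W
  mask : 2 ^ C * (L * D) ≤ W

section Procedures

variable {W L D C : ℕ}

lemma Fits.LD_pos (h : Fits W L D C) : 1 ≤ L * D := Nat.mul_pos h.L_pos h.D_pos

lemma Fits.L_le_LD (h : Fits W L D C) : L ≤ L * D := Nat.le_mul_of_pos_right _ h.D_pos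

lemma Fits.D_le_LD (h : Fits W L D C) : D ≤ L * D := Nat.le_mul_of_pos_left _ h.L_pos

lemma Fits.LD_le (h : Fits W L D C) : L * D ≤ W :=
  (Nat.le_mul_of_pos_right _ h.LD_pos).trans h.node

lemma Fits.L_le (h : Fits W L D C) : L ≤ W := h.L_le_LD.trans h.LD_le

lemma Fits.D_le (h : Fits W L D C) : D ≤ W := h.D_le_LD.trans h.LD_le

lemma Fits.LL_le (h : Fits W L D C) : L * L ≤ W :=
  (Nat.mul_le_mul_right _ h.L_le_LD).trans h.ltab

lemma Fits.CC_le (h : Fits W L D C) : C * C ≤ W :=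
  (Nat.mul_le_mul_right _ (Nat.le_mul_of_pos_right _ h.D_pos)).trans h.ctab

lemma Fits.C_le (h : Fits W L D C) : C ≤ W := (Nat.le_mul_of_pos_right _ h.C_pos).trans h.CC_le

lemma Fits.CD_le (h : Fits W L D C) : C * D ≤ W :=
  (Nat.le_mul_of_pos_right _ h.C_pos).trans h.ctab

lemma Fits.pow_le (h : Fits W L D C) : 2 ^ C ≤ W :=
  (Nat.le_mul_of_pos_right _ h.LD_pos).trans h.mask

/-- Registers that hold dimensions. -/
structure Env (L D C : ℕ) (ρ : ℕ → ℕ) : Prop where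
  r0 : ρ 0 = L
  r1 : ρ 1 = D
  r2 : ρ 2 = C
  r6 : ρ 6 = L * D

/-- Arrays that hold the tables of the instance, and the powers of two. -/
structure Inp (S : LCSystem (Fin D) (Fin L) (Fin C)) (F : Set (Fin L)) (a : ℕ → ℕ → ℕ) :
    Prop where
  lw : ∀ (q : Fin L) (b : Fin D) (q' : Fin L), 0 < a 0 ((q * D + b) * L + q') ↔
    (q, some (MemOp.write b), q') ∈ S.leaderTrans
  lr : ∀ (q : Fin L) (b : Fin D) (q' : Fin L), 0 < a 1 ((q * D + b) * L + q') ↔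
    (q, some (MemOp.read b), q') ∈ S.leaderTrans
  le : ∀ q q' : Fin L, 0 < a 2 (q * L + q') ↔ (q, none, q') ∈ S.leaderTrans
  cw : ∀ (p : Fin C) (b : Fin D) (p' : Fin C), 0 < a 3 ((p * D + b) * C + p') ↔
    (p, some (MemOp.write b), p') ∈ S.contribTrans
  cr : ∀ (p : Fin C) (b : Fin D) (p' : Fin C), 0 < a 4 ((p * D + b) * C + p') ↔
    (p, some (MemOp.read b), p') ∈ S.contribTrans
  ce : ∀ p p' : Fin C, 0 < a 5 (p * C + p') ↔ (p, none, p') ∈ S.contribTrans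
  fin : ∀ q : Fin L, 0 < a 6 q ↔ q ∈ F
  pow : ∀ p : Fin C, a 7 p = 2 ^ (p : ℕ)

lemma Inp.congr {S : LCSystem (Fin D) (Fin L) (Fin C)} {F : Set (Fin L)} {a a' : ℕ → ℕ → ℕ}
    (h : Inp S F a) (ha : ∀ A < 8, a' A = a A) : Inp S F a' := by
  constructor
  · rw [ha 0 (by omega)]; exact h.lw
  · rw [ha 1 (by omega)]; exact h.lr
  · rw [ha 2 (by omega)]; exact h.le
  · rw [ha 3 (by omega)]; exact h.cw
  · rw [ha 4 (by omega)]; exact h.cr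
  · rw [ha 5 (by omega)]; exact h.ce
  · rw [ha 6 (by omega)]; exact h.fin
  · rw [ha 7 (by omega)]; exact h.pow

/-- Number of a pair of a leader state and a memory value. -/
def nodeEquiv (L D : ℕ) : Fin L × Fin D ≃ Fin (L * D) := finProdFinEquiv

lemma nodeEquiv_val (n : Fin L × Fin D) : (nodeEquiv L D n : ℕ) = n.1 * D + n.2 := by
  simp [nodeEquiv, finProdFinEquiv, add_comm, mul_comm]

/-- Index of an entry of the matrix on nodes. -/
def cell (n n' : Fin L × Fin D) : ℕ := nodeEquiv L D n * (L * D) + nodeEquiv L D n'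

lemma cell_inj {n n' m m' : Fin L × Fin D} : cell n n' = cell m m' ↔ n = m ∧ n' = m' := by
  unfold cell
  rw [idx_inj (Fin.is_lt _) (Fin.is_lt _)]
  simp [← Fin.ext_iff]

/-- The number of the pair of registers `q` and `x`. -/
abbrev nodeE (q x : ℕ) : Ex := linE (.var q) 1 (.var x)

/-- Index of an entry of the matrix on nodes. -/
abbrev cellE (q x q' y : ℕ) : Ex := linE (nodeE q x) 6 (nodeE q' y)

lemma nodeE_bd {ρ : ℕ → ℕ} {a : ℕ → ℕ → ℕ} (hF : Fits W L D C) {q x : ℕ} {n : Fin L × Fin D}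
    (h1 : ρ 1 = D) (hq : ρ q = n.1) (hx : ρ x = n.2) :
    (nodeE q x).Bd W ρ a (L * D) ∧ (nodeE q x).eval ρ a = nodeEquiv L D n :=
  ⟨.lin (.var (by simp [hq])) (.var (by simp [hx])) h1 hF.LD_le,
    by rw [eval_linE, nodeEquiv_val]; simp [Ex.eval, h1, hq, hx]⟩

lemma cellE_bd {ρ : ℕ → ℕ} {a : ℕ → ℕ → ℕ} (hF : Fits W L D C) {q x q' y : ℕ}
    {n n' : Fin L × Fin D} (h1 : ρ 1 = D) (h6 : ρ 6 = L * D) (hq : ρ q = n.1) (hx : ρ x = n.2)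
    (hq' : ρ q' = n'.1) (hy : ρ y = n'.2) :
    (cellE q x q' y).Ok W ρ a ∧ (cellE q x q' y).eval ρ a = cell n n' := by
  have h₁ := nodeE_bd (a := a) hF h1 hq hx
  have h₂ := nodeE_bd (a := a) hF h1 hq' hy
  exact ⟨(Ex.Bd.lin h₁.1 h₂.1 h6 hF.node).1, by rw [eval_linE, h₁.2, h₂.2, h6, cell]⟩

/-- Matrix of the leader and memory moves, for writable values in array 13. -/
def buildP : Prog :=
  .seq (forE 16 (.var 6) (forE 18 (.var 6) (storeE 20 15 (linE (.var 16) 6 (.var 18)) (.const 0))))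
    (forE 16 (.var 0) (forE 18 (.var 1) (.seq
      (forE 20 (.var 0) (.seq
        (putIf 22 2 (linE (.var 16) 0 (.var 20)) 15 (cellE 16 18 20 18) 1)
        (.seq (putIf 22 1 (linE (nodeE 16 18) 0 (.var 20)) 15 (cellE 16 18 20 18) 1)
          (forE 22 (.var 1)
            (putIf 24 0 (linE (nodeE 16 22) 0 (.var 20)) 15 (cellE 16 18 20 22) 1)))))
      (forE 20 (.var 1) (putIf 22 13 (.var 20) 15 (cellE 16 18 16 20) 1)))))

variable {S : LCSystem (Fin D) (Fin L) (Fin C)} {F : Set (Fin L)} {ρ : ℕ → ℕ}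
  {a : ℕ → ℕ → ℕ}

/-- After clearing the matrix, each node gets entries of four kinds: internal moves, reads and
writes of the leader, and writes of contributors. A read or internal move keeps the memory value, so
only leader writes need loops over both components of the target. -/
lemma buildP_spec (hF : Fits W L D C) (hρ : Env L D C ρ) (ha : Inp S F a) {G : Set (Fin D)}
    (hG : ∀ b : Fin D, 0 < a 13 b ↔ b ∈ G) :
    T W buildP 16 (150 * (L * D * (L * D))) ρ a fun a' => (∀ A, A ≠ 15 → a' A = a A) ∧
      ∀ n n', 0 < a' 15 (cell n n') ↔ MStep S G n n' := by
  obtain ⟨h0, h1, h2, h6⟩ := hρ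
  have hLD := hF.LD_pos
  refine T.weaken (c := (5 + 2 + 6 + 6) + 131) (m := L * D * (L * D)) ?_ (by omega) le_rfl
  refine T.seq (T.weaken (m := L * D * (L * D * 1)) (Marks.t (Marks.forE (N := L * D) (by omega)
    (by simp) trivial trivial h6 hF.LD_le hLD fun i => Marks.forE (N := L * D) le_rfl (by simp)
      trivial trivial (by simp [Ex.eval, push, h6]) hF.LD_le hLD fun j =>
        Marks.put (j := i * (L * D) + j) (by simp [Ex.eval, push, h6]) le_rfl (by simp) (by simp)
          (Ex.Bd.lin (m := L * D) (N := L * D) (.var (by simp [push])) (.var (by simp [push]))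
            (by simp [push, h6]) hF.node).1)) ?_ (by simp)) ?_
  · simp [Ex.size]
  rintro _ rfl
  set a₁ := fill a 15 0 {x | ∃ i : Fin (L * D), x ∈ {x | ∃ j : Fin (L * D), x ∈ {x | x = i * (L * D) + j}}}
    with ha₁
  have hf₁ : ∀ A, A ≠ 15 → a₁ A = a A := fun A hA => fill_of_ne hA
  have h0₁ : ∀ n n', a₁ 15 (cell n n') = 0 := fun n n' =>
    fill_self_of_mem ⟨nodeEquiv L D n, nodeEquiv L D n', rfl⟩
  have ha' : Inp S F a₁ := ha.congr fun A hA => hf₁ A (by omega)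
  have hG' : ∀ b : Fin D, 0 < a₁ 13 b ↔ b ∈ G := by rw [hf₁ 13 (by omega)]; exact hG
  clear_value a₁
  refine T.weaken (m := L * (D * (L * D))) (T.conseq (Marks.t (Marks.forE (N := L) (by nlinarith) (by simp) trivial trivial h0
    hF.L_le hF.L_pos fun q => Marks.forE (N := D) (by omega) (by simp) (by simp) (by trivial)
      (by simp [Ex.eval, push, h1]) hF.D_le hF.D_pos fun x =>
        Marks.seq
          ((Marks.forE (m := D) (N := L) hF.D_pos (by simp) (by simp) (by trivial)
            (by simp [Ex.eval, push, h0]) hF.L_le hF.L_pos fun q' =>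
            Marks.seq (Marks.putIf (φ := (q, none, q') ∈ S.leaderTrans) (j := cell (q, x) (q', x))
                ?e1 ?e2 hF.D_pos ?b1 ?b2 (by omega) (by simp) (by simp) ?o1 ?o2)
              (Marks.seq (Marks.putIf (φ := (q, some (MemOp.read x), q') ∈ S.leaderTrans)
                  (j := cell (q, x) (q', x))
                  ?e3 ?e4 hF.D_pos ?b3 ?b4 (by omega) (by simp) (by simp) ?o3 ?o4)
                ((Marks.forE (m := 1) (N := D) le_rfl (by simp) (by simp) (by trivial)
                  (by simp [Ex.eval, push, h1]) hF.D_le hF.D_pos fun y =>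
                  Marks.putIf (φ := (q, some (MemOp.write y), q') ∈ S.leaderTrans)
                    (j := cell (q, x) (q', y))
                    ?e5 ?e6 le_rfl ?b5 ?b6 (by omega) (by simp) (by simp) ?o5 ?o6).weaken
                      le_rfl (by omega)))).weaken le_rfl le_rfl)
          ((Marks.forE (m := 1) (N := D) le_rfl (by simp) (by simp) (by trivial)
            (by simp [Ex.eval, push, h1]) hF.D_le hF.D_pos fun y =>
              Marks.putIf (φ := y ∈ G) (j := cell (q, x) (q, y))
                ?e7 ?e8 le_rfl ?b7 ?b8 (by omega) (by simp) (by simp) ?o7 ?o8).weaken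
                  le_rfl (by have := hF.D_le_LD; omega)))) ?_) ?_ (by nlinarith)
  -- Odd `e` goals give the meaning of the guards, even ones the cells that are set; `o` goals
  -- exclude overflow, `b` goals bound the registers.
  case e1 => simpa [Ex.eval, push, h0] using ha'.le q q'
  case e3 => simpa [Ex.eval, push, h0, h1] using ha'.lr q x q'
  case e5 => simpa [Ex.eval, push, h0, h1] using ha'.lw q y q'
  case e7 => simpa [Ex.eval, push, h0, h1] using hG' y
  case e2 | o2 | e4 | o4 =>
    have := cellE_bd (n := (q, x)) (n' := (q', x)) (a := a₁) (q := 16) (x := 18) (q' := 20)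
      (y := 18) (ρ := push (push (push ρ 16 q L) 18 x D) 20 q' L) hF (by simp [push, h1])
      (by simp [push, h6]) (by simp [push]) (by simp [push]) (by simp [push]) (by simp [push])
    first | exact this.1 | exact this.2
  case e6 | o6 =>
    have := cellE_bd (n := (q, x)) (n' := (q', y)) (a := a₁) (q := 16) (x := 18) (q' := 20)
      (y := 22) (ρ := push (push (push (push ρ 16 q L) 18 x D) 20 q' L) 22 y D) hF
      (by simp [push, h1])
      (by simp [push, h6]) (by simp [push]) (by simp [push]) (by simp [push]) (by simp [push])
    first | exact this.1 | exact this.2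
  case e8 | o8 =>
    have := cellE_bd (n := (q, x)) (n' := (q, y)) (a := a₁) (q := 16) (x := 18) (q' := 16)
      (y := 20) (ρ := push (push (push ρ 16 q L) 18 x D) 20 y D) hF (by simp [push, h1])
      (by simp [push, h6]) (by simp [push]) (by simp [push]) (by simp [push]) (by simp [push])
    first | exact this.1 | exact this.2
  case o1 =>
    exact (Ex.Bd.lin (m := L) (N := L) (.var (by simp [push])) (.var (by simp [push]))
      (by simp [push, h0]) hF.LL_le).1
  case o3 =>
    exact (Ex.Bd.lin (m := L * D) (N := L) (nodeE_bd (n := (q, x)) hF (by simp [push, h1])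
      (by simp [push]) (by simp [push])).1 (.var (by simp [push])) (by simp [push, h0]) hF.ltab).1
  case o5 =>
    exact (Ex.Bd.lin (m := L * D) (N := L) (nodeE_bd (n := (q, y)) hF (by simp [push, h1])
      (by simp [push]) (by simp [push])).1 (.var (by simp [push])) (by simp [push, h0]) hF.ltab).1
  case o7 => trivial
  case b1 | b2 | b3 | b4 | b5 | b6 | b7 | b8 => simp
  · rintro _ rfl
    refine ⟨fun A hA => by rw [fill_of_ne hA, hf₁ A hA], fun n n' => ?_⟩
    obtain ⟨q, x⟩ := n
    obtain ⟨q', y⟩ := n'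
    rw [fill_pos, h0₁, or_iff_left (by omega)]
    simp only [Set.mem_ofPred_eq, Set.mem_union, cell_inj, Prod.mk.injEq, MStep]
    constructor
    · rintro ⟨_, _, ⟨_, ⟨h, ⟨rfl, rfl⟩, rfl, rfl⟩ | ⟨h, ⟨rfl, rfl⟩, rfl, rfl⟩ |
        ⟨_, h, ⟨rfl, rfl⟩, rfl, rfl⟩⟩ | ⟨_, h, ⟨rfl, rfl⟩, rfl, rfl⟩⟩
      · exact .inl ⟨_, h, .eps _⟩
      · exact .inl ⟨_, h, .read _⟩
      · exact .inl ⟨_, h, .write _ _⟩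
      · exact .inr ⟨rfl, h⟩
    · rintro (⟨o, h, hm⟩ | ⟨h, hb⟩)
      · refine ⟨q, x, .inl ⟨q', ?_⟩⟩
        cases hm with
        | write => exact .inr (.inr ⟨y, h, by simp⟩)
        | read => exact .inr (.inl ⟨h, by simp⟩)
        | eps => exact .inl ⟨h, by simp⟩
      · subst h
        exact ⟨q', x, .inr ⟨y, hb, by simp⟩⟩
  · simp [Ex.size]

end Procedures

end LCSystem

/-! ### Computing the good transitions of the contributors. -/

namespace LCSystem

open RAM Relation

section Procedures

variable {W L D C : ℕ} {S : LCSystem (Fin D) (Fin L) (Fin C)} {F : Set (Fin L)} {ρ : ℕ → ℕ}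
  {a : ℕ → ℕ → ℕ} {T₀ : ℕ} {V : Set (Fin D)}

/-- Bit of register 8 whose number is in register `p`. -/
abbrev bitE (p : ℕ) : Ex := .bin .mod (.bin .div (.var 8) (.get 7 (.var p))) (.const 2)

lemma bitE_bd (ha : Inp S F a) (h8 : ρ 8 = T₀) (hT : T₀ ≤ W) {r : ℕ} {p : Fin C}
    (hp : ρ r = p) :
    (bitE r).Ok W ρ a ∧ (0 < (bitE r).eval ρ a ↔ T₀.testBit p = true) := by
  have h₁ : T₀ / 2 ^ (p : ℕ) ≤ W := (Nat.div_le_self _ _).trans hT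
  simp only [Ex.Ok, Ex.eval, ArithOp.eval, h8, hp, ha.pow, true_and]
  refine ⟨⟨h₁, (Nat.mod_le _ _).trans h₁⟩, ?_⟩
  rw [Nat.testBit_eq_decide_div_mod_eq, decide_eq_true_iff]
  omega

/-- Matrix of the contributor moves with labels over the values in array 11. -/
def edgesP : Prog :=
  .seq (forE 16 (.var 2) (forE 18 (.var 2) (storeE 20 14 (linE (.var 16) 2 (.var 18)) (.const 0))))
    (forE 16 (.var 2) (ifE 18 (.const 0) (bitE 16) (forE 18 (.var 2) (.seq
      (putIf 20 5 (linE (.var 16) 2 (.var 18)) 14 (linE (.var 16) 2 (.var 18)) 1)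
      (forE 20 (.var 1) (ifE 22 (.const 0) (.get 11 (.var 20)) (.seq
        (putIf 22 3 (linE (nodeE 16 20) 2 (.var 18)) 14 (linE (.var 16) 2 (.var 18)) 1)
        (putIf 22 4 (linE (nodeE 16 20) 2 (.var 18)) 14 (linE (.var 16) 2 (.var 18)) 1))
        .skip)))) .skip))

lemma ctabE_ok (hF : Fits W L D C) {p b p' : ℕ} (h1 : ρ 1 = D) (h2 : ρ 2 = C) (hp : ρ p < C)
    (hb : ρ b < D) (hp' : ρ p' < C) : (linE (nodeE p b) 2 (.var p')).Ok W ρ a :=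
  (Ex.Bd.lin (.lin (.var hp) (.var hb) h1 hF.CD_le) (.var hp') h2 hF.ctab).1

lemma cmatE_ok (hF : Fits W L D C) {p p' : ℕ} (h2 : ρ 2 = C) (hp : ρ p < C) (hp' : ρ p' < C) :
    (linE (.var p) 2 (.var p')).Ok W ρ a :=
  (Ex.Bd.lin (.var hp) (.var hp') h2 hF.CC_le).1

lemma edgesP_spec (hF : Fits W L D C) (hρ : Env L D C ρ) (ha : Inp S F a) (h8 : ρ 8 = T₀)
    (hT : T₀ ≤ W) (hV : ∀ b : Fin D, 0 < a 11 b ↔ b ∈ V) :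
    T W edgesP 16 (150 * (C * (C * D))) ρ a fun a' => (∀ A, A ≠ 14 → a' A = a A) ∧
      ∀ p p' : Fin C, 0 < a' 14 (p * C + p') ↔ CEdge S T₀ V p p' := by
  obtain ⟨h0, h1, h2, h6⟩ := hρ
  have hD1 := hF.D_pos
  have hC1 := hF.C_pos
  have hCD : 1 ≤ C * D := Nat.mul_pos hC1 hD1
  have hCC : C * C ≤ C * (C * D) :=
    Nat.mul_le_mul_left _ (Nat.le_mul_of_pos_right _ hD1)
  refine T.weaken (c := (5 + 2 + 6 + 6) + 131) (m := C * (C * D)) ?_ (by omega) le_rfl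
  refine T.seq (T.weaken (m := C * (C * 1)) (Marks.t (Marks.forE (N := C) (by omega)
    (by simp) trivial trivial h2 hF.C_le hC1 fun i => Marks.forE (N := C) le_rfl (by simp)
      trivial trivial (by simp [Ex.eval, push, h2]) hF.C_le hC1 fun j =>
        Marks.put (j := i * C + j) (by simp [Ex.eval, push, h2]) le_rfl (by simp) (by simp)
          (cmatE_ok hF (by simp [push, h2]) (by simp [push]) (by simp [push])))) ?_ (by simpa))
      ?_
  · simp [Ex.size]
  rintro _ rfl
  set a₁ := fill a 14 0 {x | ∃ i : Fin C, x ∈ {x | ∃ j : Fin C, x ∈ {x | x = i * C + j}}}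
    with ha₁
  have hf₁ : ∀ A, A ≠ 14 → a₁ A = a A := fun A hA => fill_of_ne hA
  have h0₁ : ∀ p p' : Fin C, a₁ 14 (p * C + p') = 0 := fun p p' =>
    fill_self_of_mem ⟨p, p', rfl⟩
  have ha' : Inp S F a₁ := ha.congr fun A hA => hf₁ A (by omega)
  have hV' : ∀ b : Fin D, 0 < a₁ 11 b ↔ b ∈ V := by rw [hf₁ 11 (by omega)]; exact hV
  clear_value a₁
  refine T.weaken (m := C * (C * D)) (T.conseq (Marks.t (Marks.forE (N := C) (by omega)
    (by simp) trivial trivial h2 hF.C_le hC1 fun p =>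
    Marks.guard (e := bitE 16) (φ := T₀.testBit p = true) ?e1 (by omega) (by omega) (by simp)
      (by simp) ?o1 fun _ =>
    Marks.forE (N := C) (m := D) (by omega) (by simp) trivial trivial
      (by simp [Ex.eval, push, h2]) hF.C_le hC1 fun p' =>
    Marks.seq
      (Marks.putIf (φ := (p, none, p') ∈ S.contribTrans) (j := p * C + p') ?e2 ?j2 hD1 (by simp)
        (by simp) (by omega) (by simp) (by simp) ?o2 ?o2')
      ((Marks.forE (m := 1) (N := D) le_rfl (by simp) (by simp) (by trivial)
        (by simp [Ex.eval, push, h1]) hF.D_le hD1 fun b =>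
        Marks.guard (e := .get 11 (.var 20)) (φ := b ∈ V) ?e3 (by omega) (by omega) (by simp)
          (by simp) trivial fun _ =>
        Marks.seq
          (Marks.putIf (φ := (p, some (MemOp.write b), p') ∈ S.contribTrans) (j := p * C + p')
            ?e4 ?j4 le_rfl (by simp) (by simp) (by omega) (by simp) (by simp) ?o4 ?o4')
          (Marks.putIf (φ := (p, some (MemOp.read b), p') ∈ S.contribTrans) (j := p * C + p')
            ?e5 ?j5 le_rfl (by simp) (by simp) (by omega) (by simp) (by simp) ?o5 ?o5')).weaken
        le_rfl (by omega)))) ?_) ?_ (by omega)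
  case e1 => exact (bitE_bd (W := W) ha' (by simp [push, h8]) hT (by simp [push])).2
  case o1 => exact (bitE_bd (p := p) ha' (by simp [push, h8]) hT (by simp [push])).1
  case e2 => simpa [Ex.eval, push, h2] using ha'.ce p p'
  case e3 => simpa [Ex.eval, push] using hV' b
  case e4 => simpa [Ex.eval, push, h2, h1] using ha'.cw p b p'
  case e5 => simpa [Ex.eval, push, h2, h1] using ha'.cr p b p'
  case j2 | j4 | j5 => simp [Ex.eval, push, h2]
  case o2 | o2' | o4' | o5' =>
    exact cmatE_ok hF (by simp [push, h2]) (by simp [push]) (by simp [push])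
  case o4 | o5 =>
    exact ctabE_ok hF (by simp [push, h1]) (by simp [push, h2]) (by simp [push]) (by simp [push])
      (by simp [push])
  · rintro _ rfl
    refine ⟨fun A hA => by rw [fill_of_ne hA, hf₁ A hA], fun p p' => ?_⟩
    rw [fill_pos, h0₁, or_iff_left (by omega)]
    simp only [Set.mem_ofPred_eq, Set.mem_union, idx_inj (Fin.is_lt _) (Fin.is_lt _),
      ← Fin.ext_iff]
    constructor
    · rintro ⟨_, hbit, _, ⟨h, rfl, rfl⟩ | ⟨b, hb, ⟨h, rfl, rfl⟩ | ⟨h, rfl, rfl⟩⟩⟩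
      · exact ⟨hbit, _, .eps, h⟩
      · exact ⟨hbit, _, .write hb, h⟩
      · exact ⟨hbit, _, .read hb, h⟩
    · rintro ⟨hbit, o, ho, h⟩
      refine ⟨p, hbit, p', ?_⟩
      cases ho with
      | eps => exact .inl ⟨h, rfl, rfl⟩
      | write hb => exact .inr ⟨_, hb, .inl ⟨h, rfl, rfl⟩⟩
      | read hb => exact .inr ⟨_, hb, .inr ⟨h, rfl, rfl⟩⟩
  · simp [Ex.size]

/-- Array 17 holds the states reachable from the state `p'` in register 16; collect the values
written by good transitions to `p'`. -/
def writtenP : Prog :=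
  forE 18 (.var 2) (ifE 20 (.const 0) (.get 17 (.var 18)) (ifE 20 (.const 0) (bitE 18)
    (forE 20 (.var 1) (ifE 22 (.const 0) (.get 11 (.var 20))
      (putIf 22 3 (linE (nodeE 18 20) 2 (.var 16)) 13 (.var 20) 1) .skip)) .skip) .skip)

/-- A transition into `p'` lies on a cycle exactly if its source can be reached from `p'`. One
search from `p'` therefore settles all transitions with target `p'`. -/
lemma writtenP_spec (hF : Fits W L D C) (hρ : Env L D C ρ) (ha : Inp S F a) (h8 : ρ 8 = T₀)
    (hT : T₀ ≤ W) (hV : ∀ b : Fin D, 0 < a 11 b ↔ b ∈ V) {p' : Fin C} (h16 : ρ 16 = p')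
    (hR : ∀ p : Fin C, 0 < a 17 p ↔ ReflTransGen (CEdge S T₀ V) p' p) :
    T W writtenP 18 (100 * (C * D)) ρ a fun a' => (∀ A, A ≠ 13 → a' A = a A) ∧
      ∀ b : Fin D, 0 < a' 13 b ↔
        (∃ p, Good S T₀ V p (some (MemOp.write b)) p') ∨ 0 < a 13 b := by
  obtain ⟨h0, h1, h2, h6⟩ := hρ
  have hD1 := hF.D_pos
  refine T.weaken (m := C * (D * 1)) (T.conseq (Marks.t (Marks.forE (N := C) (by omega)
    (by simp) trivial trivial h2 hF.C_le hF.C_pos fun p =>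
    Marks.guard (e := .get 17 (.var 18)) (φ := ReflTransGen (CEdge S T₀ V) p' p) ?e1 (by omega)
      (by omega) (by simp) (by simp) trivial fun _ =>
    Marks.guard (e := bitE 18) (φ := T₀.testBit p = true) ?e2 (by omega) (by omega) (by simp)
      (by simp) ?o2 fun _ =>
    Marks.forE (N := D) le_rfl (by simp) trivial trivial (by simp [Ex.eval, push, h1]) hF.D_le
      hD1 fun b =>
    Marks.guard (e := .get 11 (.var 20)) (φ := b ∈ V) ?e3 (by omega) (by omega) (by simp)
      (by simp) trivial fun _ =>
    Marks.putIf (φ := (p, some (MemOp.write b), p') ∈ S.contribTrans) (j := b)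
      ?e4 ?j4 le_rfl (by simp) (by simp) (by omega) (by simp) (by simp) ?o4 trivial)) ?_) ?_
    (by simp)
  case e1 => simpa [Ex.eval, push] using hR p
  case e2 => exact (bitE_bd (W := W) ha (by simp [push, h8]) hT (by simp [push])).2
  case o2 => exact (bitE_bd (p := p) ha (by simp [push, h8]) hT (by simp [push])).1
  case e3 => simpa [Ex.eval, push] using hV b
  case e4 => simpa [Ex.eval, push, h2, h1, h16] using ha.cw p b p'
  case j4 => simp [Ex.eval, push]
  case o4 =>
    exact ctabE_ok hF (by simp [push, h1]) (by simp [push, h2]) (by simp [push]) (by simp [push])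
      (by simp [push, h16])
  · rintro _ rfl
    refine ⟨fun A hA => fill_of_ne hA, fun b => ?_⟩
    rw [fill_pos]
    refine or_congr_left ?_
    simp only [Set.mem_ofPred_eq, ← Fin.ext_iff]
    constructor
    · rintro ⟨p, hr, hbit, _, hb, h, rfl⟩
      exact ⟨p, hbit, .write hb, h, hr⟩
    · rintro ⟨p, hbit, hb, h, hr⟩
      cases hb with
      | write hb => exact ⟨p, hr, hbit, b, hb, h, rfl⟩
  · simp [Ex.size]

/-- Array 17 holds the states reachable from the state `p'` in register 16; mark cell 0 of array
12 if there is a good transition to `p'`. -/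
def goodFlagP : Prog :=
  forE 18 (.var 2) (ifE 20 (.const 0) (.get 17 (.var 18))
    (putIf 20 14 (linE (.var 18) 2 (.var 16)) 12 (.const 0) 1) .skip)

/-- Here labels are irrelevant, so the edge matrix in array 14 suffices and the scan is linear in
`C`. -/
lemma goodFlagP_spec (hF : Fits W L D C) (hρ : Env L D C ρ)
    (hE : ∀ p p' : Fin C, 0 < a 14 (p * C + p') ↔ CEdge S T₀ V p p')
    {p' : Fin C} (h16 : ρ 16 = p')
    (hR : ∀ p : Fin C, 0 < a 17 p ↔ ReflTransGen (CEdge S T₀ V) p' p) :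
    T W goodFlagP 18 (100 * C) ρ a fun a' => (∀ A, A ≠ 12 → a' A = a A) ∧
      (0 < a' 12 0 ↔ (∃ p o, Good S T₀ V p o p') ∨ 0 < a 12 0) := by
  obtain ⟨h0, h1, h2, h6⟩ := hρ
  refine T.weaken (m := C * 1) (T.conseq (Marks.t (Marks.forE (N := C) (by omega)
    (by simp) trivial trivial h2 hF.C_le hF.C_pos fun p =>
    Marks.guard (e := .get 17 (.var 18)) (φ := ReflTransGen (CEdge S T₀ V) p' p) ?e1 (by omega)
      (by omega) (by simp) (by simp) trivial fun _ =>
    Marks.putIf (φ := CEdge S T₀ V p p') (j := 0) ?e2 rfl le_rfl (by simp) (by simp) (by omega)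
      (by simp) (by simp) ?o2 trivial)) ?_) ?_ (by simp)
  case e1 => simpa [Ex.eval, push] using hR p
  case e2 => simpa [Ex.eval, push, h2, h16] using hE p p'
  case o2 => exact cmatE_ok hF (by simp [push, h2]) (by simp [push]) (by simp [push, h16])
  · rintro _ rfl
    refine ⟨fun A hA => fill_of_ne hA, ?_⟩
    rw [fill_pos]
    refine or_congr_left ?_
    simp only [Set.mem_ofPred_eq, and_true]
    constructor
    · rintro ⟨p, hr, hbit, o, ho, h⟩
      exact ⟨p, o, hbit, ho, h, hr⟩
    · rintro ⟨p, o, hbit, ho, h, hr⟩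
      exact ⟨p, hr, hbit, o, ho, h⟩
  · simp [Ex.size]

/-- Good transitions for the values in array 11: their written values go to array 13, and cell 0
of array 12 is positive if there are any. -/
def goodP : Prog :=
  .seq edgesP (.seq (initP 16 1 13 0) (.seq (storeE 16 12 (.const 0) (.const 0))
    (forE 16 (.var 2) (.seq (reachP 18 2 14 false (.var 16)) (.seq writtenP goodFlagP)))))

/-- For each of the `C` targets there is a search of cost `C * C` and a scan of cost `C * D`. The
invariant of the loop collects the good transitions with targets below `j` and keeps the edge matrix
intact. -/
lemma goodP_spec (hF : Fits W L D C) (hρ : Env L D C ρ) (ha : Inp S F a) (h8 : ρ 8 = T₀)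
    (hT : T₀ ≤ W) (hV : ∀ b : Fin D, 0 < a 11 b ↔ b ∈ V) :
    T W goodP 16 (1000 * (C * (C * C + C * D))) ρ a fun a' => (∀ A < 12, a' A = a A) ∧
      (0 < a' 12 0 ↔ ∃ p o p', Good S T₀ V p o p') ∧
      ∀ b : Fin D, 0 < a' 13 b ↔ b ∈ Writable S T₀ V := by
  have hD1 := hF.D_pos
  have hC1 := hF.C_pos
  have hCD : C ≤ C * D := Nat.le_mul_of_pos_right _ hD1
  have hDC : D ≤ C * D := Nat.le_mul_of_pos_left _ hC1
  have hm : C * C + C * D ≤ C * (C * C + C * D) := Nat.le_mul_of_pos_left _ hC1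
  refine T.weaken (c := 150 + (9 + (3 + 327))) (m := C * (C * C + C * D)) ?_ (by omega) le_rfl
  refine T.seq ((edgesP_spec hF hρ ha h8 hT hV).weaken le_rfl
    (Nat.mul_le_mul_left _ (by omega))) ?_
  rintro a₁ ⟨hf₁, hE₁⟩
  refine T.seq ((initP_spec (by omega) hρ.r1 hD1 hF.D_le).weaken le_rfl (by omega)) ?_
  rintro a₂ ⟨hf₂, hG₂⟩
  refine T.seq (R := fun a' => a' = upd a₂ 12 0 0)
    (T.store trivial trivial trivial trivial (by omega) rfl) ?_
  rintro _ rfl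
  have hf₃ : ∀ A < 12, upd a₂ 12 0 0 A = a A := fun A hA => by
    rw [upd_ne (by omega), hf₂ A (by omega), hf₁ A (by omega)]
  refine (T.forE (N := C) (e := .var 2) (c := 121 + (100 + 100)) (fun j a' => (∀ A < 12, a' A = a A) ∧
    a' 14 = a₁ 14 ∧
    (0 < a' 12 0 ↔ ∃ p o, ∃ p' : Fin C, (p' : ℕ) < j ∧ Good S T₀ V p o p') ∧
    ∀ b : Fin D, 0 < a' 13 b ↔
      ∃ p, ∃ p' : Fin C, (p' : ℕ) < j ∧ Good S T₀ V p (some (MemOp.write b)) p')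
    (by simp) (by trivial) hρ.r2 hF.C_le hC1 (by omega) ?_ ?_ ?_).weaken (by simp [Ex.size]) le_rfl
  · refine ⟨hf₃, ?_, ?_, ?_⟩
    · rw [upd_ne (by omega), hf₂ _ (by omega)]
    · simp [upd_self]
    · intro b
      rw [upd_ne (by omega), hG₂]
      simp
  · rintro j hj a' ⟨hf, h14, hfl, hG⟩
    have hsucc : ∀ Q : Fin C → Prop,
        (∃ p' : Fin C, (p' : ℕ) < j + 1 ∧ Q p') ↔ Q ⟨j, hj⟩ ∨ ∃ p' : Fin C, (p' : ℕ) < j ∧ Q p' := by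
      intro Q
      constructor
      · rintro ⟨p', hp', hQ⟩
        rcases Nat.lt_or_ge p' j with h | h
        · exact .inr ⟨p', h, hQ⟩
        · have : p' = ⟨j, hj⟩ := Fin.ext (show (p' : ℕ) = j by omega)
          exact .inl (this ▸ hQ)
      · rintro (h | ⟨p', h, hQ⟩)
        exacts [⟨_, Nat.lt_succ_self j, h⟩, ⟨p', by omega, hQ⟩]
    have hρ' : Env L D C (push ρ 16 j C) :=
      ⟨by simp [push, hρ.r0], by simp [push, hρ.r1], by simp [push, hρ.r2], by simp [push, hρ.r6]⟩
    have h8' : push ρ 16 j C 8 = T₀ := by simp [push, h8]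
    refine T.seq ((reachP_spec (E := CEdge S T₀ V) false (by omega) (by omega) (by omega)
      hρ'.r2 hF.CC_le (by simpa [h14] using hE₁) (by simp) (by simp) (by trivial) ⟨j, hj⟩
      (by simp [Ex.eval, push])).weaken (by simp [Ex.size]) (by omega)) ?_
    rintro a₄ ⟨hf₄, hR₄⟩
    refine T.seq ((writtenP_spec hF hρ' (ha.congr fun A hA => ?_) h8' hT (V := V) ?_
      (p' := ⟨j, hj⟩) (by simp [push]) hR₄).weaken le_rfl (by omega)) ?_
    · rw [hf₄ A (by omega), hf A (by omega)]
    · rw [hf₄ _ (by omega), hf _ (by omega)]; exact hV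
    rintro a₅ ⟨hf₅, hG₅⟩
    refine ((goodFlagP_spec (S := S) (T₀ := T₀) (V := V) hF hρ' ?_ (p' := ⟨j, hj⟩)
      (by simp [push]) ?_).weaken le_rfl (by omega)).conseq ?_
    · rw [hf₅ 14 (by omega), hf₄ 14 (by omega), h14]; exact hE₁
    · rw [hf₅ 17 (by omega)]; exact hR₄
    rintro a₆ ⟨hf₆, hfl₆⟩
    refine ⟨fun A hA => ?_, ?_, ?_, fun b => ?_⟩
    · rw [hf₆ A (by omega), hf₅ A (by omega), hf₄ A (by omega), hf A hA]
    · rw [hf₆ _ (by omega), hf₅ _ (by omega), hf₄ _ (by omega), h14]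
    · rw [hfl₆, hf₅ 12 (by omega), hf₄ 12 (by omega), hfl]
      simp only [hsucc, exists_or]
    · rw [hf₆ _ (by omega), hG₅, hf₄ 13 (by omega), hG]
      simp only [hsucc, exists_or]
  · rintro a' ⟨hf, -, hfl, hG⟩
    refine ⟨hf, ?_, fun b => ?_⟩
    · rw [hfl]
      simp
    · rw [hG]
      simp [Writable]

end Procedures

end LCSystem

/-! ### Iterating `next` and testing for a cycle through one node. -/

namespace LCSystem

open RAM Relation

section Procedures

variable {W L D C : ℕ} {S : LCSystem (Fin D) (Fin L) (Fin C)} {F : Set (Fin L)} {ρ : ℕ → ℕ}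
  {a : ℕ → ℕ → ℕ} {T₀ : ℕ} {V : Set (Fin D)}

/-- Copy array 17 to array `A`. -/
def copyP (k r A : ℕ) : Prog :=
  .seq (initP k r A 0) (forE k (.var r) (putIf (k + 2) 17 (.var k) A (.var k) 1))

lemma copyP_spec {k r A n : ℕ} (hr : r < k) (hρ : ρ r = n) (hn : 1 ≤ n) (hW : n ≤ W)
    (hA : A ≠ 17) :
    T W (copyP k r A) k (30 * n) ρ a fun a' => (∀ B, B ≠ A → a' B = a B) ∧
      ∀ i : Fin n, 0 < a' A i ↔ 0 < a 17 i := by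
  refine T.weaken (c := 9 + (7 + 6)) (m := n) ?_ (by omega) le_rfl
  refine T.seq (initP_spec hr hρ hn hW) ?_
  rintro a₁ ⟨hf₁, h₁⟩
  refine (T.weaken (m := n * 1) (T.conseq (Marks.t (Marks.forE (N := n) le_rfl hr trivial
    trivial hρ hW hn fun i => Marks.putIf (φ := 0 < a 17 i) (j := i) ?_ ?_ le_rfl (by simp)
      (by simp) hA.symm trivial trivial trivial trivial)) ?_) (by simp [Ex.size]) (by omega))
  · simp [Ex.eval, push, hf₁ 17 hA.symm]
  · simp [Ex.eval, push]
  · rintro _ rfl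
    refine ⟨fun B hB => by rw [fill_of_ne hB, hf₁ B hB], fun i => ?_⟩
    rw [fill_pos, h₁, or_iff_left (by omega)]
    simp only [Set.mem_ofPred_eq]
    constructor
    · rintro ⟨j, hj, h⟩
      rwa [h]
    · exact fun h => ⟨i, h, rfl⟩

lemma reflTransGen_equiv {α β : Type*} (e : α ≃ β) {R : α → α → Prop} {x y : α} :
    ReflTransGen (fun i j => R (e.symm i) (e.symm j)) (e x) (e y) ↔ ReflTransGen R x y := by
  constructor
  · intro h
    simpa [Function.onFun] using h.lift e.symm fun _ _ h => h
  · intro h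
    exact h.lift e fun _ _ h => by simpa [Function.onFun] using h

/-- The values in the strongly connected component of the node in registers 10 and 12 of the
matrix in array 15 are stored in array 11. -/
def nextP : Prog :=
  .seq (reachP 16 6 15 false (nodeE 10 12)) (.seq (copyP 16 6 16)
    (.seq (reachP 16 6 15 true (nodeE 10 12)) (.seq (initP 16 1 11 0)
      (forE 16 (.var 0) (forE 18 (.var 1) (ifE 20 (.const 0) (.get 16 (nodeE 16 18))
        (putIf 20 17 (nodeE 16 18) 11 (.var 18) 1) .skip))))))

lemma cell_div (x y : Fin (L * D)) :
    (x : ℕ) * (L * D) + y = cell ((nodeEquiv L D).symm x) ((nodeEquiv L D).symm y) := by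
  simp [cell]

/-- The component of `n₀` consists of the nodes found by both a forward and a backward search. The
forward result is saved in array 16, because both searches use array 17. The backward result stays
in array 17 for the test of `Accept`. -/
lemma nextP_spec (hF : Fits W L D C) (hρ : Env L D C ρ) {n₀ : Fin L × Fin D}
    (h10 : ρ 10 = n₀.1) (h12 : ρ 12 = n₀.2) {R : Fin L × Fin D → Fin L × Fin D → Prop}
    (hM : ∀ n n', 0 < a 15 (cell n n') ↔ R n n') :
    T W nextP 16 (400 * (L * D * (L * D))) ρ a fun a' =>
      (∀ A < 17, A ≠ 11 → A ≠ 16 → a' A = a A) ∧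
      (∀ b : Fin D, 0 < a' 11 b ↔ ∃ q, ReflTransGen R n₀ (q, b) ∧ ReflTransGen R (q, b) n₀) ∧
      ∀ n, 0 < a' 17 (nodeEquiv L D n) ↔ ReflTransGen R n n₀ := by
  have hLD := hF.LD_pos
  have hLD2 : L * D ≤ L * D * (L * D) := Nat.le_mul_of_pos_left _ hLD
  have hD := hF.D_le_LD
  have hnode := nodeE_bd (a := a) hF hρ.r1 h10 h12
  refine T.weaken (c := 130 + (30 + (130 + (9 + 60)))) (m := L * D * (L * D)) ?_ (by omega) le_rfl
  refine T.seq ((reachP_spec (n := L * D)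
    (E := fun i j => R ((nodeEquiv L D).symm i) ((nodeEquiv L D).symm j)) false (by omega)
    (by omega) (by omega) hρ.r6 hF.node (fun x y => by simpa [cell_div] using hM _ _) (by simp)
    (by simp) hnode.1.1 (nodeEquiv L D n₀) hnode.2).weaken (by simp [Ex.size]) le_rfl) ?_
  rintro a₁ ⟨hf₁, h₁⟩
  refine T.seq ((copyP_spec (by omega) hρ.r6 hLD hF.LD_le (by omega)).weaken le_rfl hLD2) ?_
  rintro a₂ ⟨hf₂, h₂⟩
  have hnode₂ := nodeE_bd (a := a₂) hF hρ.r1 h10 h12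
  refine T.seq ((reachP_spec (n := L * D)
    (E := fun i j => R ((nodeEquiv L D).symm j) ((nodeEquiv L D).symm i)) true (by omega)
    (by omega) (by omega) hρ.r6 hF.node (fun x y => ?_) (by simp)
    (by simp) hnode₂.1.1 (nodeEquiv L D n₀) hnode₂.2).weaken (by simp [Ex.size]) le_rfl) ?_
  · rw [hf₂ 15 (by omega), hf₁ 15 (by omega)]
    simpa [cell_div] using hM _ _
  rintro a₃ ⟨hf₃, h₃⟩
  refine T.seq ((initP_spec (by omega) hρ.r1 hF.D_pos hF.D_le).weaken le_rfl (by omega)) ?_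
  rintro a₄ ⟨hf₄, h₄⟩
  have h16 : ∀ n, 0 < a₄ 16 (nodeEquiv L D n) ↔ ReflTransGen R n₀ n := fun n => by
    rw [hf₄ 16 (by omega), hf₃ 16 (by omega), h₂, h₁]
    exact reflTransGen_equiv _
  have h17 : ∀ n, 0 < a₄ 17 (nodeEquiv L D n) ↔ ReflTransGen R n n₀ := fun n => by
    rw [hf₄ 17 (by omega), h₃,
      ← reflTransGen_equiv (nodeEquiv L D), ← reflTransGen_swap]
  obtain ⟨h0, h1, -, -⟩ := hρ
  refine T.weaken (m := L * (D * 1)) (T.conseq (Marks.t (Marks.forE (N := L) (by simpa using hF.D_pos)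
    (by simp) trivial trivial h0 hF.L_le hF.L_pos fun q => Marks.forE (N := D) le_rfl (by simp)
      trivial trivial (by simp [Ex.eval, push, h1]) hF.D_le hF.D_pos fun x =>
    Marks.guard (e := .get 16 (nodeE 16 18)) (φ := ReflTransGen R n₀ (q, x)) ?e1 (by omega)
      le_rfl (by simp) (by simp) ?o1 fun _ =>
    Marks.putIf (φ := ReflTransGen R (q, x) n₀) (j := x) ?e2 ?j2 le_rfl (by simp) (by simp)
      (by omega) (by simp) (by simp) ?o1 trivial)) ?_) (by simp [Ex.size]) (by simpa using hLD2)
  case o1 | e1 | e2 =>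
    have := nodeE_bd (W := W) (a := a₄) (n := (q, x)) (q := 16) (x := 18)
      (ρ := push (push ρ 16 q L) 18 x D) hF (by simp [push, h1]) (by simp [push]) (by simp [push])
    first
    | exact this.1.1
    | (rw [Ex.eval, this.2]; exact h16 _)
    | (rw [this.2]; exact h17 _)
  case j2 => simp [Ex.eval, push]
  · rintro _ rfl
    refine ⟨fun A hA h11 h16 => ?_, fun b => ?_, fun n => ?_⟩
    · rw [fill_of_ne h11, hf₄ A h11, hf₃ A hA, hf₂ A h16, hf₁ A hA]
    · rw [fill_pos, h₄, or_iff_left (by omega)]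
      simp only [Set.mem_ofPred_eq, ← Fin.ext_iff]
      constructor
      · rintro ⟨q, x, h, h', rfl⟩
        exact ⟨q, h, h'⟩
      · rintro ⟨q, h, h'⟩
        exact ⟨q, b, h, h', rfl⟩
    · rw [fill_of_ne (by omega)]
      exact h17 n

/-- One application of `next` to the set in array 11. -/
def iterP : Prog := .seq goodP (.seq buildP nextP)

/-- Array 11 is advanced to `next S T₀ n₀ V`, whereas the flag, the matrix and the backward search
that remain belong to the old `V`. -/
lemma iterP_spec (hF : Fits W L D C) (hρ : Env L D C ρ) (ha : Inp S F a) (h8 : ρ 8 = T₀)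
    (hT : T₀ ≤ W) {n₀ : Fin L × Fin D} (h10 : ρ 10 = n₀.1) (h12 : ρ 12 = n₀.2)
    (hV : ∀ b : Fin D, 0 < a 11 b ↔ b ∈ V) :
    T W iterP 16 (1550 * (C * (C * C + C * D) + L * D * (L * D))) ρ a fun a' =>
      (∀ A < 11, a' A = a A) ∧ (∀ b : Fin D, 0 < a' 11 b ↔ b ∈ next S T₀ n₀ V) ∧
      (0 < a' 12 0 ↔ ∃ p o p', Good S T₀ V p o p') ∧
      (∀ n n', 0 < a' 15 (cell n n') ↔ MStep S (Writable S T₀ V) n n') ∧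
      ∀ n, 0 < a' 17 (nodeEquiv L D n) ↔ ReflTransGen (MStep S (Writable S T₀ V)) n n₀ := by
  refine T.weaken (c := 1000 + (150 + 400))
    (m := C * (C * C + C * D) + L * D * (L * D)) ?_ le_rfl le_rfl
  refine T.seq ((goodP_spec hF hρ ha h8 hT hV).weaken le_rfl (by omega)) ?_
  rintro a₁ ⟨hf₁, hfl, hG⟩
  refine T.seq ((buildP_spec hF hρ (ha.congr fun A hA => hf₁ A (by omega)) hG).weaken le_rfl
    (by omega)) ?_
  rintro a₂ ⟨hf₂, hM⟩
  refine ((nextP_spec hF hρ h10 h12 hM).weaken le_rfl (by omega)).conseq ?_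
  rintro a₃ ⟨hf₃, hV', hR⟩
  refine ⟨fun A hA => ?_, hV', ?_, fun n n' => ?_, hR⟩
  · rw [hf₃ A (by omega) (by omega) (by omega), hf₂ A (by omega), hf₁ A (by omega)]
  · rw [hf₃ 12 (by omega) (by omega) (by omega), hf₂ 12 (by omega), hfl]
  · rw [hf₃ 15 (by omega) (by omega) (by omega), hM]

/-- Look for a cycle through the node in registers 10 and 12, using the contributor states given
by the bits of register 8. If there is one, mark cell 0 of array 8. -/
def cycleP : Prog :=
  .seq (initP 14 1 11 1) (.seq (forE 14 (.var 1) iterP) (.seq iterP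
    (.seq (putIf 14 12 (.const 0) 8 (.const 0) 1)
      (forE 14 (.var 6) (ifE 16 (.const 0) (.get 15 (linE (nodeE 10 12) 6 (.var 14)))
        (putIf 16 17 (.var 14) 8 (.const 0) 1) .skip)))))

/-- `D` iterations reach the greatest fixed point. `Accept` then asks for a good transition, which
is the flag in array 12, or for an edge from `n₀` to a node of the backward search. -/
lemma cycleP_spec (hF : Fits W L D C) (hρ : Env L D C ρ) (ha : Inp S F a) (h8 : ρ 8 = T₀)
    (hT : T₀ ≤ W) {n₀ : Fin L × Fin D} (h10 : ρ 10 = n₀.1) (h12 : ρ 12 = n₀.2) :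
    T W cycleP 14 (4000 * (D * (C * (C * C + C * D) + L * D * (L * D)))) ρ a fun a' =>
      (∀ A < 11, A ≠ 8 → a' A = a A) ∧
      (0 < a' 8 0 ↔ (∃ V, V ⊆ next S T₀ n₀ V ∧ Accept S T₀ n₀ V) ∨ 0 < a 8 0) := by
  set m := C * (C * C + C * D) + L * D * (L * D) with hm
  have hLD := hF.LD_pos
  have hLD2 : L * D ≤ L * D * (L * D) := Nat.le_mul_of_pos_left _ hLD
  have hLDm : L * D ≤ m := by omega
  have hmD : m ≤ D * m := Nat.le_mul_of_pos_left _ hF.D_pos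
  have hDD := hF.D_le_LD
  clear_value m
  refine T.weaken (c := 9 + ((1550 + 6) + (1550 + 57))) (m := D * m) ?_ (by omega) le_rfl
  refine T.seq ((initP_spec (by omega) hρ.r1 hF.D_pos hF.D_le).weaken le_rfl (by omega)) ?_
  rintro a₁ ⟨hf₁, h₁⟩
  refine T.seq (T.forE (c := 1550) (fun j a' => (∀ A < 11, a' A = a A) ∧
    ∀ b : Fin D, 0 < a' 11 b ↔ b ∈ (next S T₀ n₀)^[j] Set.univ) (by simp) trivial
    hρ.r1 hF.D_le hF.D_pos (by omega) ⟨fun A hA => hf₁ A (by omega), by simp [h₁]⟩ ?_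
    fun _ h => h) ?_
  · rintro j hj a' ⟨hf, hV⟩
    rw [hm]
    refine (iterP_spec (T₀ := T₀) (n₀ := n₀) hF ⟨?_, ?_, ?_, ?_⟩
      (ha.congr fun A hA => hf A (by omega)) ?_ hT ?_ ?_ hV).conseq ?_
    · simp [push, hρ.r0]
    · simp [push, hρ.r1]
    · simp [push, hρ.r2]
    · simp [push, hρ.r6]
    · simp [push, h8]
    · simp [push, h10]
    · simp [push, h12]
    · rintro a'' ⟨hf', hV', -⟩
      refine ⟨fun A hA => by rw [hf' A hA, hf A hA], ?_⟩
      rwa [Function.iterate_succ_apply']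
  rintro a₂ ⟨hf₂, hV₂⟩
  set V := (next S T₀ n₀)^[D] Set.univ with hVdef
  -- One more iteration: the data left by the loop belong to the last but one iterate, and `Accept`
  -- needs them for the fixed point itself.
  refine T.seq (T.weaken (m := m) (T.lift (k' := 16) (by omega) fun ρ' hρ' => ?_) le_rfl hmD)
    (R := fun a' => (∀ A < 11, a' A = a A) ∧
      (0 < a' 12 0 ↔ ∃ p o p', Good S T₀ V p o p') ∧
      (∀ n n', 0 < a' 15 (cell n n') ↔ MStep S (Writable S T₀ V) n n') ∧
      ∀ n, 0 < a' 17 (nodeEquiv L D n) ↔ ReflTransGen (MStep S (Writable S T₀ V)) n n₀) ?_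
  · rw [hm]
    refine (iterP_spec (T₀ := T₀) (n₀ := n₀) hF ⟨?_, ?_, ?_, ?_⟩
      (ha.congr fun A hA => hf₂ A (by omega)) ?_ hT ?_ ?_ hV₂).conseq ?_
    · rw [hρ' 0 (by omega), hρ.r0]
    · rw [hρ' 1 (by omega), hρ.r1]
    · rw [hρ' 2 (by omega), hρ.r2]
    · rw [hρ' 6 (by omega), hρ.r6]
    · rw [hρ' 8 (by omega), h8]
    · rw [hρ' 10 (by omega), h10]
    · rw [hρ' 12 (by omega), h12]
    · rintro a₃ ⟨hf₃, -, h⟩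
      exact ⟨fun A hA => by rw [hf₃ A hA, hf₂ A hA], h⟩
  rintro a₃ ⟨hf₃, hfl, hM, hR⟩
  have hnode := nodeE_bd (a := a₃) (ρ := ρ) hF hρ.r1 h10 h12
  refine T.weaken (m := L * D * 1) (T.conseq (Marks.t (Marks.seq
    (Marks.putIf (φ := ∃ p o p', Good S T₀ V p o p') (j := 0) ?_ rfl (by omega) trivial trivial
      (by omega) trivial trivial trivial trivial)
    (Marks.forE (N := L * D) le_rfl (by simp) trivial trivial hρ.r6 hF.LD_le hLD fun i =>
      Marks.guard (e := .get 15 (linE (nodeE 10 12) 6 (.var 14)))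
        (φ := MStep S (Writable S T₀ V) n₀ ((nodeEquiv L D).symm i)) ?_ (by omega) le_rfl
        (by simp) (by simp) ?_ fun _ =>
      Marks.putIf (φ := ReflTransGen (MStep S (Writable S T₀ V)) ((nodeEquiv L D).symm i) n₀)
        (j := 0) ?_ rfl le_rfl (by simp) trivial (by omega) trivial trivial trivial trivial)))
      ?_) (by simp [Ex.size]) (by omega)
  · exact hfl
  · rw [← hM]
    simp only [Ex.eval, ArithOp.eval, cell]
    simp [push, h10, h12, hρ.r1, hρ.r6, nodeEquiv_val]
  · exact (Ex.Bd.lin (nodeE_bd (n := n₀) hF (by simp [push, hρ.r1]) (by simp [push, h10])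
      (by simp [push, h12])).1 (.var (by simp [push])) (by simp [push, hρ.r6]) hF.node).1
  · rw [← hR]
    simp [Ex.eval, push]
  · rintro _ rfl
    refine ⟨fun A hA h => by rw [fill_of_ne h, hf₃ A hA], ?_⟩
    rw [fill_pos, hf₃ 8 (by omega), exists_accept_iff, ← hVdef, Accept]
    refine or_congr_left (or_congr (by simp) ?_)
    simp only [Set.mem_ofPred_eq, and_true]
    exact ⟨fun ⟨i, h, h'⟩ => ⟨_, h, h'⟩, fun ⟨n, h, h'⟩ => ⟨nodeEquiv L D n, by simpa, by simpa⟩⟩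

end Procedures

end LCSystem

/-! ### Abstract reachability, layer by layer. -/

namespace LCSystem

open RAM Relation

section Main

variable {W L D C : ℕ} {S : LCSystem (Fin D) (Fin L) (Fin C)} {F : Set (Fin L)} {ρ : ℕ → ℕ}
  {a : ℕ → ℕ → ℕ} {T₀ : ℕ}

/-- There is no carry. The machine lacks bitwise operations, so it adds a state to a set by an
addition. -/
lemma or_two_pow_eq_add {T i : ℕ} (h : T.testBit i = false) : T ||| 2 ^ i = T + 2 ^ i := by
  induction i generalizing T with
  | zero =>
    have h₁ := Nat.or_div_two (a := T) (b := 1)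
    have h₂ := Nat.or_mod_two_eq_one (a := T) (b := 1)
    have h₃ : T % 2 = 0 := by simpa [Nat.testBit_zero] using h
    rw [show 1 / 2 = 0 from rfl, Nat.or_zero] at h₁
    rw [pow_zero]
    omega
  | succ i ih =>
    rw [Nat.testBit_succ] at h
    have h₁ := Nat.or_div_two (a := T) (b := 2 ^ (i + 1))
    have h₂ := Nat.or_mod_two_eq_one (a := T) (b := 2 ^ (i + 1))
    have h₃ : 2 ^ (i + 1) / 2 = 2 ^ i := by omega
    have h₄ : 2 ^ (i + 1) % 2 = 0 := by omega
    rw [h₃, ih h] at h₁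
    simp only [h₄] at h₂
    omega

lemma or_two_pow_of_testBit {T i : ℕ} (h : T.testBit i = true) : T ||| 2 ^ i = T := by
  refine Nat.eq_of_testBit_eq fun j => ?_
  rw [Nat.testBit_or, Nat.testBit_two_pow]
  by_cases hj : i = j
  · subst hj; simp [h]
  · simp [hj]

/-- Values written by contributors that stay in `T`. -/
def Inner (S : LCSystem (Fin D) (Fin L) (Fin C)) (T : ℕ) : Set (Fin D) :=
  {b | ∃ p p' : Fin C, T.testBit p = true ∧ T.testBit p' = true ∧
    (p, some (MemOp.write b), p') ∈ S.contribTrans}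

/-- Contributor moves that add a state to `T`. -/
def Enlarge (S : LCSystem (Fin D) (Fin L) (Fin C)) (T : ℕ) (n : Fin L × Fin D) (T' : ℕ)
    (n' : Fin L × Fin D) : Prop :=
  ∃ (p p' : Fin C) (o : Option (MemOp (Fin D))), T.testBit p = true ∧ ¬ T.testBit p' = true ∧
    (p, o, p') ∈ S.contribTrans ∧ MemStep o n.2 n'.2 ∧ n'.1 = n.1 ∧ T' = T ||| 2 ^ (p' : ℕ)

/-- For reachability the supply of contributors is unlimited. Unlike in `Good`, a write between
states of `T` needs no way back. -/
lemma AReach.of_mSteps {T : ℕ} {n n' : Fin L × Fin D} (h : AReach S T n.1 n.2)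
    (hs : ReflTransGen (MStep S (Inner S T)) n n') : AReach S T n'.1 n'.2 := by
  induction hs with
  | refl => exact h
  | tail _ hs ih =>
    rcases hs with ⟨o, hδ, hm⟩ | ⟨hq, p, p', hp, hp', hδ⟩
    · exact ih.leader hδ hm
    · have := ih.contrib hp hδ (.write _ _)
      rw [or_two_pow_of_testBit hp'] at this
      rwa [hq]

lemma AReach.enlarge {T T' : ℕ} {n n' : Fin L × Fin D} (h : AReach S T n.1 n.2)
    (hs : Enlarge S T n T' n') : AReach S T' n'.1 n'.2 := by
  obtain ⟨p, p', o, hp, -, hδ, hm, hq, rfl⟩ := hs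
  rw [hq]
  exact h.contrib hp hδ hm

/-- This is what makes a single pass over the sets in numerical order sufficient. -/
lemma Enlarge.lt {T T' : ℕ} {n n' : Fin L × Fin D} (hs : Enlarge S T n T' n') : T < T' := by
  obtain ⟨p, p', o, -, hp', -, -, -, rfl⟩ := hs
  rw [or_two_pow_eq_add (by simpa using hp')]
  exact Nat.lt_add_of_pos_right (by positivity)

/-- A layer is the closure of the initial configuration and of what is added to it from lower
layers. -/
lemma exists_mSteps_of_aReach {T : ℕ} {X : Set (Fin L × Fin D)}
    (h0 : T = 2 ^ (S.contribInit : ℕ) → (S.leaderInit, S.memInit) ∈ X)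
    (hX : ∀ T₁ n n', AReach S T₁ n.1 n.2 → Enlarge S T₁ n T n' → n' ∈ X)
    {n : Fin L × Fin D} (h : AReach S T n.1 n.2) :
    ∃ n₀ ∈ X, ReflTransGen (MStep S (Inner S T)) n₀ n := by
  obtain ⟨q, x⟩ := n
  simp only at h
  induction h with
  | init => exact ⟨_, h0 rfl, .refl⟩
  | leader h hδ hm ih =>
    obtain ⟨n₀, hn₀, hs⟩ := ih h0 hX
    exact ⟨n₀, hn₀, hs.tail (.inl ⟨_, hδ, hm⟩)⟩
  | @contrib T q a b o p p' h hp hδ hm ih =>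
    by_cases hp' : T.testBit p' = true
    -- The target is already in `T`, so the move stays in the layer, and only a write can change the
    -- node.
    · rw [or_two_pow_of_testBit hp'] at h0 hX ⊢
      obtain ⟨n₀, hn₀, hs⟩ := ih h0 hX
      refine ⟨n₀, hn₀, ?_⟩
      cases hm with
      | write => exact hs.tail (.inr ⟨rfl, p, p', hp, hp', hδ⟩)
      | read => exact hs
      | eps => exact hs
    · exact ⟨_, hX T (q, a) (q, b) h ⟨p, p', o, hp, hp', hδ, hm, rfl, rfl⟩, .refl⟩

/-- Array 10 receives the layer of register 8 that is generated by the cells of array 9. -/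
def layerP : Prog :=
  .seq (initP 10 1 13 0) (.seq
    (forE 10 (.var 2) (ifE 12 (.const 0) (bitE 10) (forE 12 (.var 2)
      (ifE 14 (.const 0) (bitE 12) (forE 14 (.var 1)
        (putIf 16 3 (linE (nodeE 10 14) 2 (.var 12)) 13 (.var 14) 1)) .skip)) .skip))
    (.seq buildP (.seq (initP 10 6 17 0) (.seq
      (forE 10 (.var 6) (putIf 12 9 (linE (.var 8) 6 (.var 10)) 17 (.var 10) 1))
      (.seq (closureP 6 15 false) (copyP 10 6 10))))))

/-- The seeds are the row `T₀` of array 9, and the layer is their closure. It is copied to array 10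
because later searches overwrite array 17. -/
lemma layerP_spec (hF : Fits W L D C) (hρ : Env L D C ρ) (ha : Inp S F a) (h8 : ρ 8 = T₀)
    (hT : T₀ < 2 ^ C) :
    T W layerP 10 (500 * (C * (C * D) + L * D * (L * D))) ρ a fun a' => (∀ A < 10, a' A = a A) ∧
      ∀ n, 0 < a' 10 (nodeEquiv L D n) ↔ ∃ n₀, 0 < a 9 (T₀ * (L * D) + nodeEquiv L D n₀) ∧
        ReflTransGen (MStep S (Inner S T₀)) n₀ n := by
  set m := C * (C * D) + L * D * (L * D) with hm
  have hLD := hF.LD_pos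
  have hLD2 : L * D ≤ L * D * (L * D) := Nat.le_mul_of_pos_left _ hLD
  have hDD := hF.D_le_LD
  have hTW : T₀ ≤ W := hT.le.trans hF.pow_le
  obtain ⟨h0, h1, h2, h6⟩ := id hρ
  refine T.weaken (c := 9 + (90 + (150 + (9 + (20 + (100 + 30)))))) (m := m) ?_ (by omega) le_rfl
  refine T.seq ((initP_spec (by omega) h1 hF.D_pos hF.D_le).weaken le_rfl (by omega)) ?_
  rintro a₁ ⟨hf₁, hG₁⟩
  have ha₁ : Inp S F a₁ := ha.congr fun A hA => hf₁ A (by omega)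
  refine T.seq (R := fun a' => (∀ A, A ≠ 13 → a' A = a A) ∧
    ∀ b : Fin D, 0 < a' 13 b ↔ b ∈ Inner S T₀)
    (T.weaken (m := C * (C * (D * 1))) (T.conseq (Marks.t (Marks.forE (N := C)
      (Nat.mul_pos hF.C_pos (by rw [mul_one]; exact hF.D_pos)) (by simp) trivial trivial h2 hF.C_le
      hF.C_pos fun p =>
      Marks.guard (e := bitE 10) (φ := T₀.testBit p = true) ?e1 (by omega)
        (Nat.mul_pos hF.C_pos (by rw [mul_one]; exact hF.D_pos)) (by simp) (by simp) ?o1 fun _ =>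
      Marks.forE (N := C) (by simpa using hF.D_pos) (by simp) trivial trivial
        (by simp [Ex.eval, push, h2]) hF.C_le hF.C_pos fun p' =>
      Marks.guard (e := bitE 12) (φ := T₀.testBit p' = true) ?e2 (by omega)
        (by simpa using hF.D_pos) (by simp) (by simp) ?o2 fun _ =>
      Marks.forE (N := D) le_rfl (by simp) trivial trivial (by simp [Ex.eval, push, h1])
        hF.D_le hF.D_pos fun b =>
      Marks.putIf (φ := (p, some (MemOp.write b), p') ∈ S.contribTrans) (j := b)
        ?e3 ?j3 le_rfl (by simp) (by simp) (by omega) (by simp) (by simp) ?o3 trivial)) ?_)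
      ?_ (by simp [hm])) ?_
  case e1 => exact (bitE_bd (W := W) ha₁ (by simp [push, h8]) hTW (by simp [push])).2
  case o1 => exact (bitE_bd (p := p) ha₁ (by simp [push, h8]) hTW (by simp [push])).1
  case e2 => exact (bitE_bd (W := W) ha₁ (by simp [push, h8]) hTW (by simp [push])).2
  case o2 => exact (bitE_bd (p := p') ha₁ (by simp [push, h8]) hTW (by simp [push])).1
  case e3 => simpa [Ex.eval, push, h2, h1] using ha₁.cw p b p'
  case j3 => simp [Ex.eval, push]
  case o3 =>
    exact ctabE_ok hF (by simp [push, h1]) (by simp [push, h2]) (by simp [push]) (by simp [push])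
      (by simp [push])
  · rintro _ rfl
    refine ⟨fun A hA => by rw [fill_of_ne hA, hf₁ A hA], fun b => ?_⟩
    rw [fill_pos, hG₁, or_iff_left (by omega)]
    simp only [Set.mem_ofPred_eq, ← Fin.ext_iff]
    constructor
    · rintro ⟨p, hp, p', hp', _, h, rfl⟩
      exact ⟨p, p', hp, hp', h⟩
    · rintro ⟨p, p', hp, hp', h⟩
      exact ⟨p, hp, p', hp', b, h, rfl⟩
  · simp [Ex.size]
  rintro a₂ ⟨hf₂, hG₂⟩
  have ha₂ : Inp S F a₂ := ha.congr fun A hA => hf₂ A (by omega)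
  -- `buildP` works from register 16 on, whereas the level here is 10.
  refine T.seq (T.lift (k' := 16) (by omega) fun ρ' hρ' => (buildP_spec hF ⟨?_, ?_, ?_, ?_⟩ ha₂
    hG₂).weaken le_rfl (by omega)) ?_
  · rw [hρ' 0 (by omega), h0]
  · rw [hρ' 1 (by omega), h1]
  · rw [hρ' 2 (by omega), h2]
  · rw [hρ' 6 (by omega), h6]
  rintro a₃ ⟨hf₃, hM⟩
  refine T.seq ((initP_spec (by omega) h6 hLD hF.LD_le).weaken le_rfl (by omega)) ?_
  rintro a₄ ⟨hf₄, hR₄⟩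
  have hnine : a₄ 9 = a 9 := by
    rw [hf₄ 9 (by omega), hf₃ 9 (by omega), hf₂ 9 (by omega)]
  refine T.seq (R := fun a' => (∀ A, A ≠ 17 → a' A = a₄ A) ∧
    ∀ i : Fin (L * D), 0 < a' 17 i ↔ 0 < a 9 (T₀ * (L * D) + i))
    (T.weaken (m := L * D * 1) (T.conseq (Marks.t (Marks.forE (N := L * D) le_rfl (by simp)
      trivial trivial h6 hF.LD_le hLD fun i =>
      Marks.putIf (φ := 0 < a 9 (T₀ * (L * D) + i)) (j := i) ?_ ?_ le_rfl (by simp) (by simp)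
        (by omega) (by simp) trivial ?_ trivial)) ?_) (by simp [Ex.size]) (by omega)) ?_
  · simp [Ex.eval, push, h8, h6, hnine]
  · simp [Ex.eval, push]
  · exact (Ex.Bd.lin (m := 2 ^ C) (.var (by simpa [push, h8] using hT)) (.var (by simp [push]))
      (by simp [push, h6]) hF.mask).1
  · rintro _ rfl
    refine ⟨fun A hA => fill_of_ne hA, fun i => ?_⟩
    rw [fill_pos, hR₄, or_iff_left (by omega)]
    simp only [Set.mem_ofPred_eq]
    constructor
    · rintro ⟨j, hj, h⟩
      rwa [h]
    · exact fun h => ⟨i, h, rfl⟩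
  rintro a₅ ⟨hf₅, hR₅⟩
  refine T.seq (T.lift (k' := 30) (by omega) fun ρ' hρ' => (closure_spec (n := L * D)
    (E := fun i j => MStep S (Inner S T₀) ((nodeEquiv L D).symm i) ((nodeEquiv L D).symm j))
    false (by omega) (by omega) (by rw [hρ' 6 (by omega), h6]) hLD hF.node
    (fun x y => ?_)).weaken le_rfl (by omega)) ?_
  · rw [hf₅ 15 (by omega), hf₄ 15 (by omega)]
    simpa [cell_div] using hM _ _
  rintro a₆ ⟨hf₆, hR₆⟩
  refine ((copyP_spec (by omega) h6 hLD hF.LD_le (by omega)).weaken le_rfl (by omega)).conseq ?_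
  rintro a₇ ⟨hf₇, h₇⟩
  refine ⟨fun A hA => ?_, fun n => ?_⟩
  · rw [hf₇ A (by omega), hf₆ A (by omega), hf₅ A (by omega), hf₄ A (by omega),
      hf₃ A (by omega), hf₂ A (by omega)]
  · rw [h₇, hR₆]
    constructor
    · rintro ⟨i, hi, hs⟩
      rw [hR₅] at hi
      refine ⟨(nodeEquiv L D).symm i, by simpa using hi, ?_⟩
      rw [← reflTransGen_equiv (nodeEquiv L D)]
      simpa using hs
    · rintro ⟨n₀, hn₀, hs⟩
      exact ⟨nodeEquiv L D n₀, (hR₅ _).2 hn₀, (reflTransGen_equiv (nodeEquiv L D)).2 hs⟩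

/-- Index in array 9 for register 8 enlarged by the state in register 12 and the node in
registers 14 and `y`. -/
abbrev targetE (y : ℕ) : Ex := linE (.bin .add (.var 8) (.get 7 (.var 12))) 6 (nodeE 14 y)

/-- The sum in `targetE` is the enlarged set only because `p'` is not yet in `T₀`; this also keeps
the index within the table. -/
lemma targetE_bd (hF : Fits W L D C) (ha : Inp S F a) (h1 : ρ 1 = D) (h6 : ρ 6 = L * D)
    (h8 : ρ 8 = T₀) (hT : T₀ < 2 ^ C) {p' : Fin C} (h12 : ρ 12 = p')
    (hp' : ¬ T₀.testBit p' = true) {y : ℕ} {n : Fin L × Fin D} (h14 : ρ 14 = n.1)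
    (hy : ρ y = n.2) :
    (targetE y).Ok W ρ a ∧
      (targetE y).eval ρ a = (T₀ ||| 2 ^ (p' : ℕ)) * (L * D) + nodeEquiv L D n := by
  have hlt : T₀ ||| 2 ^ (p' : ℕ) < 2 ^ C :=
    Nat.or_lt_two_pow hT (Nat.pow_lt_pow_right (by norm_num) p'.2)
  rw [or_two_pow_eq_add (by simpa using hp')] at hlt ⊢
  have hn := nodeE_bd (a := a) hF h1 h14 hy
  have hb : (Ex.bin .add (.var 8) (.get 7 (.var 12))).Bd W ρ a (2 ^ C) := by
    have := hF.pow_le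
    simp only [Ex.Bd, Ex.Ok, Ex.eval, ArithOp.eval, h8, h12, ha.pow, true_and]
    exact ⟨by omega, hlt⟩
  refine ⟨(hb.lin hn.1 h6 hF.mask).1, ?_⟩
  rw [eval_linE, hn.2, h6]
  simp [Ex.eval, h8, h12, ha.pow]

/-- Propagate the layer in array 10 to higher layers. -/
def enlargeP : Prog :=
  forE 10 (.var 2) (ifE 12 (.const 0) (bitE 10) (forE 12 (.var 2)
    (ifE 14 (bitE 12) (.const 1) (forE 14 (.var 0) (forE 16 (.var 1)
      (ifE 18 (.const 0) (.get 10 (nodeE 14 16)) (.seq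
        (putIf 18 5 (linE (.var 10) 2 (.var 12)) 9 (targetE 16) 1) (.seq
        (putIf 18 4 (linE (nodeE 10 16) 2 (.var 12)) 9 (targetE 16) 1)
        (forE 18 (.var 1) (putIf 20 3 (linE (nodeE 10 18) 2 (.var 12)) 9 (targetE 18) 1))))
        .skip))) .skip)) .skip)

/-- The loops run over source, target and node, with a further loop over the written value; writes
alone can reach a new memory value. -/
lemma enlargeP_spec (hF : Fits W L D C) (hρ : Env L D C ρ) (ha : Inp S F a) (h8 : ρ 8 = T₀)
    (hT : T₀ < 2 ^ C) :
    T W enlargeP 10 (200 * (C * (C * (L * (D * D))))) ρ a fun a' =>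
      (∀ A, A ≠ 9 → a' A = a A) ∧
      ∀ T' n', 0 < a' 9 (T' * (L * D) + nodeEquiv L D n') ↔
        (∃ n, 0 < a 10 (nodeEquiv L D n) ∧ Enlarge S T₀ n T' n') ∨
          0 < a 9 (T' * (L * D) + nodeEquiv L D n') := by
  have hTW : T₀ ≤ W := hT.le.trans hF.pow_le
  have hL1 := hF.L_pos
  have hD1 := hF.D_pos
  have hC1 := hF.C_pos
  have hm₁ : 1 ≤ L * (D * D) := Nat.mul_pos hL1 (Nat.mul_pos hD1 hD1)
  have hm₂ : 1 ≤ C * (L * (D * D)) := Nat.mul_pos hC1 hm₁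
  obtain ⟨h0, h1, h2, h6⟩ := hρ
  refine T.weaken (m := C * (C * (L * (D * D)))) (T.conseq (Marks.t (Marks.forE (N := C) hm₂
    (by simp) trivial trivial h2 hF.C_le hC1 fun p =>
    Marks.guard (e := bitE 10) (φ := T₀.testBit p = true) ?e1 (by omega) hm₂ (by simp) (by simp)
      ?o1 fun _ =>
    Marks.forE (N := C) hm₁ (by simp) trivial trivial (by simp [Ex.eval, push, h2]) hF.C_le hC1
      fun p' =>
    -- The three kinds of labels are merged into one condition with `MemStep`. The guard that `p'`
    -- is new must be known inside the loops, since `targetE_bd` depends on it.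
    Marks.congr (P' := {i | ¬ T₀.testBit p' = true ∧ ∃ n : Fin L × Fin D,
      0 < a 10 (nodeEquiv L D n) ∧ ∃ n' : Fin L × Fin D, (∃ o, (p, o, p') ∈ S.contribTrans ∧
        MemStep o n.2 n'.2) ∧ n'.1 = n.1 ∧
        i = (T₀ ||| 2 ^ (p' : ℕ)) * (L * D) + nodeEquiv L D n'})
    (Marks.when (by omega) hm₁ (by simp) trivial (by simp) trivial ?o2 trivial fun hbit =>
      have hp' : ¬ T₀.testBit p' = true := ?e2
      Marks.forE (N := L) (Nat.mul_pos hD1 hD1) (by simp) trivial trivial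
        (by simp [Ex.eval, push, h0]) hF.L_le hL1 fun q =>
      Marks.forE (N := D) hD1 (by simp) trivial trivial
        (by simp [Ex.eval, push, h1]) hF.D_le hD1 fun x =>
      Marks.guard (e := .get 10 (nodeE 14 16)) (φ := 0 < a 10 (nodeEquiv L D (q, x))) ?e3
        (by omega) hD1 (by simp) (by simp) ?o3 fun _ =>
      Marks.seq
        (Marks.putIf (φ := (p, none, p') ∈ S.contribTrans)
          (j := (T₀ ||| 2 ^ (p' : ℕ)) * (L * D) + nodeEquiv L D (q, x)) ?e4 ?j4 hD1 (by simp)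
          (by simp) (by omega) (by simp) (by simp) ?o4 ?t4)
      (Marks.seq
        (Marks.putIf (φ := (p, some (MemOp.read x), p') ∈ S.contribTrans)
          (j := (T₀ ||| 2 ^ (p' : ℕ)) * (L * D) + nodeEquiv L D (q, x)) ?e5 ?j4 hD1 (by simp)
          (by simp) (by omega) (by simp) (by simp) ?o5 ?t4)
        ((Marks.forE (m := 1) (N := D) le_rfl (by simp) (by simp) (by trivial)
          (by simp [Ex.eval, push, h1]) hF.D_le hD1 fun y =>
          Marks.putIf (φ := (p, some (MemOp.write y), p') ∈ S.contribTrans)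
            (j := (T₀ ||| 2 ^ (p' : ℕ)) * (L * D) + nodeEquiv L D (q, y)) ?e6 ?j6 le_rfl (by simp)
            (by simp) (by omega) (by simp) (by simp) ?o6 ?t6).weaken le_rfl (by omega)))) ?_)) ?_)
    ?_ le_rfl
  case e1 => exact (bitE_bd (W := W) ha (by simp [push, h8]) hTW (by simp [push])).2
  case o1 => exact (bitE_bd (p := p) ha (by simp [push, h8]) hTW (by simp [push])).1
  case o2 => exact (bitE_bd (p := p') ha (by simp [push, h8]) hTW (by simp [push])).1
  case e2 =>
    rw [← (bitE_bd (W := W) (ρ := push (push ρ 10 p C) 12 p' C) (r := 12) ha (by simp [push, h8])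
      hTW (by simp [push])).2]
    simp only [Ex.eval] at hbit ⊢
    omega
  case e3 | o3 =>
    have := nodeE_bd (W := W) (a := a) (n := (q, x)) (q := 14) (x := 16)
      (ρ := push (push (push (push ρ 10 p C) 12 p' C) 14 q L) 16 x D) hF (by simp [push, h1])
      (by simp [push]) (by simp [push])
    first
    | exact this.1.1
    | (rw [Ex.eval, this.2])
  case e4 => simpa [Ex.eval, push, h2] using ha.ce p p'
  case e5 => simpa [Ex.eval, push, h2, h1] using ha.cr p x p'
  case e6 => simpa [Ex.eval, push, h2, h1] using ha.cw p y p'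
  case o4 => exact cmatE_ok hF (by simp [push, h2]) (by simp [push]) (by simp [push])
  case o5 | o6 =>
    exact ctabE_ok hF (by simp [push, h1]) (by simp [push, h2]) (by simp [push]) (by simp [push])
      (by simp [push])
  case j4 | t4 =>
    have := targetE_bd (n := (q, x)) (y := 16) hF ha
      (ρ := push (push (push (push ρ 10 p C) 12 p' C) 14 q L) 16 x D) (by simp [push, h1])
      (by simp [push, h6]) (by simp [push, h8]) hT (by simp [push]) hp' (by simp [push])
      (by simp [push])
    first | exact this.1 | exact this.2
  case j6 | t6 =>
    have := targetE_bd (n := (q, y)) (y := 18) hF ha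
      (ρ := push (push (push (push (push ρ 10 p C) 12 p' C) 14 q L) 16 x D) 18 y D)
      (by simp [push, h1])
      (by simp [push, h6]) (by simp [push, h8]) hT (by simp [push]) hp' (by simp [push])
      (by simp [push])
    first | exact this.1 | exact this.2
  · have hbit : (bitE 12).eval (push (push ρ 10 p C) 12 p' C) a <
        (Ex.const 1).eval (push (push ρ 10 p C) 12 p' C) a ↔ ¬ T₀.testBit p' = true := by
      rw [← (bitE_bd (W := W) (ρ := push (push ρ 10 p C) 12 p' C) (r := 12) ha
        (by simp [push, h8]) hTW (by simp [push])).2]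
      simp only [Ex.eval]
      omega
    ext i
    simp only [hbit, Set.mem_ofPred_eq, Set.mem_union]
    refine and_congr_right fun _ => ?_
    constructor
    · rintro ⟨q, x, h, ⟨h', rfl⟩ | ⟨h', rfl⟩ | ⟨y, h', rfl⟩⟩
      · exact ⟨(q, x), h, (q, x), ⟨_, h', .eps _⟩, rfl, rfl⟩
      · exact ⟨(q, x), h, (q, x), ⟨_, h', .read _⟩, rfl, rfl⟩
      · exact ⟨(q, x), h, (q, y), ⟨_, h', .write _ _⟩, rfl, rfl⟩
    · rintro ⟨⟨q, x⟩, h, ⟨q', y⟩, ⟨o, h', hm⟩, hq, rfl⟩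
      simp only at hq hm
      subst hq
      refine ⟨q', x, h, ?_⟩
      cases hm with
      | write => exact .inr (.inr ⟨y, h', rfl⟩)
      | read => exact .inr (.inl ⟨h', rfl⟩)
      | eps => exact .inl ⟨h', rfl⟩
  · rintro _ rfl
    refine ⟨fun A hA => fill_of_ne hA, fun T' n' => ?_⟩
    rw [fill_pos]
    refine or_congr_left ?_
    simp only [Set.mem_ofPred_eq, Enlarge]
    constructor
    · rintro ⟨p, hp, p', hp', n, hn, n'', ⟨o, hδ, hm⟩, hq, he⟩
      rw [idx_inj (Fin.is_lt _) (Fin.is_lt _), ← Fin.ext_iff, (nodeEquiv L D).apply_eq_iff_eq] at he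
      obtain ⟨rfl, rfl⟩ := he
      exact ⟨n, hn, p, p', o, hp, hp', hδ, hm, hq, rfl⟩
    · rintro ⟨n, hn, p, p', o, hp, hp', hδ, hm, hq, rfl⟩
      exact ⟨p, hp, p', hp', n, hn, n', ⟨o, hδ, hm⟩, hq, rfl⟩
  · simp [Ex.size]

/-- Look for cycles through the nodes of the layer in array 10 with final leader states. -/
def checkP : Prog :=
  forE 10 (.var 0) (ifE 12 (.const 0) (.get 6 (.var 10)) (forE 12 (.var 1)
    (ifE 14 (.const 0) (.get 10 (nodeE 10 12)) cycleP .skip)) .skip)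

/-- At most `L * D` nodes are tested, each by one run of `cycleP`. The answer in array 8 is only
ever raised, so it accumulates over nodes and layers. -/
lemma checkP_spec (hF : Fits W L D C) (hρ : Env L D C ρ) (ha : Inp S F a) (h8 : ρ 8 = T₀)
    (hT : T₀ ≤ W) :
    T W checkP 10 (5000 * (L * (D * (D * (C * (C * C + C * D) + L * D * (L * D)))))) ρ a
      fun a' => (∀ A < 11, A ≠ 8 → a' A = a A) ∧
      (0 < a' 8 0 ↔ (∃ n : Fin L × Fin D, n.1 ∈ F ∧ 0 < a 10 (nodeEquiv L D n) ∧
        ∃ V, V ⊆ next S T₀ n V ∧ Accept S T₀ n V) ∨ 0 < a 8 0) := by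
  set m := C * (C * C + C * D) + L * D * (L * D) with hm
  have hm1 : 1 ≤ D * m := by
    have := Nat.mul_pos hF.LD_pos hF.LD_pos
    exact Nat.mul_pos hF.D_pos (by omega)
  have hm2 : 1 ≤ D * (D * m) := Nat.mul_pos hF.D_pos hm1
  let Cyc : Fin L × Fin D → Prop := fun n => n.1 ∈ F ∧ 0 < a 10 (nodeEquiv L D n) ∧
        ∃ V, V ⊆ next S T₀ n V ∧ Accept S T₀ n V
  obtain ⟨h0, h1, h2, h6⟩ := hρ
  refine T.weaken (c := 4000 + 8 + 6 + 4 + 6) (m := L * (D * (D * m))) ?_ (by omega) le_rfl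
  refine T.forE (fun j a' => (∀ A < 11, A ≠ 8 → a' A = a A) ∧
    (0 < a' 8 0 ↔ (∃ n, (n.1 : ℕ) < j ∧ Cyc n) ∨ 0 < a 8 0)) (by simp) trivial h0 hF.L_le hF.L_pos
    hm2 ⟨fun _ _ _ => rfl, by simp⟩ ?_ ?_
  · rintro j hj a' ⟨hf, hI⟩
    have hsucc : ∀ P : Fin L × Fin D → Prop, (∃ n, (n.1 : ℕ) < j + 1 ∧ P n) ↔
        (∃ x, P (⟨j, hj⟩, x)) ∨ ∃ n, (n.1 : ℕ) < j ∧ P n := by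
      intro P
      constructor
      · rintro ⟨⟨q, x⟩, hq, hP⟩
        rcases Nat.lt_or_ge q j with h | h
        · exact .inr ⟨(q, x), h, hP⟩
        · have : q = ⟨j, hj⟩ := Fin.ext (show (q : ℕ) = j by simp only at hq; omega)
          exact .inl ⟨x, this ▸ hP⟩
      · rintro (⟨x, h⟩ | ⟨n, h, hP⟩)
        exacts [⟨_, Nat.lt_succ_self j, h⟩, ⟨n, by omega, hP⟩]
    refine T.weaken (c := 4000 + 8 + 6 + 4) (T.when (e₁ := .const 0) (e₂ := .get 6 (.var 10))
      trivial (by simp) trivial trivial hm2 (by omega) (fun hfin => ?_) (fun hfin => ?_)) le_rfl le_rfl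
    · have hjF : (⟨j, hj⟩ : Fin L) ∈ F := by
        rw [← ha.fin, ← hf 6 (by omega) (by omega)]
        simpa [Ex.eval, push] using hfin
      refine T.forE (fun i a'' => (∀ A < 11, A ≠ 8 → a'' A = a A) ∧
        (0 < a'' 8 0 ↔ (∃ x : Fin D, (x : ℕ) < i ∧ Cyc (⟨j, hj⟩, x)) ∨ 0 < a' 8 0)) (by simp)
        trivial (by simp [Ex.eval, push, h1]) hF.D_le hF.D_pos hm1
        ⟨hf, by simp⟩ ?_ ?_
      · rintro i hi a'' ⟨hf', hI'⟩
        have hsucc' : ∀ P : Fin D → Prop, (∃ x : Fin D, (x : ℕ) < i + 1 ∧ P x) ↔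
            P ⟨i, hi⟩ ∨ ∃ x : Fin D, (x : ℕ) < i ∧ P x := by
          intro P
          constructor
          · rintro ⟨x, hx, hP⟩
            rcases Nat.lt_or_ge x i with h | h
            · exact .inr ⟨x, h, hP⟩
            · have : x = ⟨i, hi⟩ := Fin.ext (show (x : ℕ) = i by omega)
              exact .inl (this ▸ hP)
          · rintro (h | ⟨x, h, hP⟩)
            exacts [⟨_, Nat.lt_succ_self i, h⟩, ⟨x, by omega, hP⟩]
        have hnode := nodeE_bd (W := W) (a := a'') (n := (⟨j, hj⟩, ⟨i, hi⟩)) (q := 10) (x := 12)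
          (ρ := push (push ρ 10 j L) 12 i D) hF (by simp [push, h1]) (by simp [push])
          (by simp [push])
        have hten : ∀ i, a'' 10 i = a 10 i := fun i => by rw [hf' 10 (by omega) (by omega)]
        refine T.weaken (c := 4000 + 8) (T.when (e₁ := .const 0)
          (e₂ := .get 10 (nodeE 10 12)) trivial (by simp) trivial hnode.1.1 hm1
          (by omega) (fun hl => ?_) (fun hl => ?_)) (by simp) le_rfl
        · rw [Ex.eval, Ex.eval, hnode.2, hten] at hl
          refine (cycleP_spec (S := S) (F := F) (T₀ := T₀) (n₀ := (⟨j, hj⟩, ⟨i, hi⟩)) hF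
            ⟨?_, ?_, ?_, ?_⟩ (ha.congr fun A hA => ?_) ?_ hT ?_ ?_).conseq ?_
          · simp [push, h0]
          · simp [push, h1]
          · simp [push, h2]
          · simp [push, h6]
          · rw [hf' A (by omega) (by omega)]
          · simp [push, h8]
          · simp [push]
          · simp [push]
          · rintro a₃ ⟨hf₃, h₃⟩
            refine ⟨fun A hA h => by rw [hf₃ A hA h, hf' A hA h], ?_⟩
            rw [h₃, hI', hsucc', or_assoc]
            refine or_congr_left ?_
            exact ⟨fun h => ⟨hjF, hl, h⟩, fun h => h.2.2⟩
        · rw [Ex.eval, Ex.eval, hnode.2, hten] at hl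
          refine ⟨hf', ?_⟩
          rw [hI', hsucc', or_iff_right (a := Cyc _) fun h => hl h.2.1]
      · rintro a'' ⟨hf', hI'⟩
        refine ⟨hf', ?_⟩
        rw [hI', hI, hsucc, or_assoc]
        refine or_congr_left ⟨fun ⟨x, _, h⟩ => ⟨x, h⟩, fun ⟨x, h⟩ => ⟨x, x.2, h⟩⟩
    · have hjF : (⟨j, hj⟩ : Fin L) ∉ F := by
        rw [← ha.fin, ← hf 6 (by omega) (by omega)]
        simpa [Ex.eval, push] using hfin
      refine ⟨hf, ?_⟩
      rw [hI, hsucc, or_iff_right (a := ∃ x, Cyc _) fun ⟨x, h⟩ => hjF h.1]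
  · rintro a' ⟨hf, hI⟩
    refine ⟨hf, ?_⟩
    rw [hI]
    exact or_congr_left ⟨fun ⟨n, _, h⟩ => ⟨n, h⟩, fun ⟨n, h⟩ => ⟨n, n.1.2, h⟩⟩

end Main

end LCSystem

/-! ### The complete search, its cost and the output. -/

namespace LCSystem

open RAM Relation

section Program

variable {W L D C : ℕ} {S : LCSystem (Fin D) (Fin L) (Fin C)} {F : Set (Fin L)}

lemma charTable_pos {A : Set ℕ} {i : ℕ} : 0 < charTable A i ↔ i ∈ A := by
  unfold charTable
  split_ifs with h <;> simp [h]

lemma mem_labelledPos {d m : ℕ} {δ : Set (Fin m × Option (MemOp (Fin d)) × Fin m)}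
    {op : Fin d → MemOp (Fin d)} (q : Fin m) (b : Fin d) (q' : Fin m) :
    ((q : ℕ) * d + b) * m + q' ∈ labelledPos δ op ↔ (q, some (op b), q') ∈ δ := by
  constructor
  · rintro ⟨r, c, r', h, he⟩
    rw [idx_inj q'.2 r'.2, idx_inj b.2 c.2, ← Fin.ext_iff, ← Fin.ext_iff, ← Fin.ext_iff] at he
    obtain ⟨⟨rfl, rfl⟩, rfl⟩ := he
    exact h
  · exact fun h => ⟨q, b, q', h, rfl⟩

lemma mem_epsPos {d m : ℕ} {δ : Set (Fin m × Option (MemOp (Fin d)) × Fin m)} (q q' : Fin m) :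
    (q : ℕ) * m + q' ∈ epsPos δ ↔ (q, none, q') ∈ δ := by
  constructor
  · rintro ⟨r, r', h, he⟩
    rw [idx_inj q'.2 r'.2, ← Fin.ext_iff, ← Fin.ext_iff] at he
    obtain ⟨rfl, rfl⟩ := he
    exact h
  · exact fun h => ⟨q, q', h, rfl⟩

lemma inp_of_encode {a : ℕ → ℕ → ℕ} (ha : ∀ A < 7, a A = (S.encode F).arr A)
    (hp : ∀ p : Fin C, a 7 p = 2 ^ (p : ℕ)) : Inp S F a := by
  constructor
  · intro q b q'
    rw [ha 0 (by omega)]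
    exact charTable_pos.trans (mem_labelledPos q b q')
  · intro q b q'
    rw [ha 1 (by omega)]
    exact charTable_pos.trans (mem_labelledPos q b q')
  · intro q q'
    rw [ha 2 (by omega)]
    exact charTable_pos.trans (mem_epsPos q q')
  · intro q b q'
    rw [ha 3 (by omega)]
    exact charTable_pos.trans (mem_labelledPos q b q')
  · intro q b q'
    rw [ha 4 (by omega)]
    exact charTable_pos.trans (mem_labelledPos q b q')
  · intro q q'
    rw [ha 5 (by omega)]
    exact charTable_pos.trans (mem_epsPos q q')
  · intro q
    rw [ha 6 (by omega)]
    refine charTable_pos.trans ⟨?_, fun h => ⟨q, h, rfl⟩⟩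
    rintro ⟨q', h, he⟩
    rwa [Fin.ext he]
  · exact hp

/-- Powers of two in array 7. -/
def powersP : Prog :=
  .seq (storeE 7 7 (.const 0) (.const 1))
    (forE 7 (.var 2) (storeE 9 7 (.bin .add (.var 7) (.const 1))
      (.bin .add (.get 7 (.var 7)) (.get 7 (.var 7)))))

/-- The powers are produced by doubling. The exponent `C` is included, as `2 ^ C` is the number of
rounds of the main loop. -/
lemma powersP_spec (hF : Fits W L D C) {ρ : ℕ → ℕ} (h2 : ρ 2 = C) (a : ℕ → ℕ → ℕ) :
    T W powersP 7 (20 * C) ρ a fun a' => (∀ A, A ≠ 7 → a' A = a A) ∧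
      ∀ i ≤ C, a' 7 i = 2 ^ i := by
  refine T.weaken (c := 3 + 17) (m := C) ?_ le_rfl le_rfl
  refine T.seq (R := fun a' => a' = upd a 7 0 1) (T.store trivial trivial trivial trivial
    hF.C_pos rfl) ?_
  rintro _ rfl
  refine T.weaken (c := 11 + 6) (m := C * 1) (T.forE (c := 11) (fun j a' =>
    (∀ A, A ≠ 7 → a' A = a A) ∧ ∀ i ≤ j, a' 7 i = 2 ^ i) (by simp) trivial h2 hF.C_le hF.C_pos
    le_rfl ⟨fun A hA => upd_ne hA, ?_⟩ ?_ fun _ h => h) (by omega) (by omega)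
  · intro i hi
    obtain rfl : i = 0 := by omega
    simp [upd_self]
  · rintro j hj a' ⟨hf, hpow⟩
    have hlt : 2 ^ j + 2 ^ j ≤ W := by
      have h₁ : 2 ^ (j + 1) ≤ 2 ^ C := Nat.pow_le_pow_right (by norm_num) hj
      have h₂ := hF.pow_le
      rw [pow_succ] at h₁
      omega
    have hC := hF.C_le
    refine T.mono (T.store (m := 1) (by simp) (by simp) ?_ ?_ le_rfl ⟨fun A hA => ?_, ?_⟩)
      (by simp [Ex.size])
    · simp [Ex.Ok, Ex.eval, push]
      omega
    · simp [Ex.Ok, Ex.eval, push, hpow j le_rfl, hlt]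
    · rw [upd_ne hA, hf A hA]
    · intro i hi
      have hidx : (Ex.bin .add (.var 7) (.const 1)).eval (push ρ 7 j C) a' = j + 1 := by
        simp [Ex.eval, push]
      rw [hidx]
      rcases Nat.lt_or_ge i (j + 1) with h | h
      · rw [upd_of_ne h.ne, hpow i (by omega)]
      · obtain rfl : i = j + 1 := by omega
        rw [upd_self]
        simp [Ex.eval, push, hpow j le_rfl, pow_succ, mul_two]

/-- The search: cell 0 of array 8 becomes positive if the system is live. -/
def searchP : Prog :=
  letE 6 (.bin .mul (.var 0) (.var 1)) (.seq powersP (letE 7 (.get 7 (.var 2)) (.seq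
    (storeE 8 9 (linE (.get 7 (.var 5)) 6 (nodeE 4 3)) (.const 1))
    (forE 8 (.var 7) (.seq layerP (.seq enlargeP checkP))))))

/-- The invariant of the main loop. -/
structure SearchInv (S : LCSystem (Fin D) (Fin L) (Fin C)) (F : Set (Fin L)) (t : ℕ)
    (a : ℕ → ℕ → ℕ) : Prop where
  inp : Inp S F a
  sound : ∀ T n, 0 < a 9 (T * (L * D) + nodeEquiv L D n) → AReach S T n.1 n.2
  init : 0 < a 9 (2 ^ (S.contribInit : ℕ) * (L * D) + nodeEquiv L D (S.leaderInit, S.memInit))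
  closed : ∀ T < t, ∀ n T' n', AReach S T n.1 n.2 → Enlarge S T n T' n' →
    0 < a 9 (T' * (L * D) + nodeEquiv L D n')
  answer : 0 < a 8 0 ↔ ∃ T < t, ∃ n : Fin L × Fin D, n.1 ∈ F ∧ AReach S T n.1 n.2 ∧
    ∃ V, V ⊆ next S T n V ∧ Accept S T n V

/-- Cost of the search within one layer. -/
def layerCost (L D C : ℕ) : ℕ :=
  L * (D * (D * (C * (C * C + C * D) + L * D * (L * D))))

/-- Building a layer costs no more than the cycle tests in it, so `layerCost` serves as the unit for
a whole round. -/
lemma layerP_cost_le (hF : Fits W L D C) :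
    C * (C * D) + L * D * (L * D) ≤ layerCost L D C := by
  have h₁ : C * (C * D) ≤ C * (C * C + C * D) := Nat.mul_le_mul_left _ (by omega)
  calc C * (C * D) + L * D * (L * D) ≤ C * (C * C + C * D) + L * D * (L * D) := by omega
    _ ≤ D * (C * (C * C + C * D) + L * D * (L * D)) := Nat.le_mul_of_pos_left _ hF.D_pos
    _ ≤ D * (D * (C * (C * C + C * D) + L * D * (L * D))) := Nat.le_mul_of_pos_left _ hF.D_pos
    _ ≤ _ := Nat.le_mul_of_pos_left _ hF.L_pos

lemma enlargeP_cost_le (L D C : ℕ) : C * (C * (L * (D * D))) ≤ layerCost L D C := by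
  have h₁ : C * C ≤ C * (C * C + C * D) + L * D * (L * D) := by
    have : C * C ≤ C * (C * C + C * D) :=
      Nat.mul_le_mul_left _ ((Nat.le_mul_self C).trans (by omega))
    omega
  calc C * (C * (L * (D * D))) = L * (D * (D * (C * C))) := by ring
    _ ≤ _ := Nat.mul_le_mul_left _ (Nat.mul_le_mul_left _ (Nat.mul_le_mul_left _ h₁))

/-- Whatever enlarges a set to `t` comes from a smaller number, hence has been recorded in array 9
already. By `exists_mSteps_of_aReach` the closure of the recorded cells is then the entire layer
`t`, and propagating this layer restores the invariant for `t + 1`. -/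
lemma SearchInv.step (hF : Fits W L D C) {ρ : ℕ → ℕ} (hρ : Env L D C ρ) {t : ℕ} (h8 : ρ 8 = t)
    (ht : t < 2 ^ C) {a : ℕ → ℕ → ℕ} (ha : SearchInv S F t a) :
    T W (.seq layerP (.seq enlargeP checkP)) 10 (5700 * layerCost L D C) ρ a
      (SearchInv S F (t + 1)) := by
  refine T.weaken (c := 500 + (200 + 5000)) (m := layerCost L D C) ?_ (by omega) le_rfl
  refine T.seq ((layerP_spec hF hρ ha.inp h8 ht).weaken le_rfl (layerP_cost_le hF)) ?_
  rintro a₁ ⟨hf₁, hlay⟩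
  have hlayer : ∀ n, 0 < a₁ 10 (nodeEquiv L D n) ↔ AReach S t n.1 n.2 := by
    intro n
    rw [hlay]
    constructor
    · rintro ⟨n₀, hn₀, hs⟩
      exact (ha.sound t n₀ hn₀).of_mSteps hs
    · intro h
      obtain ⟨n₀, hn₀, hs⟩ := exists_mSteps_of_aReach
        (X := {n | 0 < a 9 (t * (L * D) + nodeEquiv L D n)})
        (fun he => by
          have := ha.init
          rwa [← he] at this)
        (fun T₁ n n' hn hs => ha.closed T₁ hs.lt n t n' hn hs) h
      exact ⟨n₀, hn₀, hs⟩
  have hi₁ : Inp S F a₁ := ha.inp.congr fun A hA => hf₁ A (by omega)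
  refine T.seq ((enlargeP_spec hF hρ hi₁ h8 ht).weaken le_rfl (enlargeP_cost_le L D C)) ?_
  rintro a₂ ⟨hf₂, hnine⟩
  have hi₂ : Inp S F a₂ := hi₁.congr fun A hA => hf₂ A (by omega)
  refine (checkP_spec hF hρ hi₂ h8 (ht.le.trans hF.pow_le)).conseq ?_
  rintro a₃ ⟨hf₃, hans⟩
  have hmark : ∀ T' n', 0 < a₃ 9 (T' * (L * D) + nodeEquiv L D n') ↔
      (∃ n, AReach S t n.1 n.2 ∧ Enlarge S t n T' n') ∨
        0 < a 9 (T' * (L * D) + nodeEquiv L D n') := by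
    intro T' n'
    rw [hf₃ 9 (by omega) (by omega), hnine, hf₁ 9 (by omega)]
    simp only [hlayer]
  constructor
  · exact hi₂.congr fun A hA => hf₃ A (by omega) (by omega)
  · intro T' n' h
    rcases (hmark T' n').1 h with ⟨n, hn, hs⟩ | h
    exacts [hn.enlarge hs, ha.sound T' n' h]
  · exact (hmark _ _).2 (.inr ha.init)
  · intro T₁ hT₁ n T' n' hn hs
    rcases Nat.lt_or_ge T₁ t with h | h
    · exact (hmark _ _).2 (.inr (ha.closed T₁ h n T' n' hn hs))
    · obtain rfl : T₁ = t := by omega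
      exact (hmark _ _).2 (.inl ⟨n, hn, hs⟩)
  · rw [hans, hf₂ 8 (by omega), hf₁ 8 (by omega), ha.answer, hf₂ 10 (by omega)]
    simp only [hlayer]
    constructor
    · rintro (h | ⟨T₁, hT₁, h⟩)
      exacts [⟨t, Nat.lt_succ_self t, h⟩, ⟨T₁, by omega, h⟩]
    · rintro ⟨T₁, hT₁, h⟩
      rcases Nat.lt_or_ge T₁ t with h' | h'
      · exact .inr ⟨T₁, h', h⟩
      · obtain rfl : T₁ = t := by omega
        exact .inl h

/-- The invariant after `2 ^ C` rounds decides `ALive`, hence liveness. -/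
lemma searchP_spec (hF : Fits W L D C) :
    T W searchP 6 (6000 * (2 ^ C * layerCost L D C)) (S.encode F).reg (S.encode F).arr
      fun a' => 0 < a' 8 0 ↔ S.Live F := by
  have hcost : 1 ≤ layerCost L D C :=
    hF.LD_pos.trans ((Nat.le_mul_of_pos_left _ hF.LD_pos).trans
      ((Nat.le_add_left _ _).trans (layerP_cost_le hF)))
  have hpow : 1 ≤ 2 ^ C := Nat.one_le_two_pow
  have hm : 1 ≤ 2 ^ C * layerCost L D C := Nat.mul_pos hpow hcost
  have hCm : C ≤ 2 ^ C * layerCost L D C :=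
    Nat.lt_two_pow_self.le.trans (Nat.le_mul_of_pos_right _ hcost)
  refine T.weaken (c := 20 + (12 + (5700 + 6) + 3) + 4) (m := 2 ^ C * layerCost L D C) ?_
    (by omega) le_rfl
  refine T.letE (by simp) (by simpa [Ex.Ok, Ex.eval, encode] using hF.LD_le)
    (by simpa [Ex.eval, encode] using hF.LD_le) hm ?_
  generalize hρ₁ : push (S.encode F).reg 6 (Ex.eval (S.encode F).reg (S.encode F).arr
    (.bin .mul (.var 0) (.var 1))) 0 = ρ₁
  have g0 : ρ₁ 0 = L := by rw [← hρ₁]; rfl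
  have g1 : ρ₁ 1 = D := by rw [← hρ₁]; rfl
  have g2 : ρ₁ 2 = C := by rw [← hρ₁]; rfl
  have g3 : ρ₁ 3 = S.memInit := by rw [← hρ₁]; rfl
  have g4 : ρ₁ 4 = S.leaderInit := by rw [← hρ₁]; rfl
  have g5 : ρ₁ 5 = S.contribInit := by rw [← hρ₁]; rfl
  have g6 : ρ₁ 6 = L * D := by rw [← hρ₁]; rfl
  clear hρ₁
  refine T.seq ((powersP_spec hF g2 _).weaken le_rfl hCm) ?_
  rintro a₁ ⟨hf₁, hp₁⟩
  have hev : (Ex.get 7 (.var 2)).eval ρ₁ a₁ = 2 ^ C := by simp [Ex.eval, g2, hp₁ C le_rfl]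
  refine T.letE (e := .get 7 (.var 2)) (by simp) trivial (by rw [hev]; exact hF.pow_le) hm ?_
  rw [hev]
  have hinit : (linE (.get 7 (.var 5)) 6 (nodeE 4 3)).Ok W (push ρ₁ 7 (2 ^ C) 0) a₁ ∧
      (linE (.get 7 (.var 5)) 6 (nodeE 4 3)).eval (push ρ₁ 7 (2 ^ C) 0) a₁ =
        2 ^ (S.contribInit : ℕ) * (L * D) + nodeEquiv L D (S.leaderInit, S.memInit) := by
    have hn := nodeE_bd (W := W) (a := a₁) (n := (S.leaderInit, S.memInit)) (q := 4) (x := 3)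
      (ρ := push ρ₁ 7 (2 ^ C) 0) hF (by simp [push, g1]) (by simp [push, g4]) (by simp [push, g3])
    have hg : (Ex.get 7 (.var 5)).eval (push ρ₁ 7 (2 ^ C) 0) a₁ =
        2 ^ (S.contribInit : ℕ) := by
      simp [Ex.eval, push, g5, hp₁ _ S.contribInit.2.le]
    refine ⟨(Ex.Bd.lin (m := 2 ^ C) ⟨by trivial, ?_⟩ hn.1 (by simp [push, g6]) hF.mask).1, ?_⟩
    · rw [hg]
      exact Nat.pow_lt_pow_right (by norm_num) S.contribInit.2
    · rw [eval_linE, hn.2, hg]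
      simp [push, g6]
  refine T.seq (R := SearchInv S F 0) (T.store (by simp) trivial hinit.1 trivial hm ?_) ?_
  · rw [hinit.2]
    have hi : Inp S F a₁ := inp_of_encode (fun A hA => hf₁ A (by omega)) fun p => hp₁ p p.2.le
    have h9 : ∀ i, 0 < upd a₁ 9 (2 ^ (S.contribInit : ℕ) * (L * D) +
        nodeEquiv L D (S.leaderInit, S.memInit)) 1 9 i ↔
        i = 2 ^ (S.contribInit : ℕ) * (L * D) + nodeEquiv L D (S.leaderInit, S.memInit) := by
      intro i
      rw [upd_eq_fill, fill_pos, hf₁ 9 (by omega)]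
      simp [encode]
    constructor
    · exact hi.congr fun A hA => upd_ne (by omega)
    · intro T n h
      rw [Ex.eval, h9, idx_inj (Fin.is_lt _) (Fin.is_lt _), ← Fin.ext_iff,
        (nodeEquiv L D).apply_eq_iff_eq] at h
      obtain ⟨rfl, rfl⟩ := h
      exact .init
    · exact (h9 _).2 rfl
    · omega
    · rw [upd_ne (by omega), hf₁ 8 (by omega)]
      simp [encode]
  · intro a₂ ha₂
    refine (T.forE (e := .var 7) (c := 5700) (SearchInv S F) (by simp) trivial
      (by simp [Ex.eval, push]) hF.pow_le hpow hcost ha₂ ?_ ?_)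
    · intro t ht a' ha'
      refine SearchInv.step hF ⟨?_, ?_, ?_, ?_⟩ ?_ ht ha'
      · simp [push, g0]
      · simp [push, g1]
      · simp [push, g2]
      · simp [push, g6]
      · simp [push]
    · intro a' ha'
      rw [ha'.answer, live_iff_aLive]
      constructor
      · rintro ⟨T, -, n, hn, hr, hc⟩
        exact ⟨T, n.1, n.2, hn, hr, hc⟩
      · rintro ⟨T, q, x, hq, hr, hc⟩
        -- No set is missed: abstractly reachable ones are numbers below `2 ^ C`.
        exact ⟨T, hr.lt, (q, x), hq, hr, hc⟩

/-- The search, followed by the output of the answer in register 0. -/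
def livenessP : Prog :=
  .seq searchP (.seq (.load 6 8 (.const 0)) (.ifLt (.const 0) (.reg 6)
    (.assign 0 .add (.const 1) (.const 0)) (.assign 0 .add (.const 0) (.const 0))))

lemma exec_livenessP (hF : Fits W L D C) :
    ∃ n s, Exec W livenessP (S.encode F) n s ∧ n ≤ 6000 * (2 ^ C * layerCost L D C) + 3 ∧
      (S.Live F → s.reg 0 = 1) ∧ (¬ S.Live F → s.reg 0 = 0) := by
  obtain ⟨n, s, hs, hn, -, hans⟩ := searchP_spec hF (S := S) (F := F) (S.encode F)
    (fun _ _ => rfl) rfl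
  have hW : 1 ≤ W := hF.L_pos.trans hF.L_le
  by_cases h : 0 < s.arr 8 0
  · refine ⟨_, _, .seq hs (.seq (.load _ _ _ _) (.ifTrue ?_ (.assign _ _ _ _ _ ?_))), ?_, ?_, ?_⟩
    · simpa [Operand.val, State.setReg] using h
    · simpa [Operand.val] using hW
    · omega
    · simp [Operand.val, State.setReg]
    · exact fun h' => absurd (hans.1 h) h'
  · refine ⟨_, _, .seq hs (.seq (.load _ _ _ _) (.ifFalse ?_ (.assign _ _ _ _ _ ?_))), ?_, ?_, ?_⟩
    · simpa [Operand.val, State.setReg] using h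
    · simp [Operand.val]
    · omega
    · exact fun h' => absurd (hans.2 h') h
    · simp [Operand.val, State.setReg]

/-- There is room to spare: the method has `C ^ 3` in place of `L * C ^ 4` and `L ^ 2 * D ^ 2` in
place of `L ^ 2 * D ^ 3`. -/
lemma layerCost_le (L D : ℕ) {C : ℕ} (hL : 1 ≤ L) (hC : 1 ≤ C) (hD : 1 ≤ D) :
    2 ^ C * layerCost L D C ≤ timeBound L D C := by
  have h₁ : C * (C * C) ≤ L * C ^ 4 :=
    calc C * (C * C) ≤ C * (C * C) * (L * C) := Nat.le_mul_of_pos_right _ (Nat.mul_pos hL hC)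
      _ = L * C ^ 4 := by ring
  have h₂ : L * D * (L * D) ≤ L ^ 2 * D ^ 3 :=
    calc L * D * (L * D) ≤ L * D * (L * D) * D := Nat.le_mul_of_pos_right _ hD
      _ = L ^ 2 * D ^ 3 := by ring
  calc 2 ^ C * layerCost L D C
      = 2 ^ C * L * D ^ 2 * (C * (C * C) + D * C ^ 2 + L * D * (L * D)) := by
        unfold layerCost; ring
    _ ≤ timeBound L D C := Nat.mul_le_mul_left _ (by omega)

lemma Fits.of_timeBound (hL : 1 ≤ L) (hD : 1 ≤ D) (hC : 1 ≤ C) (hW : timeBound L D C ≤ W) :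
    Fits W L D C := by
  have hX : 1 ≤ L * D ^ 2 := Nat.mul_pos hL (pow_pos hD 2)
  have h2 : 1 ≤ 2 ^ C := Nat.one_le_two_pow
  have hsum : L * C ^ 4 + D * C ^ 2 + L ^ 2 * D ^ 3 ≤ W :=
    (Nat.le_mul_of_pos_left _ (show 0 < 2 ^ C * L * D ^ 2 by positivity)).trans hW
  refine ⟨hL, hD, hC, ?_, ?_, ?_, ?_⟩
  · calc L * D * (L * D) ≤ L * D * (L * D) * D := Nat.le_mul_of_pos_right _ hD
      _ = L ^ 2 * D ^ 3 := by ring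
      _ ≤ W := by omega
  · calc L * D * L ≤ L * D * L * (D * D) := Nat.le_mul_of_pos_right _ (Nat.mul_pos hD hD)
      _ = L ^ 2 * D ^ 3 := by ring
      _ ≤ W := by omega
  · calc C * D * C = D * C ^ 2 := by ring
      _ ≤ W := by omega
  · have : 1 ≤ D * (L * C ^ 4 + D * C ^ 2 + L ^ 2 * D ^ 3) := by
      have : 1 ≤ D * C ^ 2 := Nat.mul_pos hD (pow_pos hC 2)
      exact Nat.mul_pos hD (by omega)
    calc 2 ^ C * (L * D)
        ≤ 2 ^ C * (L * D) * (D * (L * C ^ 4 + D * C ^ 2 + L ^ 2 * D ^ 3)) :=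
          Nat.le_mul_of_pos_right _ this
      _ = timeBound L D C := by unfold timeBound; ring
      _ ≤ W := hW

end Program

end LCSystem

/-- A single program and a single constant `K` work for all instances. Numbers stay below `K`
times the time bound, so the machine uses words of length logarithmic in its running time. -/
theorem mainTheorem6 :
    ∃ (P : RAM.Prog) (K : ℕ),
      ∀ (L D C : ℕ) (S : LCSystem (Fin D) (Fin L) (Fin C)) (F : Set (Fin L)),
        ∃ (n : ℕ) (s : RAM.State),
          RAM.Exec (K * LCSystem.timeBound L D C) P (S.encode F) n s ∧
          n ≤ K * LCSystem.timeBound L D C ∧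
          (S.Live F → s.reg 0 = 1) ∧
          (¬ S.Live F → s.reg 0 = 0) := by
  -- `6000` for the search and `3` for loading, testing and writing the answer; the latter is
  -- absorbed since the time bound is positive.
  refine ⟨LCSystem.livenessP, 6003, fun L D C S F => ?_⟩
  -- The initial states and the initial memory value witness that all dimensions are positive.
  have hL : 1 ≤ L := S.leaderInit.pos
  have hD : 1 ≤ D := S.memInit.pos
  have hC : 1 ≤ C := S.contribInit.pos
  obtain ⟨n, s, hs, hn, h⟩ := LCSystem.exec_livenessP (S := S) (F := F)
    (LCSystem.Fits.of_timeBound (W := 6003 * LCSystem.timeBound L D C) hL hD hC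
      (Nat.le_mul_of_pos_left _ (by norm_num)))
  have hle := LCSystem.layerCost_le L D hL hC hD
  have hpos : 1 ≤ LCSystem.timeBound L D C := by
    unfold LCSystem.timeBound
    change 0 < _
    positivity
  exact ⟨n, s, hs, by omega, h⟩
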